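/- Let $p,s,n,m,k\ge 0$ be integers and $d=m+1$. Let $P\subset\mathbb R^p$, $Z\subset\mathbb R^n$ and $\mathbf W\subset P\times\mathbb R^s$ be compact, $\mathbf W,Z$ nonempty, and let $s(\varrho,w)\in\mathbb R^s$, $f_0(\varrho,w,z)\in\mathbb R^n$, $q(\varrho,w,z,e)\in\mathbb R$ be $C^1$. Write $\mathbf w=(\varrho,w)$, $\mathbf z=(\varrho,w,z)$, $\mathbf s(\mathbf w)=(0,s(\varrho,w))$, $\mathbf f_0(\mathbf z)=(0,s(\varrho,w),f_0(\varrho,w,z))$, $\mathbf Z=\mathbf W\times Z$. The $\omega$-limit set $\omega(B)$ of a set $B$ under a flow is the set of all limits of sequences $\phi(t_j,x_j)$ with $x_j\in B$, $t_j\to\infty$; let $\mathcal A_0=\omega(\mathbf Z)$ under $\dot{\mathbf z}=\mathbf f_0(\mathbf z)$, and let $\mathbf z(t,\mathbf z_0)$ be the solution through $\mathbf z_0$ at $t=0$. A nonempty set $A$ is called locally exponentially attractive for an autonomous differential equation, with initial conditions in $D$, if there are $M\ge1$, $a>0$, $\delta>0$ such that for each $x_0\in D$ with $\mathrm{dist}(x_0,A)\le\delta$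 the solution $x(t)$ from $x_0$ exists for all $t\ge0$ and $\mathrm{dist}(x(t),A)\le Me^{-at}\,\mathrm{dist}(x_0,A)$. Assume: (i) $\mathbf W$ is a differential submanifold (with boundary) of $\mathbb R^p\times\mathbb R^s$ and is invariant for $\dot{\mathbf w}=\mathbf s(\mathbf w)$. (ii) There is a compact $\mathcal Z\subset\mathbf W\times\mathbb R^n$ containing the positive orbit of $\mathbf Z$ under $\dot{\mathbf z}=\mathbf f_0(\mathbf z)$; $\mathcal A_0$ is a differential submanifold (with boundary); and for some $d_1>0$ every $\mathbf z\in\mathbf W\times\mathbb R^n$ with $\mathrm{dist}(\mathbf z,\mathcal A_0)\le d_1$ lies in $\mathbf Z$. (iii) $\mathcal A_0$ is locally exponentially attractive for $\dot{\mathbf z}=\mathbf f_0(\mathbf z)$, with initial conditions in $\mathbf W\times\mathbb R^n$. (iv) With $A\in\mathbb R^{d\times d}$ having ones on the superdiagonal and zeros elsewhere and $C=(1\ 0\cdots 0)$, there are a map $\tau$ into $\mathbb R^d$ that is $C^1$ on a neighbourhood of $\mathcal Z$, a continuous $\theta:P\to\mathbb R^k$, and $C^1$ maps $\phi:\mathbb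 R\to\mathbb R^d$, $\Omega:\mathbb R\to\mathbb R^{d\times k}$ of compact support such that for all $\mathbf z=(\varrho,w,z)\in\mathcal A_0$ $$\frac{\partial\tau}{\partial\mathbf z}\mathbf f_0(\mathbf z)=A\tau(\mathbf z)+\phi(C\tau(\mathbf z))+\Omega(C\tau(\mathbf z))\theta(\varrho),\qquad -q(\varrho,w,z,0)=C\tau(\mathbf z).$$ Let $\ell>|\theta(\varrho)|$ for all $\varrho\in P$. Let $\mathrm{dz}:\mathbb R\to\mathbb R$ be $C^1$ with $\mathrm{dz}(x)=0$ for $|x|\le\ell$, $\mathrm{dz}(x)=x$ for $|x|\ge\ell+1$ and $x\,\mathrm{dz}(x)\ge0$ for all $x$, and let $\mathrm{dzv}$ apply $\mathrm{dz}$ to each component. For real $b_2,\dots,b_d$ and $\lambda>0$ put $b=(1,b_2,\dots,b_d)^{\rm T}$, $K=Ab+\lambda b$; let $F\in\mathbb R^{(d-1)\times(d-1)}$ have first column $(-b_2,\dots,-b_d)^{\rm T}$ plus ones on the superdiagonal, let $G\in\mathbb R^{(d-1)\times d}$ be $(-b_2,\dots,-b_d)^{\rm T}$ followed by the identity, and for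 $X\in\mathbb R^{(d-1)\times k}$, $y\in\mathbb R$ put $\beta(X,y)=\bigl[CA\binom{0}{X}+C\Omega(y)\bigr]^{\rm T}$. For $\mathbf z\in\mathcal A_0$ put $\sigma(\mathbf z)=\int_{-\infty}^0e^{-Ft}G\,\Omega(\tau_1(\mathbf z(t,\mathbf z)))\,dt$. The zero dynamics of the closed loop are $$\begin{aligned}\dot{\mathbf z}&=\mathbf f_0(\mathbf z),\\ \dot\eta&=A\eta-K[q(\varrho,w,z,0)+\eta_1]+b\,\beta(X,\eta_1)^{\rm T}\tilde\theta+\phi(\eta_1)+\Omega(\eta_1)\theta(\varrho),\\ \dot{\tilde\theta}&=-\beta(X,\eta_1)[q(\varrho,w,z,0)+\eta_1]-\mathrm{dzv}(\tilde\theta+\theta(\varrho)),\\ \dot X&=FX+G\,\Omega(\eta_1).\end{aligned}\tag{$*$}$$ Then there is $\mu>0$ such that the following holds for all $b_2,\dots,b_d$ for which the polynomial $x^{d-1}+b_2x^{d-2}+\dots+b_d$ has $d-1$ distinct roots with negative real part. Suppose (v) for every $\mathbf z_0\in\mathcal A_0$ and $\gamma\in\mathbb R^k$, if $\gamma^{\rm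 T}\beta\bigl(\sigma(\mathbf z(t,\mathbf z_0)),\tau_1(\mathbf z(t,\mathbf z_0))\bigr)=0$ for all $t\in\mathbb R$, then $\gamma=0$, and suppose that either all roots of the polynomial have real part less than $-\mu$, or $\sigma$ is Lipschitz on $\mathcal A_0$. Then there is $\lambda^\star>0$ such that for all $\lambda\ge\lambda^\star$ and all nonempty compact sets $\mathbf H\subset\mathbb R^d$, $\Theta\subset\mathbb R^k$, $\mathbf X\subset\mathbb R^{(d-1)\times k}$, the limit set $\omega(\mathbf B)$ of $\mathbf B=\mathbf Z\times\mathbf H\times\Theta\times\mathbf X$ under $(*)$ is locally exponentially attractive for $(*)$, with initial conditions in $(\mathbf W\times\mathbb R^n)\times\mathbb R^d\times\mathbb R^k\times\mathbb R^{(d-1)\times k}$. -/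

import Mathlib

open Set Filter Topology Matrix

noncomputable section

/-! ## Autonomous differential equations: flow, limit sets, attractivity

All spaces below are finite-dimensional and carry the product norms of Mathlib.  Every notion that
uses a distance (`∃ d₁ > 0`, `∃ M a d`, Lipschitz for some constant) is unaffected by passing to an
equivalent norm, in particular to the Euclidean one. -/

section Dynamics

variable {E : Type*} [NormedAddCommGroup E] [NormedSpace ℝ E]

open Classical in
/-- The flow of `ẋ = f x`: the value at time `t` (of either sign) of a solution that is defined
between `0` and `t` and passes through `x` at time `0`.  If there is no such solution the value
is `x` (not used). -/
def odeFlow (f : E → E) (t : ℝ) (x : E) : E :=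
  if h : ∃ γ : ℝ → E, γ 0 = x ∧ IsIntegralCurveOn γ (fun _ => f) (uIcc 0 t) then h.choose t else x

/-- The `ω`-limit set of the set `B` under the flow of `ẋ = f x`. -/
def odeOmega (f : E → E) (B : Set E) : Set E :=
  omegaLimit atTop (odeFlow f) B

/-- `A` is locally exponentially attractive for `ẋ = f x`, for initial conditions in `D`. -/
def LocallyExponentiallyAttractive (f : E → E) (D A : Set E) : Prop :=
  A.Nonempty ∧ ∃ M : ℝ, 1 ≤ M ∧ ∃ a : ℝ, 0 < a ∧ ∃ d : ℝ, 0 < d ∧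
    ∀ x ∈ D, Metric.infDist x A ≤ d →
      ∃ γ : ℝ → E, γ 0 = x ∧ IsIntegralCurveOn γ (fun _ => f) (Ici 0) ∧
        ∀ t : ℝ, 0 ≤ t →
          Metric.infDist (γ t) A ≤ M * Real.exp (-a * t) * Metric.infDist x A

/-- `A` is invariant for `ẋ = f x` (in forward and backward time). -/
def OdeInvariant (f : E → E) (A : Set E) : Prop :=
  ∀ x ∈ A, ∃ γ : ℝ → E, γ 0 = x ∧ IsIntegralCurve γ (fun _ => f) ∧ ∀ t : ℝ, γ t ∈ A

/-- `S` is an embedded `C¹` submanifold of `E`, possibly with boundary: near each of its points a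
`C¹` change of coordinates of `E` maps `S` onto a `k`-dimensional half space
`{y | 0 ≤ y₁, y_{k+1} = ⋯ = y_N = 0}` (a point if `k = 0`). -/
def IsSubmanifoldWithBoundary (S : Set E) : Prop :=
  ∀ x ∈ S, ∃ (N k : ℕ) (e : OpenPartialHomeomorph E (Fin N → ℝ)),
    x ∈ e.source ∧ ContDiffOn ℝ 1 e e.source ∧ ContDiffOn ℝ 1 e.symm e.target ∧
      e '' (S ∩ e.source) =
        e.target ∩ {y | (∀ i, i.val = 0 → 0 ≤ y i) ∧ ∀ i, k ≤ i.val → y i = 0}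

end Dynamics

/-! ## The plant and its zero dynamics -/

/-- Augmented exogenous state `𝐰 = (ϱ, w)`. -/
abbrev ExoState (p s : ℕ) : Type := (Fin p → ℝ) × (Fin s → ℝ)

/-- State `𝐳 = (ϱ, w, z)` of the augmented zero dynamics of the plant. -/
abbrev ZState (p s n : ℕ) : Type := ExoState p s × (Fin n → ℝ)

/-- The data of the plant `ż = f₀(ϱ,w,z) + f₁(ϱ,w,z,e) e`, `ė = q(ϱ,w,z,e) + u`, and of the
exosystem `ϱ̇ = 0`, `ẇ = s(ϱ,w)`, that enter the zero dynamics (`f₁` does not, as `e = 0` there). -/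
structure Plant (p s n : ℕ) where
  exo : ExoState p s → (Fin s → ℝ)
  f₀ : ZState p s n → (Fin n → ℝ)
  q : ZState p s n × ℝ → ℝ
  contDiff_exo : ContDiff ℝ 1 exo
  contDiff_f₀ : ContDiff ℝ 1 f₀
  contDiff_q : ContDiff ℝ 1 q

namespace Plant

variable {p s n : ℕ} (S : Plant p s n)

/-- The augmented exosystem `𝐬(𝐰) = (0, s(ϱ,w))`. -/
def exoField (w : ExoState p s) : ExoState p s := (0, S.exo w)

/-- The augmented zero dynamics `𝐟₀(𝐳) = (0, s(ϱ,w), f₀(ϱ,w,z))`. -/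
def zeroField (z : ZState p s n) : ZState p s n := (S.exoField z.1, S.f₀ z)

/-- The friend `c(𝐳) = -q(ϱ,w,z,0)`. -/
def c (z : ZState p s n) : ℝ := -S.q (z, 0)

/-- The set `𝒜₀`: the limit set of `𝐙 = 𝐖 × Z` under the augmented zero dynamics. -/
def A₀ (W : Set (ExoState p s)) (Z : Set (Fin n → ℝ)) : Set (ZState p s n) :=
  odeOmega S.zeroField (W ×ˢ Z)

/-- Assumption (i). -/
def AssumptionI (W : Set (ExoState p s)) : Prop :=
  IsSubmanifoldWithBoundary W ∧ OdeInvariant S.exoField W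

/-- Assumption (ii), with its compact set `𝒵`. -/
def AssumptionII (W : Set (ExoState p s)) (Z : Set (Fin n → ℝ)) (𝒵 : Set (ZState p s n)) : Prop :=
  IsCompact 𝒵 ∧ 𝒵 ⊆ W ×ˢ univ ∧
  (∀ z ∈ W ×ˢ Z, ∃ γ : ℝ → ZState p s n, γ 0 = z ∧
    IsIntegralCurveOn γ (fun _ => S.zeroField) (Ici 0) ∧ ∀ t : ℝ, 0 ≤ t → γ t ∈ 𝒵) ∧
  IsSubmanifoldWithBoundary (S.A₀ W Z) ∧
  ∃ d₁ : ℝ, 0 < d₁ ∧ ∀ z ∈ W ×ˢ univ, Metric.infDist z (S.A₀ W Z) ≤ d₁ → z ∈ W ×ˢ Z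

/-- Assumption (iii).  (Shrinking `d₂` does no harm, so the requirement `d₂ ≤ d₁` is omitted.) -/
def AssumptionIII (W : Set (ExoState p s)) (Z : Set (Fin n → ℝ)) : Prop :=
  LocallyExponentiallyAttractive S.zeroField (W ×ˢ univ) (S.A₀ W Z)

end Plant

/-! ## The adaptive internal model

The integer `d` is written `m + 1`, and `k` is the dimension of the parameter estimate. -/

section InternalModel

variable {m k : ℕ}

/-- The matrix `A` of the observable pair: ones on the superdiagonal. -/
def primeA (m : ℕ) : Matrix (Fin (m + 1)) (Fin (m + 1)) ℝ :=
  Matrix.of fun i j => if j.val = i.val + 1 then 1 else 0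

/-- The row `C = (1 0 ⋯ 0)`. -/
def primeC (m : ℕ) : Fin (m + 1) → ℝ := Pi.single 0 1

/-- The column `(1, b₂, …, b_d)`; the free entries `b₂, …, b_d` are `b 0, …, b (m-1)`. -/
def bCol (b : Fin m → ℝ) : Fin (m + 1) → ℝ := Fin.cons 1 b

/-- The matrix `F`: first column `(-b₂, …, -b_d)`, ones on the superdiagonal. -/
def matF (b : Fin m → ℝ) : Matrix (Fin m) (Fin m) ℝ :=
  Matrix.of fun i j => (if j.val = 0 then -b i else 0) + (if j.val = i.val + 1 then 1 else 0)

/-- The matrix `G`: first column `(-b₂, …, -b_d)`, followed by the identity. -/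
def matG (b : Fin m → ℝ) : Matrix (Fin m) (Fin (m + 1)) ℝ :=
  Matrix.of fun i j => (if j.val = 0 then -b i else 0) + (if j.val = i.val + 1 then 1 else 0)

/-- The gain `K = A b + lam b`. -/
def gainK (b : Fin m → ℝ) (lam : ℝ) : Fin (m + 1) → ℝ :=
  primeA m *ᵥ bCol b + lam • bCol b

/-- `M(X)`: the matrix `X` below a row of zeros. -/
def matM (X : Fin m → Fin k → ℝ) : Matrix (Fin (m + 1)) (Fin k) ℝ :=
  Matrix.of (Fin.cons 0 X)

/-- `β(X, y) = [C A M(X) + C Ω(y)]ᵀ`. -/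
def betaFn (Ω : ℝ → Fin (m + 1) → Fin k → ℝ) (X : Fin m → Fin k → ℝ) (y : ℝ) : Fin k → ℝ :=
  primeC m ᵥ* (primeA m * matM X + Matrix.of (Ω y))

/-- The polynomial `λ^(d-1) + b₂ λ^(d-2) + ⋯ + b_d`. -/
def polyB (b : Fin m → ℝ) : Polynomial ℂ :=
  Polynomial.X ^ m + ∑ j : Fin m, Polynomial.C (b j : ℂ) * Polynomial.X ^ (m - 1 - j.val)

/-- The polynomial has `d - 1` distinct roots, all with real part less than `-μ`. -/
def RootsLeftOf (b : Fin m → ℝ) (μ : ℝ) : Prop :=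
  (polyB b).roots.Nodup ∧ ∀ x ∈ (polyB b).roots, x.re < -μ

/-- `dz` is a `C¹` dead-zone function of amplitude `ℓ` (in the transition region `ℓ < |x| < ℓ + 1`
its sign is that of its argument, or it vanishes). -/
def IsDeadZone (ℓ : ℝ) (dz : ℝ → ℝ) : Prop :=
  ContDiff ℝ 1 dz ∧ (∀ x, |x| ≤ ℓ → dz x = 0) ∧ (∀ x, ℓ + 1 ≤ |x| → dz x = x) ∧
    ∀ x, 0 ≤ x * dz x

/-- State `(𝐳, η, θ̃, X)` of the zero dynamics of the closed loop. -/
abbrev LoopState (p s n m k : ℕ) : Type :=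
  ZState p s n × (Fin (m + 1) → ℝ) × (Fin k → ℝ) × (Fin m → Fin k → ℝ)

end InternalModel

namespace Plant

variable {p s n m k : ℕ} (S : Plant p s n)

/-- Assumption (iv), for given maps `τ : 𝒵 → ℝ^d` and `θ : P → ℝ^k`, given `φ`, `Ω` of compact
support, and the observable pair `(A, C)` in canonical form: `τ` is `C¹` on a neighbourhood of `𝒵`
and the immersion property holds on `𝒜₀`. -/
def AssumptionIV (P : Set (Fin p → ℝ)) (W : Set (ExoState p s)) (Z : Set (Fin n → ℝ))
    (𝒵 : Set (ZState p s n)) (τ : ZState p s n → Fin (m + 1) → ℝ)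
    (θ : (Fin p → ℝ) → Fin k → ℝ) (φ : ℝ → Fin (m + 1) → ℝ)
    (Ω : ℝ → Fin (m + 1) → Fin k → ℝ) : Prop :=
  (∃ U : Set (ZState p s n), IsOpen U ∧ 𝒵 ⊆ U ∧ ContDiffOn ℝ 1 τ U) ∧
  ContinuousOn θ P ∧
  ContDiff ℝ 1 φ ∧ HasCompactSupport φ ∧ ContDiff ℝ 1 Ω ∧ HasCompactSupport Ω ∧
  ∀ z ∈ S.A₀ W Z,
    fderiv ℝ τ z (S.zeroField z) =
      primeA m *ᵥ τ z + φ (primeC m ⬝ᵥ τ z) + Matrix.of (Ω (primeC m ⬝ᵥ τ z)) *ᵥ θ z.1.1 ∧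
    S.c z = primeC m ⬝ᵥ τ z

/-- The map `σ(𝐳) = ∫_{-∞}^0 e^{-Fs} G Ω(τ₁(𝐳(s,𝐳))) ds` (used on `𝒜₀`), entry by entry. -/
def sigma (b : Fin m → ℝ) (τ : ZState p s n → Fin (m + 1) → ℝ)
    (Ω : ℝ → Fin (m + 1) → Fin k → ℝ) (z : ZState p s n) : Fin m → Fin k → ℝ :=
  fun i j => ∫ t in Iic (0 : ℝ),
    (NormedSpace.exp ((-t) • matF b) *
      (matG b * Matrix.of (Ω (τ (odeFlow S.zeroField t z) 0)))) i j

/-- Assumption (v): persistence of excitation. -/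
def AssumptionV (W : Set (ExoState p s)) (Z : Set (Fin n → ℝ)) (b : Fin m → ℝ)
    (τ : ZState p s n → Fin (m + 1) → ℝ) (Ω : ℝ → Fin (m + 1) → Fin k → ℝ) : Prop :=
  ∀ z₀ ∈ S.A₀ W Z, ∀ g : Fin k → ℝ,
    (∀ t : ℝ, g ⬝ᵥ betaFn Ω (S.sigma b τ Ω (odeFlow S.zeroField t z₀))
      (τ (odeFlow S.zeroField t z₀) 0) = 0) → g = 0

/-- The zero dynamics of the closed loop:
`𝐳̇ = 𝐟₀(𝐳)`,
`η̇ = A η - K [q(𝐳,0) + η₁] + b βᵀ θ̃ + φ(η₁) + Ω(η₁) θ(ϱ)`,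
`θ̃̇ = -β [q(𝐳,0) + η₁] - dzv(θ̃ + θ(ϱ))`,
`Ẋ = F X + G Ω(η₁)`, with `β = β(X, η₁)`. -/
def loopField (b : Fin m → ℝ) (lam : ℝ) (θ : (Fin p → ℝ) → Fin k → ℝ)
    (φ : ℝ → Fin (m + 1) → ℝ) (Ω : ℝ → Fin (m + 1) → Fin k → ℝ) (dz : ℝ → ℝ) :
    LoopState p s n m k → LoopState p s n m k :=
  fun (z, η, θt, X) =>
    (S.zeroField z,
     primeA m *ᵥ η - (S.q (z, 0) + η 0) • gainK b lam + (betaFn Ω X (η 0) ⬝ᵥ θt) • bCol b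
       + φ (η 0) + Matrix.of (Ω (η 0)) *ᵥ θ z.1.1,
     -(S.q (z, 0) + η 0) • betaFn Ω X (η 0) - (fun i => dz (θt i + θ z.1.1 i)),
     fun i j => (matF b * Matrix.of X + matG b * Matrix.of (Ω (η 0))) i j)

end Plant

end

/-!
The limit set of the closed loop is the graph `{(𝐳, τ(𝐳), 0, σ(𝐳)) | 𝐳 ∈ 𝒜₀}` of its steady state
(`SteadyState.odeOmega_eq`), and this graph is locally exponentially attractive
(`SteadyState.locallyExponentiallyAttractive`).

*Steady state.*  The immersion property makes `τ` a solution of the internal-model equation along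
the orbits of `𝒜₀`, and `σ` is the bounded solution of the filter equation `Ẋ = F X + G Ω(τ₁)`.
The map `σ` is Lipschitz on `𝒜₀` by hypothesis, or because `F` decays faster than orbits of the
plant separate backwards in time: that is where `μ` comes from (`sigma_lipschitz`).  As `𝒜₀` is
compact and invariant, persistence of excitation is uniform over windows of a fixed length `T`
(`exists_excitation_window`).  It also makes `𝐳 ↦ θ(ϱ)` Lipschitz on `𝒜₀`, although `θ` is only
assumed continuous: the integrated immersion equation along two orbits bounds the difference of
their parameters (`theta_lipschitz`).  All this is collected in `exists_steadyState`.

*Error dynamics.*  In the coordinates `y = η₁ - τ₁`, `θ̃` and `χ`, the latter made of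
`G (η - τ)` and `X - σ` in modal coordinates of the companion matrix `F`, the error of a closed-loop
solution with respect to a steady-state solution obeys
`ẏ = -λ y + βᵀθ̃ + …`, `θ̃̇ = -β y - dzv(θ̃ + θ)`, `χ̇ = F χ + …`, up to perturbations of the size `δ`
of the mismatch between the plant state and the point of `𝒜₀` that is followed
(`SteadyState.exists_errorWindow`).  The energy `y² + |θ̃|² + |χ|²` is dissipated because the terms
`± y βᵀθ̃` cancel, because `λ` dominates the cross terms between `y` and `χ`, and because the dead
zone acts against `θ̃` in proportion to its size: this last point uses `|θ| ≤ ℓ' < ℓ`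
(`dead_zone_inner`).  If little energy is lost over a window of length `T`, then `y` and `χ` are
small on the window and `θ̃` hardly moves, so that excitation forces `θ̃` to be small as well.  Hence
the energy contracts by a fixed factor over each window, up to a multiple of `δ²`
(`ErrorWindow.exists_contraction`).

*Convergence.*  On each window the reference orbit is restarted from the point of `𝒜₀` nearest to
the current plant state.  Since the plant approaches `𝒜₀` exponentially, the mismatches decay
geometrically from window to window (`exists_shadowing`), and the contraction can be iterated
(`ErrorWindow.exists_decay_of_windows`).  This gives exponential convergence of the closed loop to
its steady state, uniformly for bounded initial errors (`SteadyState.exists_loop_convergence`).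

The field of the closed loop is only continuous in `ϱ`, but `ϱ` is constant along solutions, so
existence and uniqueness are those of the `C¹` field with frozen parameter (`exists_loop_solution`).
-/

noncomputable section

/-! ### Global flows, uniqueness and localization of vector fields -/

open Metric in
/-- A bounded Lipschitz vector field has global integral curves. -/
theorem exists_isIntegralCurve_of_lipschitz_bounded {E : Type*} [NormedAddCommGroup E]
    [NormedSpace ℝ E] [CompleteSpace E] {g : E → E} {K C : NNReal} (hg : LipschitzWith K g)
    (hC : ∀ x, ‖g x‖ ≤ C) (x : E) :
    ∃ γ : ℝ → E, γ 0 = x ∧ IsIntegralCurve γ (fun _ => g) := by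
  have key : ∀ n : ℕ, ∃ γ : ℝ → E, γ 0 = x ∧
      ∀ t ∈ Icc (-(n + 1 : ℝ)) (n + 1),
        HasDerivWithinAt γ (g (γ t)) (Icc (-(n + 1 : ℝ)) (n + 1)) t := by
    intro n
    have h0 : (0 : ℝ) ∈ Icc (-(n + 1 : ℝ)) (n + 1) := by
      constructor <;> linarith [n.cast_nonneg (α := ℝ)]
    have hp : IsPicardLindelof (fun _ : ℝ => g) (⟨0, h0⟩ : Icc (-(n + 1 : ℝ)) (n + 1)) x
        (C * (n + 1)) 0 C K := by
      refine IsPicardLindelof.of_time_independent (fun y _ => hC y) hg.lipschitzOnWith ?_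
      simp
    simpa using hp.exists_eq_forall_mem_Icc_hasDerivWithinAt₀
  -- the curves on the intervals `[-(n + 1), n + 1]` agree by uniqueness and are glued together
  choose α hα0 hα using key
  have agree : ∀ n m : ℕ, n ≤ m → EqOn (α n) (α m) (Icc (-(n + 1 : ℝ)) (n + 1)) := by
    intro n m hnm
    have hnm' : (n : ℝ) ≤ m := by exact_mod_cast hnm
    have hs : Icc (-(n + 1 : ℝ)) (n + 1) ⊆ Icc (-(m + 1 : ℝ)) (m + 1) :=
      Icc_subset_Icc (by linarith) (by linarith)
    have hn0 : (0 : ℝ) ≤ n := n.cast_nonneg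
    refine ODE_solution_unique_of_mem_Icc (v := fun _ => g) (s := fun _ => univ) (K := K) (t₀ := 0)
      (fun _ _ => hg.lipschitzOnWith) ⟨by linarith, by linarith⟩
      (fun t ht => (hα n t ht).continuousWithinAt)
      (fun t ht => (hα n t (Ioo_subset_Icc_self ht)).hasDerivAt (Icc_mem_nhds ht.1 ht.2))
      (fun _ _ => trivial)
      (fun t ht => ((hα m t (hs ht)).mono hs).continuousWithinAt)
      (fun t ht => ((hα m t (hs (Ioo_subset_Icc_self ht))).mono hs).hasDerivAt
        (Icc_mem_nhds ht.1 ht.2))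
      (fun _ _ => trivial) (by rw [hα0, hα0])
  refine ⟨fun t => α ⌈|t|⌉₊ t, by simp [hα0], fun t => ?_⟩
  set n := ⌈|t|⌉₊ with hn
  have hlt : |t| < n + 1 := lt_of_le_of_lt (Nat.le_ceil _) (by linarith)
  rw [abs_lt] at hlt
  have hmem : Icc (-(n + 1 : ℝ)) (n + 1) ∈ 𝓝 t := Icc_mem_nhds (by linarith) hlt.2
  have hd := (hα n t (mem_of_mem_nhds hmem)).hasDerivAt hmem
  refine hd.congr_of_eventuallyEq ?_
  filter_upwards [hmem] with u hu
  rcases le_total n ⌈|u|⌉₊ with h | h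
  · exact (agree _ _ h hu).symm
  · refine agree _ _ h ⟨?_, ?_⟩ <;>
      linarith [neg_abs_le u, le_abs_self u, Nat.le_ceil |u|]

/-- Trajectories of a Lipschitz field separate at most exponentially, in both time directions. -/
theorem dist_le_of_isIntegralCurve {E : Type*} [NormedAddCommGroup E]
    [NormedSpace ℝ E] {g : E → E} {K : NNReal} (hg : LipschitzWith K g) {γ γ' : ℝ → E}
    (h : IsIntegralCurve γ (fun _ => g)) (h' : IsIntegralCurve γ' (fun _ => g)) (t : ℝ) :
    dist (γ t) (γ' t) ≤ dist (γ 0) (γ' 0) * Real.exp (K * |t|) := by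
  rcases le_total 0 t with ht | ht
  · have := dist_le_of_trajectories_ODE (v := fun _ => g) (fun _ => hg)
      (h.continuous.continuousOn (s := Icc 0 t)) (fun u _ => (h u).hasDerivWithinAt)
      (h'.continuous.continuousOn) (fun u _ => (h' u).hasDerivWithinAt) le_rfl t ⟨ht, le_rfl⟩
    simpa [abs_of_nonneg ht] using this
  · have hneg : LipschitzWith K (fun x => -g x) := hg.neg
    have d : ∀ {γ : ℝ → E}, IsIntegralCurve γ (fun _ => g) →
        IsIntegralCurve (fun u => γ (-u)) (fun _ x => -g x) := by
      intro γ h u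
      have := (h (-u)).scomp u (hasDerivAt_neg u)
      rw [neg_one_smul] at this
      exact this
    have := dist_le_of_trajectories_ODE (v := fun _ x => -g x) (fun _ => hneg)
      ((d h).continuous.continuousOn (s := Icc 0 (-t))) (fun u _ => (d h u).hasDerivWithinAt)
      ((d h').continuous.continuousOn) (fun u _ => (d h' u).hasDerivWithinAt) le_rfl (-t)
      ⟨by linarith, le_rfl⟩
    simpa [abs_of_nonpos ht] using this

/-- The global flow of a bounded Lipschitz vector field. -/
theorem exists_flow_of_lipschitz_bounded {E : Type*} [NormedAddCommGroup E]
    [NormedSpace ℝ E] [CompleteSpace E] {g : E → E} {K C : NNReal} (hg : LipschitzWith K g)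
    (hC : ∀ x, ‖g x‖ ≤ C) :
    ∃ ψ : Flow ℝ E, (∀ x, IsIntegralCurve (fun t => ψ t x) (fun _ => g)) ∧
      ∀ t x y, dist (ψ t x) (ψ t y) ≤ dist x y * Real.exp (K * |t|) := by
  choose γ hγ0 hγ using exists_isIntegralCurve_of_lipschitz_bounded hg hC
  have hdist : ∀ t x y, dist (γ x t) (γ y t) ≤ dist x y * Real.exp (K * |t|) := by
    intro t x y
    simpa [hγ0] using dist_le_of_isIntegralCurve hg (hγ x) (hγ y) t
  have hadd : ∀ t₁ t₂ x, γ x (t₁ + t₂) = γ (γ x t₂) t₁ := by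
    intro t₁ t₂ x
    have h1 : IsIntegralCurve (fun t => γ x (t + t₂)) (fun _ => g) := (hγ x).comp_add t₂
    have := dist_le_of_isIntegralCurve hg h1 (hγ (γ x t₂)) t₁
    simpa [hγ0] using this
  have hcont : Continuous (fun p : ℝ × E => γ p.2 p.1) := by
    rw [continuous_iff_continuousAt]
    rintro ⟨t, x⟩
    rw [ContinuousAt, tendsto_iff_dist_tendsto_zero]
    have h1 : Tendsto (fun p : ℝ × E => dist p.2 x * Real.exp (K * |p.1|) + dist (γ x p.1) (γ x t))
        (𝓝 (t, x)) (𝓝 (dist x x * Real.exp (K * |t|) + dist (γ x t) (γ x t))) := by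
      have : Continuous (fun p : ℝ × E =>
          dist p.2 x * Real.exp (K * |p.1|) + dist (γ x p.1) (γ x t)) := by
        have := (hγ x).continuous
        fun_prop
      exact this.tendsto (t, x)
    refine squeeze_zero (fun _ => dist_nonneg) (fun p => ?_) (by simpa using h1)
    exact (dist_triangle _ (γ x p.1) _).trans (add_le_add_left (hdist _ _ _) _)
  exact ⟨{ toFun := fun t x => γ x t
           cont' := hcont
           map_add' := hadd
           map_zero' := hγ0 }, hγ, hdist⟩

section Curves

variable {E : Type*} [NormedAddCommGroup E] [NormedSpace ℝ E]

theorem IsIntegralCurveOn.hasDerivWithinAt_Ici {γ : ℝ → E} {v : ℝ → E → E} {a b t : ℝ}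
    (h : IsIntegralCurveOn γ v (Icc a b)) (ht : t ∈ Ico a b) :
    HasDerivWithinAt γ (v t (γ t)) (Ici t) t :=
  (h t (Ico_subset_Icc_self ht)).mono_of_mem_nhdsWithin (Icc_mem_nhdsGE_of_mem ht)

theorem IsIntegralCurveOn.hasDerivWithinAt_Iic {γ : ℝ → E} {v : ℝ → E → E} {a b t : ℝ}
    (h : IsIntegralCurveOn γ v (Icc a b)) (ht : t ∈ Ioc a b) :
    HasDerivWithinAt γ (v t (γ t)) (Iic t) t :=
  (h t (Ioc_subset_Icc_self ht)).mono_of_mem_nhdsWithin (Icc_mem_nhdsLE_of_mem ht)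

/-- The value of `odeFlow` is taken from some solution; it is that of `γ` if all solutions agree
with `γ` at time `t`. -/
theorem odeFlow_eq_of_unique {f : E → E} {γ : ℝ → E} {t : ℝ} {x : E} (h0 : γ 0 = x)
    (h : IsIntegralCurveOn γ (fun _ => f) (uIcc 0 t))
    (huniq : ∀ γ' : ℝ → E, γ' 0 = x → IsIntegralCurveOn γ' (fun _ => f) (uIcc 0 t) →
      γ' t = γ t) : odeFlow f t x = γ t := by
  have hex : ∃ γ : ℝ → E, γ 0 = x ∧ IsIntegralCurveOn γ (fun _ => f) (uIcc 0 t) := ⟨γ, h0, h⟩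
  rw [odeFlow, dif_pos hex]
  exact huniq _ hex.choose_spec.1 hex.choose_spec.2

end Curves

section Smooth

variable {E : Type*} [NormedAddCommGroup E] [NormedSpace ℝ E] [FiniteDimensional ℝ E]

/-- A `C¹` field can be modified outside a ball to become bounded and Lipschitz. -/
theorem exists_lipschitz_bounded_eqOn_closedBall {f : E → E} (hf : ContDiff ℝ 1 f) (R : ℝ) :
    ∃ (g : E → E) (K C : NNReal), LipschitzWith K g ∧ (∀ x, ‖g x‖ ≤ C) ∧
      EqOn g f (Metric.closedBall 0 R) := by
  let χ : ContDiffBump (0 : E) := ⟨|R| + 1, |R| + 2, by positivity, by linarith⟩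
  have hs : HasCompactSupport (fun x => χ x • f x) := χ.hasCompactSupport.smul_right
  have hc : ContDiff ℝ 1 (fun x => χ x • f x) := χ.contDiff.smul hf
  obtain ⟨K, hK⟩ := hc.lipschitzWith_of_hasCompactSupport hs (by norm_num)
  obtain ⟨C, hC⟩ := hs.exists_bound_of_continuous hc.continuous
  refine ⟨_, K, C.toNNReal, hK, fun x => (hC x).trans (Real.le_coe_toNNReal C), fun x hx => ?_⟩
  have : χ x = 1 := χ.one_of_mem_closedBall
    (Metric.closedBall_subset_closedBall (show R ≤ |R| + 1 by linarith [le_abs_self R]) hx)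
  simp [this]

theorem ContDiff.exists_lipschitzOnWith_closedBall {F : Type*} [NormedAddCommGroup F]
    [NormedSpace ℝ F] {f : E → F} (hf : ContDiff ℝ 1 f)
    (R : ℝ) : ∃ K : NNReal, LipschitzOnWith K f (Metric.closedBall 0 R) :=
  haveI : ProperSpace E := FiniteDimensional.proper ℝ E
  hf.contDiffOn.exists_lipschitzOnWith (by norm_num) (convex_closedBall 0 R)
    (isCompact_closedBall 0 R)

theorem exists_common_lipschitz_ball {f : E → E} (hf : ContDiff ℝ 1 f) {γ γ' : ℝ → E} {a b : ℝ}
    (h : ContinuousOn γ (Icc a b)) (h' : ContinuousOn γ' (Icc a b)) :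
    ∃ (s : Set E) (K : NNReal), LipschitzOnWith K f s ∧
      (∀ t ∈ Icc a b, γ t ∈ s) ∧ ∀ t ∈ Icc a b, γ' t ∈ s := by
  obtain ⟨R, hR⟩ := isCompact_Icc.exists_bound_of_continuousOn h
  obtain ⟨R', hR'⟩ := isCompact_Icc.exists_bound_of_continuousOn h'
  obtain ⟨K, hK⟩ := hf.exists_lipschitzOnWith_closedBall (max R R')
  exact ⟨_, K, hK, fun t ht => by simpa using Or.inl (hR t ht),
    fun t ht => by simpa using Or.inr (hR' t ht)⟩

/-- Uniqueness for `C¹` fields, forwards and backwards in time. -/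
theorem isIntegralCurveOn_eq_of_contDiff {f : E → E} (hf : ContDiff ℝ 1 f) {γ γ' : ℝ → E} {t : ℝ}
    (h : IsIntegralCurveOn γ (fun _ => f) (uIcc 0 t))
    (h' : IsIntegralCurveOn γ' (fun _ => f) (uIcc 0 t)) (h0 : γ 0 = γ' 0) :
    EqOn γ γ' (uIcc 0 t) := by
  rcases le_total 0 t with ht | ht
  · rw [uIcc_of_le ht] at h h' ⊢
    obtain ⟨s, K, hK, hs, hs'⟩ := exists_common_lipschitz_ball hf h.continuousOn h'.continuousOn
    exact ODE_solution_unique_of_mem_Icc_right (v := fun _ => f) (s := fun _ => s)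
      (fun _ _ => hK) h.continuousOn
      (fun u hu => h.hasDerivWithinAt_Ici hu) (fun u hu => hs u (Ico_subset_Icc_self hu))
      h'.continuousOn
      (fun u hu => h'.hasDerivWithinAt_Ici hu) (fun u hu => hs' u (Ico_subset_Icc_self hu)) h0
  · rw [uIcc_of_ge ht] at h h' ⊢
    obtain ⟨s, K, hK, hs, hs'⟩ := exists_common_lipschitz_ball hf h.continuousOn h'.continuousOn
    exact ODE_solution_unique_of_mem_Icc_left (v := fun _ => f) (s := fun _ => s)
      (fun _ _ => hK) h.continuousOn
      (fun u hu => h.hasDerivWithinAt_Iic hu) (fun u hu => hs u (Ioc_subset_Icc_self hu))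
      h'.continuousOn
      (fun u hu => h'.hasDerivWithinAt_Iic hu) (fun u hu => hs' u (Ioc_subset_Icc_self hu)) h0

theorem odeFlow_eq_of_contDiff {f : E → E} (hf : ContDiff ℝ 1 f) {γ : ℝ → E} {t : ℝ} {x : E}
    (h0 : γ 0 = x) (h : IsIntegralCurveOn γ (fun _ => f) (uIcc 0 t)) : odeFlow f t x = γ t :=
  odeFlow_eq_of_unique h0 h fun _ h0' h' =>
    isIntegralCurveOn_eq_of_contDiff hf h' h (h0'.trans h0.symm) right_mem_uIcc

/-- A `C¹` field whose solutions from `x` obey an a priori bound on every finite horizon has a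
solution from `x` for all positive times. -/
theorem exists_isIntegralCurveOn_Ici {f : E → E} (hf : ContDiff ℝ 1 f) {x : E}
    (hb : ∀ T : ℝ, ∃ R : ℝ, ∀ t ∈ Icc 0 T, ∀ γ : ℝ → E, γ 0 = x →
      IsIntegralCurveOn γ (fun _ => f) (Icc 0 t) → ‖γ t‖ ≤ R) :
    ∃ γ : ℝ → E, γ 0 = x ∧ IsIntegralCurveOn γ (fun _ => f) (Ici 0) := by
  have key : ∀ T : ℝ, ∃ γ : ℝ → E, γ 0 = x ∧ IsIntegralCurveOn γ (fun _ => f) (Icc 0 T) := by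
    intro T
    rcases lt_or_ge T 0 with hT | hT
    · exact ⟨fun _ => x, rfl, by rw [Icc_eq_empty (not_le.2 hT)]; exact fun _ h => h.elim⟩
    obtain ⟨R, hR⟩ := hb T
    obtain ⟨g, K, C, hK, hC, hgf⟩ := exists_lipschitz_bounded_eqOn_closedBall hf (R + 1)
    obtain ⟨γ, h0, hγ⟩ := exists_isIntegralCurve_of_lipschitz_bounded hK hC x
    have hsol : ∀ t, (∀ u ∈ Icc 0 t, ‖γ u‖ ≤ R + 1) →
        IsIntegralCurveOn γ (fun _ => f) (Icc 0 t) := by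
      intro t ht u hu
      have := hgf (show γ u ∈ Metric.closedBall 0 (R + 1) by simpa using ht u hu)
      simpa [this] using (hγ u).hasDerivWithinAt
    have hR0 : ‖γ 0‖ ≤ R := by
      refine hR 0 ⟨le_rfl, hT⟩ γ h0 ?_
      intro u hu
      rw [Icc_self, mem_singleton_iff] at hu
      subst hu
      rw [Icc_self]
      exact HasFDerivWithinAt.of_subsingleton subsingleton_singleton
    have hN : Continuous (fun t => ‖γ t‖) := hγ.continuous.norm
    refine ⟨γ, h0, hsol T ?_⟩
    by_contra! hcon
    obtain ⟨t₁, ht₁, hlt⟩ := hcon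
    -- the first time at which the curve leaves the ball of radius `R + 1` contradicts the bound
    let A : Set ℝ := Icc 0 t₁ ∩ {u | ‖γ u‖ = R + 1}
    have hAc : IsCompact A := isCompact_Icc.inter_right (isClosed_eq hN continuous_const)
    have hAne : A.Nonempty := by
      obtain ⟨u, hu, hu'⟩ := intermediate_value_Icc ht₁.1 hN.continuousOn
        (show R + 1 ∈ Icc ‖γ 0‖ ‖γ t₁‖ from ⟨by linarith, hlt.le⟩)
      exact ⟨u, hu, hu'⟩
    obtain ⟨s, hsA, hs⟩ := hAc.exists_isLeast hAne
    have hle : ∀ u ∈ Icc 0 s, ‖γ u‖ ≤ R + 1 := by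
      intro u hu
      by_contra! hu'
      obtain ⟨v, hv, hv'⟩ := intermediate_value_Icc hu.1 hN.continuousOn
        (show R + 1 ∈ Icc ‖γ 0‖ ‖γ u‖ from ⟨by linarith, hu'.le⟩)
      have hvs := hs (show v ∈ A from ⟨⟨hv.1, hv.2.trans (hu.2.trans hsA.1.2)⟩, hv'⟩)
      have : u = v := le_antisymm (hu.2.trans hvs) hv.2
      subst this
      exact hu'.ne' hv'
    have h1 := hR s ⟨hsA.1.1, hsA.1.2.trans ht₁.2⟩ γ h0 (hsol s hle)
    have h2 : ‖γ s‖ = R + 1 := hsA.2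
    linarith
  choose α hα0 hα using fun n : ℕ => key (n + 1)
  have agree : ∀ n m : ℕ, n ≤ m → EqOn (α n) (α m) (Icc 0 (n + 1 : ℝ)) := by
    intro n m hnm
    have hnm' : (n : ℝ) ≤ m := by exact_mod_cast hnm
    have hn0 : (0 : ℝ) ≤ n + 1 := by positivity
    rw [← uIcc_of_le hn0]
    refine isIntegralCurveOn_eq_of_contDiff hf ?_ ?_ (by rw [hα0, hα0])
    · rw [uIcc_of_le hn0]; exact hα n
    · rw [uIcc_of_le hn0]; exact (hα m).mono (Icc_subset_Icc le_rfl (by linarith))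
  refine ⟨fun t => α ⌈t⌉₊ t, by simp [hα0], fun t ht => ?_⟩
  set n := ⌈t⌉₊ with hn
  have hlt : t < n + 1 := lt_of_le_of_lt (Nat.le_ceil _) (by linarith)
  have hmem : Icc 0 (n + 1 : ℝ) ∈ 𝓝[Ici 0] t := by
    rw [← Ici_inter_Iic]
    exact inter_mem self_mem_nhdsWithin (mem_nhdsWithin_of_mem_nhds (Iic_mem_nhds hlt))
  have hd := (hα n t ⟨ht, hlt.le⟩).mono_of_mem_nhdsWithin hmem
  refine hd.congr_of_eventuallyEq ?_ rfl
  filter_upwards [hmem] with u hu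
  rcases le_total n ⌈u⌉₊ with h | h
  · exact (agree _ _ h hu).symm
  · exact agree _ _ h ⟨hu.1, (Nat.le_ceil u).trans (by linarith)⟩

end Smooth

/-! ### Comparison lemmas and the error window -/

section Comparison

theorem sub_le_of_hasDerivWithinAt_le {f f' : ℝ → ℝ} {a b c : ℝ} (hab : a ≤ b)
    (hf : ∀ t ∈ Icc a b, HasDerivWithinAt f (f' t) (Icc a b) t)
    (h : ∀ t ∈ Icc a b, f' t ≤ c) : f b - f a ≤ c * (b - a) := by
  have hB : ∀ t, HasDerivAt (fun t => f a + c * (t - a)) c t := fun t => by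
    simpa using (((hasDerivAt_id t).sub_const a).const_mul c).const_add (f a)
  have := image_le_of_deriv_right_le_deriv_boundary (f := f) (f' := f') (a := a) (b := b)
    (B := fun t => f a + c * (t - a)) (B' := fun _ => c)
    (fun t ht => (hf t ht).continuousWithinAt)
    (fun t ht => (hf t (Ico_subset_Icc_self ht)).mono_of_mem_nhdsWithin (Icc_mem_nhdsGE_of_mem ht))
    (by simp) (fun t _ => (hB t).continuousAt.continuousWithinAt)
    (fun t _ => (hB t).hasDerivWithinAt)
    (fun t ht => h t (Ico_subset_Icc_self ht)) ⟨hab, le_rfl⟩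
  linarith [this]

/-- Grönwall's inequality for a scalar differential inequality `f' ≤ K f`. -/
theorem le_mul_exp_of_hasDerivWithinAt_le {f f' : ℝ → ℝ} {T K : ℝ}
    (hf : ∀ t ∈ Icc 0 T, HasDerivWithinAt f (f' t) (Icc 0 T) t)
    (h : ∀ t ∈ Icc 0 T, f' t ≤ K * f t) {t : ℝ} (ht : t ∈ Icc 0 T) :
    f t ≤ f 0 * Real.exp (K * t) := by
  have hs : Icc 0 t ⊆ Icc 0 T := Icc_subset_Icc le_rfl ht.2
  have he : ∀ u, HasDerivAt (fun u => Real.exp (-K * u)) (Real.exp (-K * u) * (-K)) u := fun u => by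
    simpa using ((hasDerivAt_id u).const_mul (-K)).exp
  have := sub_le_of_hasDerivWithinAt_le (f := fun u => f u * Real.exp (-K * u))
    (f' := fun u => f' u * Real.exp (-K * u) + f u * (Real.exp (-K * u) * (-K))) (c := 0) ht.1
    (fun u hu => ((hf u (hs hu)).mono hs).mul (he u).hasDerivWithinAt)
    (fun u hu => by nlinarith [h u (hs hu), Real.exp_pos (-K * u)])
  have h2 : f t * Real.exp (-K * t) ≤ f 0 := by simpa using this
  calc f t = f t * Real.exp (-K * t) * Real.exp (K * t) := by
        rw [mul_assoc, ← Real.exp_add]; simp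
    _ ≤ _ := mul_le_mul_of_nonneg_right h2 (Real.exp_pos _).le

/-- If `E' ≤ -a P + e` and `P` varies at rate at most `B`, a large value of `P` at one time forces
a drop of `E` over the whole window. -/
theorem sq_le_of_dissipation {E E' P P' : ℝ → ℝ} {T a e B t₁ : ℝ} (ha : 0 ≤ a)
    (hB : 0 < B)
    (hE : ∀ t ∈ Icc 0 T, HasDerivWithinAt E (E' t) (Icc 0 T) t)
    (hP : ∀ t ∈ Icc 0 T, HasDerivWithinAt P (P' t) (Icc 0 T) t)
    (hP0 : ∀ t ∈ Icc 0 T, 0 ≤ P t)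
    (hE' : ∀ t ∈ Icc 0 T, E' t ≤ -a * P t + e) (hP' : ∀ t ∈ Icc 0 T, |P' t| ≤ B)
    (ht₁ : t₁ ∈ Icc 0 T) (hPT : P t₁ ≤ B * T) :
    a * P t₁ ^ 2 ≤ 4 * B * (E 0 - E T + e * T) := by
  set s := P t₁ with hs
  have hs0 : 0 ≤ s := hP0 _ ht₁
  set h := s / (2 * B) with hh
  have hh0 : 0 ≤ h := by positivity
  have hBh : B * h = s / 2 := by rw [hh]; field_simp
  have hhT : 2 * h ≤ T := by
    have : B * (2 * h) ≤ B * T := by linarith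
    exact le_of_mul_le_mul_left this hB
  -- an interval of length `h` in the window with `t₁` as an endpoint
  obtain ⟨u, v, hu0, hv, huv, hmem⟩ : ∃ u v : ℝ, 0 ≤ u ∧ v ≤ T ∧ v - u = h ∧
      ∀ t ∈ Icc u v, |t - t₁| ≤ h := by
    rcases le_total h t₁ with h1 | h1
    · exact ⟨t₁ - h, t₁, by linarith, ht₁.2, by ring, fun t ht => by
        rw [abs_le]; constructor <;> linarith [ht.1, ht.2]⟩
    · exact ⟨t₁, t₁ + h, ht₁.1, by linarith, by ring, fun t ht => by
        rw [abs_le]; constructor <;> linarith [ht.1, ht.2]⟩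
  have hlow : ∀ t ∈ Icc u v, s / 2 ≤ P t := by
    intro t ht
    have := (convex_Icc (0 : ℝ) T).norm_image_sub_le_of_norm_hasDerivWithin_le hP
      (fun t ht => by simpa using hP' t ht) ht₁ ⟨hu0.trans ht.1, ht.2.trans hv⟩
    simp only [Real.norm_eq_abs] at this
    have h2 := mul_le_mul_of_nonneg_left (hmem t ht) hB.le
    have h3 := abs_le.1 (this.trans h2)
    linarith [h3.1]
  have huv' : u ≤ v := by linarith
  have s1 : Icc 0 u ⊆ Icc 0 T := Icc_subset_Icc le_rfl (huv'.trans hv)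
  have s2 : Icc u v ⊆ Icc 0 T := Icc_subset_Icc hu0 hv
  have s3 : Icc v T ⊆ Icc 0 T := Icc_subset_Icc (hu0.trans huv') le_rfl
  have d1 := sub_le_of_hasDerivWithinAt_le hu0 (fun t ht => (hE t (s1 ht)).mono s1)
    (c := e) (fun t ht => by nlinarith [hE' t (s1 ht), hP0 t (s1 ht)])
  have d2 := sub_le_of_hasDerivWithinAt_le huv' (fun t ht => (hE t (s2 ht)).mono s2)
    (c := -a * (s / 2) + e) (fun t ht => by nlinarith [hE' t (s2 ht), hlow t ht])
  have d3 := sub_le_of_hasDerivWithinAt_le hv (fun t ht => (hE t (s3 ht)).mono s3)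
    (c := e) (fun t ht => by nlinarith [hE' t (s3 ht), hP0 t (s3 ht)])
  have hsum : a * (s / 2) * h ≤ E 0 - E T + e * T := by
    rw [huv] at d2
    have : e * (u - 0) + e * h + e * (T - v) = e * T := by rw [← huv]; ring
    linarith
  calc a * s ^ 2 = 4 * B * (a * (s / 2) * h) := by
        rw [show 4 * B * (a * (s / 2) * h) = 2 * a * s * (B * h) by ring, hBh]; ring
    _ ≤ _ := mul_le_mul_of_nonneg_left hsum (by positivity)

end Comparison

section ErrorWindow

variable (H X : Type*) [NormedAddCommGroup H] [InnerProductSpace ℝ H]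
  [NormedAddCommGroup X] [InnerProductSpace ℝ X]

/-- A window `[0, T]` of the error dynamics of a passive adaptive loop: `y` is the scalar output
error, `ϑ` the parameter error and `χ` the state of the asymptotically stable part, which dissipates
at the rate `a` (`hstable`).  The regressor `β` is close to the reference regressor `βs`, which is
exciting on the window with constant `κ` (`hpe`).  The term `D` is a leakage, which acts against `ϑ`
in proportion to its size (`hD`).  The exogenous perturbations have size `δ`; they enter with the
constant `c₁`, and the couplings between the errors have the constant `c₀`. -/
structure ErrorWindow (T lam a c₀ c₁ ε₀ κ δ : ℝ) where
  y : ℝ → ℝ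
  ϑ : ℝ → H
  χ : ℝ → X
  r : ℝ → ℝ
  ν : ℝ → ℝ
  β : ℝ → H
  βs : ℝ → H
  D : ℝ → H
  χ' : ℝ → X
  hy : ∀ t ∈ Icc 0 T,
    HasDerivWithinAt y (-lam * y t + inner ℝ (β t) (ϑ t) + r t) (Icc 0 T) t
  hϑ : ∀ t ∈ Icc 0 T, HasDerivWithinAt ϑ (-(y t - ν t) • β t - D t) (Icc 0 T) t
  hχ : ∀ t ∈ Icc 0 T, HasDerivWithinAt χ (χ' t) (Icc 0 T) t
  hr : ∀ t ∈ Icc 0 T, |r t| ≤ c₀ * (|y t| + ‖χ t‖) + c₁ * δ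
  hν : ∀ t ∈ Icc 0 T, |ν t| ≤ c₁ * δ
  hstable : ∀ t ∈ Icc 0 T,
    inner ℝ (χ t) (χ' t) ≤ -a * ‖χ t‖ ^ 2 + ‖χ t‖ * (c₀ * |y t| + c₁ * δ)
  hχ' : ∀ t ∈ Icc 0 T, ‖χ' t‖ ≤ c₀ * (|y t| + ‖χ t‖) + c₁ * δ
  hD : ∀ t ∈ Icc 0 T, ε₀ * ‖D t‖ ≤ inner ℝ (ϑ t) (D t)
  hβs : ∀ t ∈ Icc 0 T, ‖βs t‖ ≤ c₀
  hβs_cont : Continuous βs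
  hβ : ∀ t ∈ Icc 0 T, ‖β t - βs t‖ ≤ c₀ * (|y t| + ‖χ t‖)
  hpe : ∀ γ : H, ∃ t ∈ Icc 0 T, κ * ‖γ‖ ≤ |∫ s in (0)..t, inner ℝ (βs s) γ|

namespace ErrorWindow

variable {H X} {T lam a c₀ c₁ ε₀ κ δ : ℝ} (w : ErrorWindow H X T lam a c₀ c₁ ε₀ κ δ)

/-- The dissipated part of the energy. -/
def fast (t : ℝ) : ℝ := w.y t ^ 2 + ‖w.χ t‖ ^ 2

/-- The Lyapunov function of the error dynamics. -/
def energy (t : ℝ) : ℝ := w.y t ^ 2 + ‖w.ϑ t‖ ^ 2 + ‖w.χ t‖ ^ 2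

/-- The derivative of `ErrorWindow.energy`. -/
def energyDeriv (t : ℝ) : ℝ :=
  2 * w.y t * (-lam * w.y t + inner ℝ (w.β t) (w.ϑ t) + w.r t)
    + 2 * inner ℝ (w.ϑ t) (-(w.y t - w.ν t) • w.β t - w.D t) + 2 * inner ℝ (w.χ t) (w.χ' t)

/-- The derivative of `ErrorWindow.fast`. -/
def fastDeriv (t : ℝ) : ℝ :=
  2 * w.y t * (-lam * w.y t + inner ℝ (w.β t) (w.ϑ t) + w.r t)
    + 2 * inner ℝ (w.χ t) (w.χ' t)

theorem fast_nonneg (t : ℝ) : 0 ≤ w.fast t := by unfold fast; positivity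
theorem energy_nonneg (t : ℝ) : 0 ≤ w.energy t := by unfold energy; positivity
theorem energy_eq (t : ℝ) : w.energy t = w.fast t + ‖w.ϑ t‖ ^ 2 := by unfold energy fast; ring

theorem hasDerivWithinAt_fast {t : ℝ} (ht : t ∈ Icc 0 T) :
    HasDerivWithinAt w.fast (w.fastDeriv t) (Icc 0 T) t := by
  have h1 := (w.hy t ht).pow 2
  have h2 := (w.hχ t ht).norm_sq
  refine (h1.add h2).congr_deriv ?_
  simp only [fastDeriv]; push_cast; ring

theorem hasDerivWithinAt_energy {t : ℝ} (ht : t ∈ Icc 0 T) :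
    HasDerivWithinAt w.energy (w.energyDeriv t) (Icc 0 T) t := by
  have h1 := (w.hy t ht).pow 2
  have h2 := (w.hχ t ht).norm_sq
  have h3 := (w.hϑ t ht).norm_sq
  refine ((h1.add h3).add h2).congr_deriv ?_
  simp only [energyDeriv]; push_cast; ring

theorem abs_y_le (t : ℝ) : |w.y t| ≤ √(w.fast t) :=
  Real.abs_le_sqrt (by unfold fast; nlinarith [sq_nonneg ‖w.χ t‖])

theorem norm_χ_le (t : ℝ) : ‖w.χ t‖ ≤ √(w.fast t) :=
  Real.le_sqrt_of_sq_le (by unfold fast; nlinarith [sq_nonneg (w.y t)])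

theorem norm_ϑ_le (t : ℝ) : ‖w.ϑ t‖ ≤ √(w.energy t) :=
  Real.le_sqrt_of_sq_le (by rw [energy_eq]; nlinarith [w.fast_nonneg t])

theorem sqrt_fast_le (t : ℝ) : √(w.fast t) ≤ √(w.energy t) :=
  Real.sqrt_le_sqrt (by rw [energy_eq]; nlinarith [sq_nonneg ‖w.ϑ t‖])

theorem norm_β_le (hc₀ : 0 ≤ c₀) {t : ℝ} (ht : t ∈ Icc 0 T) :
    ‖w.β t‖ ≤ c₀ * (1 + 2 * √(w.energy t)) := by
  have h1 := w.hβs t ht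
  have h2 := w.hβ t ht
  have h3 : ‖w.β t‖ ≤ ‖w.β t - w.βs t‖ + ‖w.βs t‖ := by
    simpa using norm_add_le (w.β t - w.βs t) (w.βs t)
  have h4 := (w.abs_y_le t).trans (w.sqrt_fast_le t)
  have h5 := (w.norm_χ_le t).trans (w.sqrt_fast_le t)
  nlinarith

/-- The cross terms between the output error and the parameter error cancel, so that the energy
is dissipated up to the exogenous perturbations. -/
theorem energyDeriv_le (ha : 0 < a) (hc₀ : 0 ≤ c₀) (hc₁ : 0 ≤ c₁) (hδ : 0 ≤ δ)
    (hlam : c₀ + 2 * c₀ ^ 2 / a + a / 2 ≤ lam) {t : ℝ} (ht : t ∈ Icc 0 T) :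
    w.energyDeriv t ≤ -a * w.fast t - 2 * ε₀ * ‖w.D t‖ +
      4 * c₁ * (1 + c₀) * δ * (√(w.energy t) * (1 + √(w.energy t))) := by
  set q := √(w.energy t) with hq
  have hq0 : 0 ≤ q := Real.sqrt_nonneg _
  have hy := (w.abs_y_le t).trans (w.sqrt_fast_le t)
  have hx := (w.norm_χ_le t).trans (w.sqrt_fast_le t)
  have hϑ := w.norm_ϑ_le t
  have hβ := w.norm_β_le hc₀ ht
  rw [← hq] at hy hx hϑ hβ
  have hid : w.energyDeriv t = -2 * lam * w.y t ^ 2 + 2 * (w.y t * w.r t)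
      + 2 * (w.ν t * inner ℝ (w.ϑ t) (w.β t)) - 2 * inner ℝ (w.ϑ t) (w.D t)
      + 2 * inner ℝ (w.χ t) (w.χ' t) := by
    simp only [energyDeriv, inner_sub_right, inner_smul_right, real_inner_comm (w.ϑ t) (w.β t)]
    ring
  have e1 : w.y t * w.r t ≤ |w.y t| * (c₀ * (|w.y t| + ‖w.χ t‖) + c₁ * δ) := by
    refine (le_abs_self _).trans ?_
    rw [abs_mul]
    exact mul_le_mul_of_nonneg_left (w.hr t ht) (abs_nonneg _)
  have e2 : w.ν t * inner ℝ (w.ϑ t) (w.β t) ≤ (c₁ * δ) * (q * (c₀ * (1 + 2 * q))) := by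
    refine (le_abs_self _).trans ?_
    rw [abs_mul]
    refine mul_le_mul (w.hν t ht) ((abs_real_inner_le_norm _ _).trans ?_) (abs_nonneg _)
      (by positivity)
    exact mul_le_mul hϑ hβ (norm_nonneg _) hq0
  have e3 := w.hstable t ht
  have e4 := w.hD t ht
  have hysq : w.y t ^ 2 = |w.y t| ^ 2 := (sq_abs _).symm
  have hyn := abs_nonneg (w.y t)
  have hxn := norm_nonneg (w.χ t)
  set Y := |w.y t|
  set Z := ‖w.χ t‖
  have hfast : w.fast t = Y ^ 2 + Z ^ 2 := by rw [fast, hysq]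
  have young : 4 * c₀ * (Y * Z) ≤ a * Z ^ 2 + 4 * c₀ ^ 2 / a * Y ^ 2 := by
    have : a * Z ^ 2 + 4 * c₀ ^ 2 / a * Y ^ 2 - 4 * c₀ * (Y * Z) =
        a * (Z - 2 * c₀ / a * Y) ^ 2 := by
      field_simp; ring
    nlinarith [mul_nonneg ha.le (sq_nonneg (Z - 2 * c₀ / a * Y))]
  have hl : (2 * c₀ + 4 * c₀ ^ 2 / a + a) * Y ^ 2 ≤ 2 * lam * Y ^ 2 := by
    refine mul_le_mul_of_nonneg_right ?_ (sq_nonneg _)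
    have : 4 * c₀ ^ 2 / a = 2 * (2 * c₀ ^ 2 / a) := by ring
    linarith
  have p1 : c₁ * δ * Y ≤ c₁ * δ * q := mul_le_mul_of_nonneg_left hy (by positivity)
  have p2 : c₁ * δ * Z ≤ c₁ * δ * q := mul_le_mul_of_nonneg_left hx (by positivity)
  rw [hid, hfast, hysq]
  have p3 : 0 ≤ c₁ * δ * q * q := by positivity
  have p4 : 0 ≤ c₁ * δ * q * c₀ := by positivity
  nlinarith

/-- The energy grows at most by a factor controlled by the perturbation, whatever its size. -/
theorem energy_growth (ha : 0 < a) (hc₀ : 0 ≤ c₀) (hc₁ : 0 ≤ c₁) (hδ : 0 ≤ δ) (hε₀ : 0 ≤ ε₀)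
    (hlam : c₀ + 2 * c₀ ^ 2 / a + a / 2 ≤ lam) {t : ℝ} (ht : t ∈ Icc 0 T) :
    1 + 2 * w.energy t ≤ (1 + 2 * w.energy 0) * Real.exp (8 * c₁ * (1 + c₀) * δ * t) := by
  refine le_mul_exp_of_hasDerivWithinAt_le (f := fun t => 1 + 2 * w.energy t)
    (f' := fun t => 2 * w.energyDeriv t) (fun t ht => ?_) (fun t ht => ?_) ht
  · exact ((w.hasDerivWithinAt_energy ht).const_mul 2).const_add 1
  · have h := w.energyDeriv_le ha hc₀ hc₁ hδ hlam ht
    have h1 : 0 ≤ ε₀ * ‖w.D t‖ := by positivity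
    have h2 := w.fast_nonneg t
    have h3 := Real.sq_sqrt (w.energy_nonneg t)
    have h4 : √(w.energy t) * (1 + √(w.energy t)) ≤ 1 + 2 * w.energy t := by
      nlinarith [sq_nonneg (√(w.energy t) - 1)]
    have h5 : 0 ≤ 4 * c₁ * (1 + c₀) * δ := by positivity
    nlinarith [mul_le_mul_of_nonneg_left h4 h5]

/-- Persistence of excitation bounds the initial parameter error by the output error over the
window. -/
theorem norm_ϑ_zero_le (hc₀ : 0 ≤ c₀) (hlam : 0 ≤ lam) (hT : 0 ≤ T) (hδ : 0 ≤ c₁ * δ) {S q V : ℝ}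
    (hS : ∀ t ∈ Icc 0 T, √(w.fast t) ≤ S) (hq : ∀ t ∈ Icc 0 T, ‖w.ϑ t‖ ≤ q)
    (hV : ∀ t ∈ Icc 0 T, ‖w.ϑ t - w.ϑ 0‖ ≤ V) :
    κ * ‖w.ϑ 0‖ ≤ 2 * S + ((lam + 2 * c₀) * S + c₁ * δ + 2 * c₀ * S * q + c₀ * V) * T := by
  obtain ⟨t, ht, hκ⟩ := w.hpe (w.ϑ 0)
  have h0 : (0 : ℝ) ∈ Icc 0 T := ⟨le_rfl, hT⟩
  have hS0 : 0 ≤ S := (Real.sqrt_nonneg _).trans (hS 0 h0)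
  have hV0 : 0 ≤ V := (norm_nonneg _).trans (hV 0 h0)
  have hq0 : 0 ≤ q := (norm_nonneg _).trans (hq 0 h0)
  set C := (lam + 2 * c₀) * S + c₁ * δ + 2 * c₀ * S * q + c₀ * V with hC
  have hC0 : 0 ≤ C := by positivity
  have hcont : Continuous fun s => inner ℝ (w.βs s) (w.ϑ 0) := w.hβs_cont.inner continuous_const
  have hd : ∀ s ∈ Icc 0 T, HasDerivWithinAt
      (fun t => w.y t - ∫ s in (0)..t, inner ℝ (w.βs s) (w.ϑ 0))
      (-lam * w.y s + inner ℝ (w.β s) (w.ϑ s) + w.r s - inner ℝ (w.βs s) (w.ϑ 0)) (Icc 0 T) s :=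
    fun s hs => (w.hy s hs).sub (hcont.integral_hasStrictDerivAt 0 s).hasDerivAt.hasDerivWithinAt
  have hbound : ∀ s ∈ Ico 0 T,
      ‖-lam * w.y s + inner ℝ (w.β s) (w.ϑ s) + w.r s - inner ℝ (w.βs s) (w.ϑ 0)‖ ≤ C := by
    intro s hs
    have hs := Ico_subset_Icc_self hs
    have hy : |w.y s| ≤ S := (w.abs_y_le s).trans (hS s hs)
    have hx : ‖w.χ s‖ ≤ S := (w.norm_χ_le s).trans (hS s hs)
    have e1 : |lam * w.y s| ≤ lam * S := by
      rw [abs_mul, abs_of_nonneg hlam]; exact mul_le_mul_of_nonneg_left hy hlam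
    have e2 : |w.r s| ≤ 2 * c₀ * S + c₁ * δ := (w.hr s hs).trans (by nlinarith)
    have e3 : |inner ℝ (w.β s - w.βs s) (w.ϑ s)| ≤ 2 * c₀ * S * q := by
      refine (abs_real_inner_le_norm _ _).trans
        (mul_le_mul ((w.hβ s hs).trans (by nlinarith)) (hq s hs) (norm_nonneg _) (by positivity))
    have e4 : |inner ℝ (w.βs s) (w.ϑ s - w.ϑ 0)| ≤ c₀ * V :=
      (abs_real_inner_le_norm _ _).trans
        (mul_le_mul (w.hβs s hs) (hV s hs) (norm_nonneg _) hc₀)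
    have hid : -lam * w.y s + inner ℝ (w.β s) (w.ϑ s) + w.r s - inner ℝ (w.βs s) (w.ϑ 0)
        = -(lam * w.y s) + w.r s + inner ℝ (w.β s - w.βs s) (w.ϑ s)
          + inner ℝ (w.βs s) (w.ϑ s - w.ϑ 0) := by
      rw [inner_sub_left, inner_sub_right]; ring
    rw [hid, Real.norm_eq_abs]
    rw [abs_le] at e1 e2 e3 e4 ⊢
    constructor <;> linarith [e1.1, e1.2, e2.1, e2.2, e3.1, e3.2, e4.1, e4.2]
  have hmv := norm_image_sub_le_of_norm_deriv_le_segment' hd hbound t ht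
  simp only [intervalIntegral.integral_same, sub_zero] at hmv
  have hy0 := (w.abs_y_le 0).trans (hS 0 h0)
  have hyt := (w.abs_y_le t).trans (hS t ht)
  have hCt : C * t ≤ C * T := mul_le_mul_of_nonneg_left ht.2 hC0
  rw [Real.norm_eq_abs] at hmv
  set J := ∫ s in (0)..t, inner ℝ (w.βs s) (w.ϑ 0)
  have hJ : |J| ≤ |w.y t| + |w.y t - J - w.y 0| + |w.y 0| := by
    have h1 : J = w.y t - (w.y t - J - w.y 0) - w.y 0 := by ring
    calc |J| = |w.y t - (w.y t - J - w.y 0) - w.y 0| := by rw [← h1]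
      _ ≤ |w.y t - (w.y t - J - w.y 0)| + |w.y 0| := abs_sub _ _
      _ ≤ _ := by gcongr; exact abs_sub _ _
  linarith

/-- The parameter error moves only as much as the output error and the dissipated energy allow. -/
theorem norm_ϑ_sub_le (hc₀ : 0 ≤ c₀) (hδ : 0 ≤ c₁ * δ) (hε₀ : 0 < ε₀)
    (ha : 0 ≤ a) {S q e : ℝ} (hS : ∀ t ∈ Icc 0 T, √(w.fast t) ≤ S)
    (hq : ∀ t ∈ Icc 0 T, √(w.energy t) ≤ q)
    (hE : ∀ t ∈ Icc 0 T, w.energyDeriv t ≤ -a * w.fast t - 2 * ε₀ * ‖w.D t‖ + e)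
    {t : ℝ} (ht : t ∈ Icc 0 T) :
    ‖w.ϑ t - w.ϑ 0‖ ≤ (S + c₁ * δ) * (c₀ * (1 + 2 * q)) * T
      + (w.energy 0 - w.energy T + e * T) / (2 * ε₀) := by
  have hT : 0 ≤ T := ht.1.trans ht.2
  have hS0 : 0 ≤ S := (Real.sqrt_nonneg _).trans (hS 0 ⟨le_rfl, hT⟩)
  have hq0 : 0 ≤ q := (Real.sqrt_nonneg _).trans (hq 0 ⟨le_rfl, hT⟩)
  set c := (S + c₁ * δ) * (c₀ * (1 + 2 * q)) with hc
  have hc0 : 0 ≤ c := by positivity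
  have hB : ∀ s ∈ Icc 0 T, HasDerivWithinAt
      (fun s => c * s + (w.energy 0 - w.energy s + e * s) / (2 * ε₀))
      (c + (-w.energyDeriv s + e) / (2 * ε₀)) (Icc 0 T) s := by
    intro s hs
    have h1 : HasDerivWithinAt (fun s : ℝ => c * s) c (Icc 0 T) s := by
      simpa using ((hasDerivAt_id s).const_mul c).hasDerivWithinAt
    have h2 : HasDerivWithinAt (fun s : ℝ => e * s) e (Icc 0 T) s := by
      simpa using ((hasDerivAt_id s).const_mul e).hasDerivWithinAt
    exact h1.add ((((w.hasDerivWithinAt_energy hs).const_sub _).add h2).div_const _)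
  have h := image_norm_le_of_norm_deriv_right_le_deriv_boundary'
    (f := fun s => w.ϑ s - w.ϑ 0) (f' := fun s => -(w.y s - w.ν s) • w.β s - w.D s)
    (fun s hs => ((w.hϑ s hs).sub_const _).continuousWithinAt)
    (fun s hs => ((w.hϑ s (Ico_subset_Icc_self hs)).sub_const _).mono_of_mem_nhdsWithin
      (Icc_mem_nhdsGE_of_mem hs))
    (B := fun s => c * s + (w.energy 0 - w.energy s + e * s) / (2 * ε₀))
    (B' := fun s => c + (-w.energyDeriv s + e) / (2 * ε₀)) (by simp)
    (fun s hs => (hB s hs).continuousWithinAt)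
    (fun s hs => (hB s (Ico_subset_Icc_self hs)).mono_of_mem_nhdsWithin (Icc_mem_nhdsGE_of_mem hs))
    (fun s hs => ?_) ht
  · refine h.trans (add_le_add (mul_le_mul_of_nonneg_left ht.2 hc0) ?_)
    refine div_le_div_of_nonneg_right ?_ (by positivity)
    have := sub_le_of_hasDerivWithinAt_le ht.2
      (fun u hu => (w.hasDerivWithinAt_energy ⟨ht.1.trans hu.1, hu.2⟩).mono
        (Icc_subset_Icc ht.1 le_rfl)) (c := e) (fun u hu => by
          have hu : u ∈ Icc 0 T := ⟨ht.1.trans hu.1, hu.2⟩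
          have h1 : 0 ≤ ε₀ * ‖w.D u‖ := by positivity
          nlinarith [hE u hu, w.fast_nonneg u])
    linarith
  · have hs := Ico_subset_Icc_self hs
    have h1 : ‖(w.y s - w.ν s) • w.β s‖ ≤ c := by
      rw [norm_smul, Real.norm_eq_abs]
      refine mul_le_mul ?_ ((w.norm_β_le hc₀ hs).trans ?_) (norm_nonneg _) (by positivity)
      · exact (abs_sub _ _).trans (add_le_add ((w.abs_y_le s).trans (hS s hs)) (w.hν s hs))
      · exact mul_le_mul_of_nonneg_left (by linarith [hq s hs]) hc₀
    have h2 : ‖w.D s‖ ≤ (-w.energyDeriv s + e) / (2 * ε₀) := by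
      rw [le_div_iff₀ (by positivity)]
      nlinarith [hE s hs, w.fast_nonneg s]
    calc _ ≤ ‖(w.y s - w.ν s) • w.β s‖ + ‖w.D s‖ := by
          rw [neg_smul]; simpa using norm_sub_le (-((w.y s - w.ν s) • w.β s)) (w.D s)
      _ ≤ _ := add_le_add h1 h2

theorem abs_fastDeriv_le (hc₀ : 0 ≤ c₀) (hc₁ : 0 ≤ c₁) (hlam : 0 ≤ lam) {q Q : ℝ}
    (hq : ∀ t ∈ Icc 0 T, √(w.energy t) ≤ q) (hqQ : q ≤ Q) (hδq : δ ≤ q) {t : ℝ}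
    (ht : t ∈ Icc 0 T) :
    |w.fastDeriv t| ≤ (2 * (lam + c₀ * (1 + 2 * Q) + 2 * c₀ + c₁) + 2 * (2 * c₀ + c₁)) * q ^ 2 := by
  have hqt := hq t ht
  have hq0 : 0 ≤ q := (Real.sqrt_nonneg _).trans hqt
  have hy := ((w.abs_y_le t).trans (w.sqrt_fast_le t)).trans hqt
  have hx := ((w.norm_χ_le t).trans (w.sqrt_fast_le t)).trans hqt
  have hϑ := (w.norm_ϑ_le t).trans hqt
  have hβ : ‖w.β t‖ ≤ c₀ * (1 + 2 * Q) :=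
    (w.norm_β_le hc₀ ht).trans (mul_le_mul_of_nonneg_left (by linarith) hc₀)
  have hQ0 : 0 ≤ Q := hq0.trans hqQ
  have hcδ : c₁ * δ ≤ c₁ * q := mul_le_mul_of_nonneg_left hδq hc₁
  have e1 : |-lam * w.y t + inner ℝ (w.β t) (w.ϑ t) + w.r t| ≤
      (lam + c₀ * (1 + 2 * Q) + 2 * c₀ + c₁) * q := by
    have f1 : |lam * w.y t| ≤ lam * q := by
      rw [abs_mul, abs_of_nonneg hlam]; exact mul_le_mul_of_nonneg_left hy hlam
    have f2 : |inner ℝ (w.β t) (w.ϑ t)| ≤ c₀ * (1 + 2 * Q) * q :=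
      (abs_real_inner_le_norm _ _).trans (mul_le_mul hβ hϑ (norm_nonneg _) (by positivity))
    have f3 : |w.r t| ≤ 2 * c₀ * q + c₁ * q := (w.hr t ht).trans (by nlinarith)
    rw [abs_le] at f1 f2 f3 ⊢
    constructor <;> linarith [f1.1, f1.2, f2.1, f2.2, f3.1, f3.2]
  have e2 : |w.y t * (-lam * w.y t + inner ℝ (w.β t) (w.ϑ t) + w.r t)| ≤
      q * ((lam + c₀ * (1 + 2 * Q) + 2 * c₀ + c₁) * q) := by
    rw [abs_mul]; exact mul_le_mul hy e1 (abs_nonneg _) hq0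
  have e3 : |inner ℝ (w.χ t) (w.χ' t)| ≤ q * ((2 * c₀ + c₁) * q) := by
    refine (abs_real_inner_le_norm _ _).trans
      (mul_le_mul hx ((w.hχ' t ht).trans ?_) (norm_nonneg _) hq0)
    nlinarith
  have : w.fastDeriv t = 2 * (w.y t * (-lam * w.y t + inner ℝ (w.β t) (w.ϑ t) + w.r t))
      + 2 * inner ℝ (w.χ t) (w.χ' t) := by simp only [fastDeriv]; ring
  rw [this]
  rw [abs_le] at e2 e3 ⊢
  constructor <;> nlinarith [e2.1, e2.2, e3.1, e3.2]

end ErrorWindow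

end ErrorWindow

/-! ### Contraction of the error over one window -/

namespace ErrorWindow

/-- The arithmetic behind the contraction over one window: `u²` is the dissipated energy, `q²` a
bound for the energy on the window. -/
theorem contraction_arith {E₀ E₁ S δ q u Q g A A₂ A₃ A₅ c₃ T θ : ℝ}
    (hq0 : 0 ≤ q) (hu0 : 0 ≤ u) (hqQ : q ≤ Q) (hθ0 : 0 ≤ θ)
    (hg : 1 ≤ g) (hA₂ : 0 ≤ A₂) (hA₃ : 0 ≤ A₃)
    (hA₅ : A₅ = g * ((1 + 3 * A ^ 2) * (A₂ + A₃ ^ 3 * Q ^ 2) + 3 * A ^ 2 + 1))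
    (hq : q ^ 2 = g * (E₀ + δ ^ 2)) (hE₀ : E₀ ≤ S ^ 2 + θ ^ 2) (hθ : θ ≤ A * (S + δ + u ^ 2))
    (hS : S ^ 2 ≤ A₂ * (q * u)) (hu : u ≤ A₃ * q) (hu2 : u ^ 2 = E₀ - E₁ + c₃ * δ * q * T)
    (hE₀q : E₀ ≤ q ^ 2) :
    A₅ ^ 2 * E₁ ≤ A₅ ^ 2 * E₀ - E₀ / 2 + ((A₅ ^ 2 * c₃ * T) ^ 2 / 2 + 2 * A₅) * δ ^ 2 := by
  have hA₅0 : 0 ≤ A₅ := by rw [hA₅]; positivity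
  have hu4 : (u ^ 2) ^ 2 ≤ A₃ ^ 3 * Q ^ 2 * (q * u) := by
    have h1 : u ^ 3 ≤ (A₃ * q) ^ 3 := by gcongr
    have h2 : q ^ 2 ≤ Q ^ 2 := by gcongr
    calc (u ^ 2) ^ 2 = u * u ^ 3 := by ring
      _ ≤ u * (A₃ * q) ^ 3 := by gcongr
      _ = A₃ ^ 3 * (q * u) * q ^ 2 := by ring
      _ ≤ A₃ ^ 3 * (q * u) * Q ^ 2 := by gcongr
      _ = _ := by ring
  have hθ2 : θ ^ 2 ≤ 3 * A ^ 2 * (S ^ 2 + δ ^ 2 + (u ^ 2) ^ 2) := by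
    calc θ ^ 2 ≤ (A * (S + δ + u ^ 2)) ^ 2 := by gcongr
      _ = A ^ 2 * (S + δ + u ^ 2) ^ 2 := by ring
      _ ≤ A ^ 2 * (3 * (S ^ 2 + δ ^ 2 + (u ^ 2) ^ 2)) := by
          gcongr
          nlinarith [sq_nonneg (S - δ), sq_nonneg (S - u ^ 2), sq_nonneg (δ - u ^ 2)]
      _ = _ := by ring
  have hq5 : q ^ 2 ≤ A₅ * (q * u + δ ^ 2) := by
    have hqu : 0 ≤ q * u := by positivity
    have h1 : E₀ ≤ (1 + 3 * A ^ 2) * (A₂ + A₃ ^ 3 * Q ^ 2) * (q * u) + 3 * A ^ 2 * δ ^ 2 := by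
      calc E₀ ≤ (1 + 3 * A ^ 2) * (S ^ 2 + (u ^ 2) ^ 2) + 3 * A ^ 2 * δ ^ 2 := by
            nlinarith [sq_nonneg (u ^ 2)]
        _ ≤ (1 + 3 * A ^ 2) * (A₂ * (q * u) + A₃ ^ 3 * Q ^ 2 * (q * u)) + 3 * A ^ 2 * δ ^ 2 := by
            gcongr
        _ = _ := by ring
    have h2 : 0 ≤ (1 + 3 * A ^ 2) * (A₂ + A₃ ^ 3 * Q ^ 2) := by positivity
    rw [hq, hA₅, mul_assoc]
    refine mul_le_mul_of_nonneg_left ?_ (by linarith)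
    have h3 : 0 ≤ 3 * A ^ 2 * (q * u) := by positivity
    have h4 : 0 ≤ (1 + 3 * A ^ 2) * (A₂ + A₃ ^ 3 * Q ^ 2) * δ ^ 2 := by positivity
    linarith
  have hy1 : q ^ 2 ≤ A₅ ^ 2 * u ^ 2 + 2 * A₅ * δ ^ 2 := by
    nlinarith [sq_nonneg (q - A₅ * u)]
  rw [hu2] at hy1
  nlinarith [sq_nonneg (q - A₅ ^ 2 * c₃ * T * δ)]

variable {H X : Type*} [NormedAddCommGroup H] [InnerProductSpace ℝ H]
  [NormedAddCommGroup X] [InnerProductSpace ℝ X] {T lam a c₀ c₁ ε₀ κ δ : ℝ}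
  (w : ErrorWindow H X T lam a c₀ c₁ ε₀ κ δ)

/-- For bounded initial energy the perturbation enters the energy balance linearly. -/
theorem energyDeriv_le_linear {R : ℝ} (ha : 0 < a) (hc₀ : 0 ≤ c₀) (hc₁ : 0 ≤ c₁) (hε₀ : 0 ≤ ε₀)
    (hlam : c₀ + 2 * c₀ ^ 2 / a + a / 2 ≤ lam) (hδ0 : 0 ≤ δ) (hδ1 : δ ≤ 1)
    (hwR : w.energy 0 ≤ R) {t : ℝ} (ht : t ∈ Icc 0 T) :
    w.energyDeriv t ≤ -a * w.fast t - 2 * ε₀ * ‖w.D t‖ +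
      4 * c₁ * (1 + c₀) * (1 + √((1 + 2 * R) * Real.exp (2 * (4 * c₁ * (1 + c₀)) * T))) *
        (δ * √(w.energy t)) := by
  have hbound : √(w.energy t) ≤ √((1 + 2 * R) * Real.exp (2 * (4 * c₁ * (1 + c₀)) * T)) := by
    refine Real.sqrt_le_sqrt ?_
    have h := w.energy_growth ha hc₀ hc₁ hδ0 hε₀ hlam ht
    have hE0 := w.energy_nonneg 0
    have h2 : (1 + 2 * w.energy 0) * Real.exp (8 * c₁ * (1 + c₀) * δ * t) ≤
        (1 + 2 * R) * Real.exp (2 * (4 * c₁ * (1 + c₀)) * T) := by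
      refine mul_le_mul (by linarith) (Real.exp_le_exp.2 ?_) (Real.exp_pos _).le (by linarith)
      have h3 : δ * t ≤ 1 * T := mul_le_mul hδ1 ht.2 ht.1 zero_le_one
      calc 8 * c₁ * (1 + c₀) * δ * t = 2 * (4 * c₁ * (1 + c₀)) * (δ * t) := by ring
        _ ≤ 2 * (4 * c₁ * (1 + c₀)) * (1 * T) := by gcongr
        _ = _ := by ring
    linarith [w.energy_nonneg t]
  refine (w.energyDeriv_le ha hc₀ hc₁ hδ0 hlam ht).trans ?_
  generalize √((1 + 2 * R) * Real.exp (2 * (4 * c₁ * (1 + c₀)) * T)) = B at hbound ⊢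
  have : 4 * c₁ * (1 + c₀) * δ * (√(w.energy t) * (1 + √(w.energy t))) ≤
      4 * c₁ * (1 + c₀) * δ * (√(w.energy t) * (1 + B)) := by gcongr
  calc _ ≤ -a * w.fast t - 2 * ε₀ * ‖w.D t‖ +
        4 * c₁ * (1 + c₀) * δ * (√(w.energy t) * (1 + B)) := by gcongr
    _ = _ := by ring

/-- While the perturbation enters the energy balance linearly, the energy on the window is bounded
by its initial value and by `δ ^ 2`, with a factor that does not depend on either. -/
theorem energy_add_le {c₃ : ℝ} (ha : 0 ≤ a) (hε₀ : 0 ≤ ε₀) (hc₃ : 0 ≤ c₃)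
    (hder : ∀ t ∈ Icc 0 T, w.energyDeriv t ≤ -a * w.fast t - 2 * ε₀ * ‖w.D t‖ +
      c₃ * (δ * √(w.energy t))) {t : ℝ} (ht : t ∈ Icc 0 T) :
    w.energy t + δ ^ 2 ≤ Real.exp (c₃ * T) * (w.energy 0 + δ ^ 2) := by
  have hE0 := w.energy_nonneg 0
  have h := le_mul_exp_of_hasDerivWithinAt_le (f := fun t => w.energy t + δ ^ 2) (K := c₃)
    (fun t ht => (w.hasDerivWithinAt_energy ht).add_const _) (fun t ht => ?_) ht
  · refine h.trans ?_
    rw [mul_comm (Real.exp (c₃ * T))]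
    exact mul_le_mul_of_nonneg_left (Real.exp_le_exp.2 (mul_le_mul_of_nonneg_left ht.2 hc₃))
      (by positivity)
  · have h1 := hder t ht
    have h2 : 0 ≤ ε₀ * ‖w.D t‖ := by positivity
    have h3 := mul_nonneg ha (w.fast_nonneg t)
    have h4 := Real.sq_sqrt (w.energy_nonneg t)
    have h5 : δ * √(w.energy t) ≤ w.energy t + δ ^ 2 := by
      nlinarith [sq_nonneg (δ - √(w.energy t)), sq_nonneg (δ + √(w.energy t))]
    have h6 := mul_le_mul_of_nonneg_left h5 hc₃
    linarith

/-- Over one window the energy contracts by a fixed factor, up to the square of the size of the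
perturbation. The constants depend on the initial energy only through the bound `R`.

If `u ^ 2` denotes the dissipated energy and `q ^ 2` a bound for the energy on the window, then
`ErrorWindow.fast` is at most a multiple of `q * u` on the window, and by excitation so is the
square of the initial parameter error. Hence `q ^ 2` is at most a multiple of `q * u + δ ^ 2`, that
is, a fixed fraction of the energy is dissipated, up to a multiple of `δ ^ 2`. -/
theorem exists_contraction {T lam a c₀ c₁ ε₀ κ R : ℝ} (hT : 0 < T) (ha : 0 < a) (hc₀ : 0 ≤ c₀)
    (hc₁ : 0 ≤ c₁) (hε₀ : 0 < ε₀) (hκ : 0 < κ)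
    (hlam : c₀ + 2 * c₀ ^ 2 / a + a / 2 ≤ lam)
    (H X : Type*) [NormedAddCommGroup H] [InnerProductSpace ℝ H]
    [NormedAddCommGroup X] [InnerProductSpace ℝ X] :
    ∃ ρ C : ℝ, 0 ≤ ρ ∧ ρ < 1 ∧ 0 ≤ C ∧
      ∀ δ : ℝ, 0 ≤ δ → δ ≤ 1 → ∀ w : ErrorWindow H X T lam a c₀ c₁ ε₀ κ δ, w.energy 0 ≤ R →
        w.energy T ≤ ρ * w.energy 0 + C * δ ^ 2 ∧
        ∀ t ∈ Icc 0 T, w.energy t ≤ C * (w.energy 0 + δ ^ 2) := by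
  have hlam0 : 0 ≤ lam := le_trans (by positivity) hlam
  -- `R'` bounds the energy on the window and `c₃` is the factor of `δ √energy` in its balance; `Q`
  -- bounds `q`, `CB q²` bounds the rate of change of the fast part, and `A`, `A₂`, `A₃` and `A₅`
  -- are the constants of the estimates of `‖ϑ 0‖`, of the fast part, of `u` and of `q²`
  obtain ⟨c₂, hc₂⟩ : ∃ x, x = 4 * c₁ * (1 + c₀) := ⟨_, rfl⟩
  obtain ⟨R', hR'⟩ : ∃ x, x = (1 + 2 * R) * Real.exp (2 * c₂ * T) := ⟨_, rfl⟩
  obtain ⟨c₃, hc₃⟩ : ∃ x, x = c₂ * (1 + √R') := ⟨_, rfl⟩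
  obtain ⟨g, hg⟩ : ∃ x, x = Real.exp (c₃ * T) := ⟨_, rfl⟩
  obtain ⟨Q, hQ⟩ : ∃ x, x = √(g * (R + 1)) := ⟨_, rfl⟩
  obtain ⟨CB, hCB⟩ : ∃ x, x =
    2 * (lam + c₀ * (1 + 2 * Q) + 2 * c₀ + c₁) + 2 * (2 * c₀ + c₁) + 1 / T := ⟨_, rfl⟩
  obtain ⟨k, hk⟩ : ∃ x, x = c₀ * (1 + 2 * Q) * T := ⟨_, rfl⟩
  obtain ⟨α, hα⟩ : ∃ x, x = 2 + (lam + 2 * c₀ + 2 * c₀ * Q + c₀ * k) * T := ⟨_, rfl⟩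
  obtain ⟨β, hβ⟩ : ∃ x, x = (c₁ + c₀ * k * c₁) * T := ⟨_, rfl⟩
  obtain ⟨γ, hγ⟩ : ∃ x, x = c₀ * T / (2 * ε₀) := ⟨_, rfl⟩
  obtain ⟨A, hA⟩ : ∃ x, x = (α + β + γ) / κ := ⟨_, rfl⟩
  obtain ⟨A₂, hA₂⟩ : ∃ x, x = √(4 * CB / a) := ⟨_, rfl⟩
  obtain ⟨A₃, hA₃⟩ : ∃ x, x = 1 + c₃ * T := ⟨_, rfl⟩
  obtain ⟨A₅, hA₅⟩ : ∃ x,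
    x = g * ((1 + 3 * A ^ 2) * (A₂ + A₃ ^ 3 * Q ^ 2) + 3 * A ^ 2 + 1) := ⟨_, rfl⟩
  have hc₂0 : 0 ≤ c₂ := by rw [hc₂]; positivity
  have hc₃0 : 0 ≤ c₃ := by rw [hc₃]; positivity
  have hg1 : 1 ≤ g := hg ▸ Real.one_le_exp (by positivity)
  have hQ0 : 0 ≤ Q := hQ ▸ Real.sqrt_nonneg _
  have hCB0 : 0 < CB := by rw [hCB]; positivity
  have hk0 : 0 ≤ k := by rw [hk]; positivity
  have hα0 : 0 ≤ α := by rw [hα]; positivity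
  have hβ0 : 0 ≤ β := by rw [hβ]; positivity
  have hγ0 : 0 ≤ γ := by rw [hγ]; positivity
  have hA0 : 0 ≤ A := by rw [hA]; positivity
  have hA₂0 : 0 ≤ A₂ := hA₂ ▸ Real.sqrt_nonneg _
  have hA₃1 : 1 ≤ A₃ := by
    have : 0 ≤ c₃ * T := by positivity
    rw [hA₃]; linarith
  have hA₅1 : 1 ≤ A₅ := by
    have h1 : 0 ≤ (1 + 3 * A ^ 2) * (A₂ + A₃ ^ 3 * Q ^ 2) := by positivity
    have h2 : 0 ≤ 3 * A ^ 2 := by positivity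
    rw [hA₅]
    exact one_le_mul_of_one_le_of_one_le hg1 (by linarith)
  have hA₅s : 1 ≤ A₅ ^ 2 := one_le_pow₀ hA₅1
  obtain ⟨C', hC'⟩ : ∃ x, x = (A₅ ^ 2 * c₃ * T) ^ 2 / 2 + 2 * A₅ := ⟨_, rfl⟩
  have hC'0 : 0 ≤ C' := by rw [hC']; positivity
  have hCB6 : 1 ≤ CB * T := by
    have h5 : 1 / T * T = 1 := by field_simp
    rw [← h5, hCB]
    refine mul_le_mul_of_nonneg_right ?_ hT.le
    linarith [show 0 ≤ 2 * (lam + c₀ * (1 + 2 * Q) + 2 * c₀ + c₁) + 2 * (2 * c₀ + c₁) by positivity]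
  refine ⟨1 - 1 / (2 * A₅ ^ 2), g + C', ?_, ?_, by positivity, ?_⟩
  · rw [sub_nonneg, div_le_one (by positivity)]; linarith
  · have : 0 < 1 / (2 * A₅ ^ 2) := by positivity
    linarith
  intro δ hδ0 hδ1 w hwR
  have hE0 := w.energy_nonneg 0
  obtain ⟨q, hq⟩ : ∃ x, x = √(g * (w.energy 0 + δ ^ 2)) := ⟨_, rfl⟩
  have hq0 : 0 ≤ q := hq ▸ Real.sqrt_nonneg _
  have hq2 : q ^ 2 = g * (w.energy 0 + δ ^ 2) := hq ▸ Real.sq_sqrt (by positivity)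
  have hδ2 : δ ^ 2 ≤ 1 := pow_le_one₀ hδ0 hδ1
  have hqQ : q ≤ Q := by
    rw [hq, hQ]; exact Real.sqrt_le_sqrt (by gcongr)
  have hδq : δ ≤ q := hq ▸ Real.le_sqrt_of_sq_le (by
    have h1 : 1 * (w.energy 0 + δ ^ 2) ≤ g * (w.energy 0 + δ ^ 2) := by gcongr
    linarith)
  have hder0 : ∀ t ∈ Icc 0 T, w.energyDeriv t ≤ -a * w.fast t - 2 * ε₀ * ‖w.D t‖ +
      c₃ * (δ * √(w.energy t)) :=
    fun t ht => by
      rw [hc₃, hR', hc₂]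
      exact w.energyDeriv_le_linear ha hc₀ hc₁ hε₀.le hlam hδ0 hδ1 hwR ht
  have hEq : ∀ t ∈ Icc 0 T, w.energy t + δ ^ 2 ≤ q ^ 2 :=
    fun t ht => by
      rw [hq2, hg]
      exact w.energy_add_le ha.le hε₀.le hc₃0 hder0 ht
  have hsq : ∀ t ∈ Icc 0 T, √(w.energy t) ≤ q := fun t ht =>
    Real.sqrt_le_iff.2 ⟨hq0, by linarith [hEq t ht, sq_nonneg δ]⟩
  have hder : ∀ t ∈ Icc 0 T, w.energyDeriv t ≤ -a * w.fast t - 2 * ε₀ * ‖w.D t‖ + c₃ * δ * q := by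
    intro t ht
    have := mul_le_mul_of_nonneg_left (hsq t ht) (show 0 ≤ c₃ * δ by positivity)
    have h2 := hder0 t ht
    rw [← mul_assoc] at h2
    exact h2.trans (add_le_add_right this _)
  have hT0 : (0 : ℝ) ∈ Icc 0 T := ⟨le_rfl, hT.le⟩
  have hTT : T ∈ Icc 0 T := ⟨hT.le, le_rfl⟩
  have hlast : ∀ t ∈ Icc 0 T, w.energy t ≤ (g + C') * (w.energy 0 + δ ^ 2) := by
    intro t ht
    have h1 := hEq t ht
    rw [hq2] at h1
    have h2 : 0 ≤ C' * (w.energy 0 + δ ^ 2) := by positivity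
    linarith [sq_nonneg δ, add_mul g C' (w.energy 0 + δ ^ 2)]
  refine ⟨?_, hlast⟩
  have hconv : ∀ E₁ : ℝ, A₅ ^ 2 * E₁ ≤ A₅ ^ 2 * w.energy 0 - w.energy 0 / 2 + C' * δ ^ 2 →
      E₁ ≤ (1 - 1 / (2 * A₅ ^ 2)) * w.energy 0 + (g + C') * δ ^ 2 := by
    intro E₁ h
    refine le_of_mul_le_mul_left (h.trans ?_) (show 0 < A₅ ^ 2 by positivity)
    have e1 : A₅ ^ 2 * ((1 - 1 / (2 * A₅ ^ 2)) * w.energy 0 + (g + C') * δ ^ 2)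
        = A₅ ^ 2 * w.energy 0 - w.energy 0 / 2 + A₅ ^ 2 * ((g + C') * δ ^ 2) := by
      have : A₅ ≠ 0 := by positivity
      field_simp
    rw [e1]
    have e2 : 0 ≤ g * δ ^ 2 := by positivity
    have e3 : 1 * ((g + C') * δ ^ 2) ≤ A₅ ^ 2 * ((g + C') * δ ^ 2) := by gcongr
    linarith [add_mul g C' (δ ^ 2)]
  refine hconv _ ?_
  have hdrop : w.energy T - w.energy 0 ≤ c₃ * δ * q * T := by
    have := sub_le_of_hasDerivWithinAt_le hT.le (fun t ht => w.hasDerivWithinAt_energy ht)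
      (c := c₃ * δ * q) (fun t ht => by
        have h1 : 0 ≤ ε₀ * ‖w.D t‖ := by positivity
        have h2 := mul_nonneg ha.le (w.fast_nonneg t)
        linarith [hder t ht])
    simpa using this
  obtain ⟨Δ, hΔ⟩ : ∃ x, x = w.energy 0 - w.energy T + c₃ * δ * q * T := ⟨_, rfl⟩
  have hΔ0 : 0 ≤ Δ := by linarith
  obtain ⟨u, hu⟩ : ∃ x, x = √Δ := ⟨_, rfl⟩
  have hu2 : u ^ 2 = Δ := hu ▸ Real.sq_sqrt hΔ0
  have hu0 : 0 ≤ u := hu ▸ Real.sqrt_nonneg _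
  -- the largest value of the fast part on the window
  obtain ⟨t₁, ht₁, hmax⟩ := isCompact_Icc.exists_isMaxOn ⟨0, hT0⟩
    (fun t ht => (w.hasDerivWithinAt_fast ht).continuousWithinAt : ContinuousOn w.fast (Icc 0 T))
  obtain ⟨S, hS⟩ : ∃ x, x = √(w.fast t₁) := ⟨_, rfl⟩
  have hS0 : 0 ≤ S := hS ▸ Real.sqrt_nonneg _
  have hSf : ∀ t ∈ Icc 0 T, √(w.fast t) ≤ S := fun t ht => hS ▸ Real.sqrt_le_sqrt (hmax ht)
  have hS2 : S ^ 2 = w.fast t₁ := hS ▸ Real.sq_sqrt (w.fast_nonneg _)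
  have hfq : w.fast t₁ ≤ q ^ 2 := by
    have := hEq t₁ ht₁
    rw [w.energy_eq] at this
    linarith [sq_nonneg δ, sq_nonneg ‖w.ϑ t₁‖]
  have hS4 : S ^ 2 ≤ A₂ * (q * u) := by
    rcases hq0.eq_or_lt with h0 | hqpos
    · rw [← h0] at hfq ⊢
      rw [hS2]; simpa using hfq
    have h := sq_le_of_dissipation (E := w.energy) (P := w.fast) (e := c₃ * δ * q)
      (B := CB * q ^ 2) ha.le (by positivity) (fun t ht => w.hasDerivWithinAt_energy ht)
      (fun t ht => w.hasDerivWithinAt_fast ht) (fun t _ => w.fast_nonneg t)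
      (fun t ht => by
        have h1 : 0 ≤ ε₀ * ‖w.D t‖ := by positivity
        linarith [hder t ht])
      (fun t ht => (w.abs_fastDeriv_le hc₀ hc₁ hlam0 hsq hqQ hδq ht).trans
        (mul_le_mul_of_nonneg_right (by rw [hCB]; linarith [show 0 ≤ 1 / T by positivity])
          (sq_nonneg q))) ht₁ ?_
    · rw [← hS2, ← hΔ, ← hu2] at h
      refine le_of_sq_le_sq ?_ (by positivity)
      have h3 : A₂ ^ 2 = 4 * CB / a := hA₂ ▸ Real.sq_sqrt (by positivity)
      rw [mul_pow, h3, div_mul_eq_mul_div, le_div_iff₀ ha]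
      linarith [show 4 * (CB * q ^ 2) * u ^ 2 = 4 * CB * (q * u) ^ 2 by ring,
        mul_comm a ((S ^ 2) ^ 2)]
    · refine hfq.trans ?_
      calc q ^ 2 = 1 * q ^ 2 := (one_mul _).symm
        _ ≤ CB * T * q ^ 2 := by gcongr
        _ = _ := by ring
  have hVb : ∀ t ∈ Icc 0 T, ‖w.ϑ t - w.ϑ 0‖ ≤
      (S + c₁ * δ) * (c₀ * (1 + 2 * Q)) * T + Δ / (2 * ε₀) :=
    fun t ht => hΔ ▸ w.norm_ϑ_sub_le hc₀ (by positivity) hε₀ ha.le hSf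
      (fun t ht => (hsq t ht).trans hqQ) hder ht
  have hθ := w.norm_ϑ_zero_le hc₀ hlam0 hT.le (by positivity) hSf
    (fun t ht => ((w.norm_ϑ_le t).trans (hsq t ht)).trans hqQ) hVb
  have hθ' : ‖w.ϑ 0‖ ≤ A * (S + δ + u ^ 2) := by
    rw [hA, div_mul_eq_mul_div, le_div_iff₀ hκ, hu2]
    have e1 : 2 * S + ((lam + 2 * c₀) * S + c₁ * δ + 2 * c₀ * S * Q +
        c₀ * ((S + c₁ * δ) * (c₀ * (1 + 2 * Q)) * T + Δ / (2 * ε₀))) * T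
        = α * S + β * δ + γ * Δ := by
      rw [hα, hβ, hγ, hk]; field_simp; ring
    rw [e1] at hθ
    have : 0 ≤ α * δ + α * Δ + β * S + β * Δ + γ * S + γ * δ := by positivity
    linarith
  rw [hC']
  refine contraction_arith hq0 hu0 hqQ (norm_nonneg (w.ϑ 0)) hg1 hA₂0 (by linarith) hA₅ hq2 ?_ hθ'
    hS4 ?_ (hu2.trans hΔ) ?_
  · have h0 : w.fast 0 ≤ w.fast t₁ := hmax hT0
    rw [w.energy_eq, hS2]; linarith
  · refine le_of_sq_le_sq ?_ (by positivity)
    rw [hu2]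
    have h1 : Δ ≤ q ^ 2 + c₃ * q * q * T := by
      have h2 : c₃ * δ * q * T ≤ c₃ * q * q * T := by gcongr
      have h3 := hEq 0 hT0
      linarith [w.energy_nonneg T, sq_nonneg δ]
    have h4 : A₃ * 1 ≤ A₃ * A₃ := by gcongr
    calc Δ ≤ A₃ * q ^ 2 := by rw [hA₃]; linarith
      _ ≤ (A₃ * A₃) * q ^ 2 := by gcongr; linarith
      _ = _ := by ring
  · linarith [hEq 0 hT0, sq_nonneg δ]

end ErrorWindow

/-! ### Modes of the companion matrix -/

section Modal

variable {m : ℕ}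

/-- The modal coordinates of `x`: its pairings with the left eigenvectors `(r^(m-1), …, r, 1)` of
the companion matrix `matF b`, for the roots `r 0, …, r (m-1)` of `polyB b`. -/
def modal (r : Fin m → ℂ) : (Fin m → ℝ) →ₗ[ℝ] PiLp 2 (fun _ : Fin m => ℂ) where
  toFun x := WithLp.toLp 2 fun i => ∑ j : Fin m, r i ^ (m - 1 - j.val) * (x j : ℂ)
  map_add' x y := by
    ext i
    simp [mul_add, Finset.sum_add_distrib]
  map_smul' c x := by
    ext i
    simp only [Pi.smul_apply, smul_eq_mul, Complex.ofReal_mul, RingHom.id_apply, PiLp.smul_apply,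
      Complex.real_smul, Finset.mul_sum]
    exact Finset.sum_congr rfl fun j _ => by ring

theorem modal_apply (r : Fin m → ℂ) (x : Fin m → ℝ) (i : Fin m) :
    modal r x i = ∑ j : Fin m, r i ^ (m - 1 - j.val) * (x j : ℂ) := rfl

/-- The roots of `polyB b`, listed without repetition. -/
theorem RootsLeftOf.exists_roots {b : Fin m → ℝ} {μ : ℝ} (h : RootsLeftOf b μ) :
    ∃ r : Fin m → ℂ, Function.Injective r ∧ (∀ i, (polyB b).eval (r i) = 0) ∧
      ∀ i, (r i).re < -μ := by
  have hdeg : (∑ j : Fin m, Polynomial.C (b j : ℂ) * Polynomial.X ^ (m - 1 - j.val)).degree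
      < (m : WithBot ℕ) := by
    refine (Polynomial.degree_sum_le _ _).trans_lt
      ((Finset.sup_lt_iff (WithBot.bot_lt_coe m)).2 fun j _ => ?_)
    refine (Polynomial.degree_C_mul_X_pow_le _ _).trans_lt ?_
    have := j.2
    exact WithBot.coe_lt_coe.2 (show m - 1 - j.val < m by omega)
  have hnat : (polyB b).natDegree = m :=
    (Polynomial.natDegree_add_eq_left_of_degree_lt
      (by rwa [Polynomial.degree_X_pow])).trans (Polynomial.natDegree_X_pow m)
  have hne : polyB b ≠ 0 := (Polynomial.monic_X_pow_add hdeg).ne_zero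
  have hcard : (polyB b).roots.card = m := by
    rw [← (IsAlgClosed.splits (polyB b)).natDegree_eq_card_roots, hnat]
  have hlen : (polyB b).roots.toList.length = m := by rw [Multiset.length_toList, hcard]
  have hmem : ∀ i : Fin m, (polyB b).roots.toList.get (i.cast hlen.symm) ∈ (polyB b).roots :=
    fun i => Multiset.mem_toList.1 (List.get_mem _ _)
  refine ⟨fun i => (polyB b).roots.toList.get (i.cast hlen.symm), ?_, fun i => ?_, fun i => ?_⟩
  · intro i j hij
    have hnd : (polyB b).roots.toList.Nodup := by
      rw [← Multiset.coe_nodup, Multiset.coe_toList]; exact h.1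
    have := hnd.injective_get hij
    simpa using this
  · exact (Polynomial.mem_roots hne).1 (hmem i)
  · exact h.2 _ (hmem i)

/-- For a root `r i` of `polyB b`, the row `(r^(m-1), …, r, 1)` is a left eigenvector of the
companion matrix. -/
theorem modal_mulVec_matF {b : Fin m → ℝ} {r : Fin m → ℂ} {i : Fin m}
    (hr : (polyB b).eval (r i) = 0) (x : Fin m → ℝ) :
    modal r (matF b *ᵥ x) i = r i * modal r x i := by
  obtain ⟨n, rfl⟩ : ∃ n, m = n + 1 := ⟨m - 1, by have := i.2; omega⟩
  have hcol : ∀ l : Fin (n + 1), ∑ j : Fin (n + 1), r i ^ (n + 1 - 1 - j.val) * (matF b j l : ℂ)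
      = r i * r i ^ (n + 1 - 1 - l.val) := by
    intro l
    refine Fin.cases ?_ (fun l' => ?_) l
    · simp only [polyB, Polynomial.eval_add, Polynomial.eval_pow, Polynomial.eval_X,
        Polynomial.eval_finsetSum, Polynomial.eval_mul, Polynomial.eval_C] at hr
      have h2 : ∑ j : Fin (n + 1), r i ^ (n + 1 - 1 - j.val) * (matF b j 0 : ℂ)
          = -∑ j : Fin (n + 1), (b j : ℂ) * r i ^ (n + 1 - 1 - j.val) := by
        rw [← Finset.sum_neg_distrib]
        exact Finset.sum_congr rfl fun j _ => by simp [matF]; ring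
      rw [h2, ← eq_neg_of_add_eq_zero_left hr]
      simp [pow_succ']
    · rw [Finset.sum_eq_single l'.castSucc]
      · have := l'.2
        simp only [matF, of_apply, Fin.val_succ, Fin.val_castSucc, Nat.add_eq_zero_iff, one_ne_zero,
          and_false, if_false, if_true, zero_add, Complex.ofReal_one, mul_one]
        rw [← pow_succ']
        congr 1
        omega
      · intro j _ hj
        have : ¬ (l'.val + 1 = j.val + 1) := fun h => hj (Fin.ext (by simpa using h.symm))
        simp [matF]
        omega
      · simp
  simp only [modal_apply, mulVec, dotProduct, Complex.ofReal_sum, Complex.ofReal_mul,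
    Finset.mul_sum]
  rw [Finset.sum_comm]
  refine Finset.sum_congr rfl fun l _ => ?_
  rw [← mul_assoc (r i), ← hcol l, Finset.sum_mul]
  exact Finset.sum_congr rfl fun j _ => by ring

/-- For distinct roots the modal coordinates are injective, by the Vandermonde determinant. -/
theorem modal_injective {r : Fin m → ℂ} (hr : Function.Injective r) :
    Function.Injective (modal r) := by
  rw [← LinearMap.ker_eq_bot, LinearMap.ker_eq_bot']
  intro x hx
  have hV : (vandermonde r).det ≠ 0 := det_vandermonde_ne_zero_iff.2 hr
  have h0 : vandermonde r *ᵥ (fun j => (x (Fin.rev j) : ℂ)) = 0 := by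
    funext i
    have h := congrArg (fun y : PiLp 2 (fun _ : Fin m => ℂ) => y i) hx
    simp only [modal_apply] at h
    rw [← Equiv.sum_comp Fin.revPerm] at h
    simp only [mulVec, dotProduct, vandermonde_apply, Pi.zero_apply]
    refine Eq.trans (Finset.sum_congr rfl fun j _ => ?_) h
    have := j.2
    simp only [Fin.revPerm_apply, Fin.val_rev]
    congr 2
    omega
  have h1 := eq_zero_of_mulVec_eq_zero hV h0
  funext j
  have := congrFun h1 (Fin.rev j)
  simpa using this

/-- An injective linear map from a finite-dimensional space is a norm equivalence. -/
theorem exists_norm_equiv {E F : Type*} [NormedAddCommGroup E] [NormedSpace ℝ E]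
    [FiniteDimensional ℝ E] [NormedAddCommGroup F] [NormedSpace ℝ F] {f : E →ₗ[ℝ] F}
    (hf : Function.Injective f) :
    ∃ C : ℝ, 0 < C ∧ ∀ x, ‖x‖ ≤ C * ‖f x‖ ∧ ‖f x‖ ≤ C * ‖x‖ := by
  obtain ⟨K, _, hK⟩ := f.exists_antilipschitzWith (LinearMap.ker_eq_bot.2 hf)
  refine ⟨max (K : ℝ) ‖f.toContinuousLinearMap‖ + 1, by positivity, fun x => ⟨?_, ?_⟩⟩
  · have h := hK.le_mul_dist x 0
    simp only [dist_zero_right, map_zero] at h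
    exact h.trans (mul_le_mul_of_nonneg_right
      ((le_max_left _ _).trans (by linarith)) (norm_nonneg _))
  · exact (f.toContinuousLinearMap.le_opNorm x).trans
      (mul_le_mul_of_nonneg_right ((le_max_right _ _).trans (by linarith)) (norm_nonneg _))

/-- In modal coordinates `matF b` is diagonal, hence dissipative. -/
theorem inner_modal_matF_le {b : Fin m → ℝ} {r : Fin m → ℂ} {a : ℝ}
    (hr : ∀ i, (polyB b).eval (r i) = 0) (ha : ∀ i, (r i).re ≤ -a) (x : Fin m → ℝ) :
    inner ℝ (modal r x) (modal r (matF b *ᵥ x)) ≤ -a * ‖modal r x‖ ^ 2 := by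
  rw [PiLp.inner_apply, PiLp.norm_sq_eq_of_L2, Finset.mul_sum]
  refine Finset.sum_le_sum fun i _ => ?_
  rw [modal_mulVec_matF (hr i), Complex.inner]
  have : (r i * modal r x i * starRingEnd ℂ (modal r x i)).re
      = (r i).re * ‖modal r x i‖ ^ 2 := by
    rw [← Complex.normSq_eq_norm_sq, mul_assoc, Complex.mul_conj]
    simp
  rw [this]
  exact mul_le_mul_of_nonneg_right (ha i) (sq_nonneg _)

theorem exists_re_le_neg {r : Fin m → ℂ} (h : ∀ i, (r i).re < -0) :
    ∃ a : ℝ, 0 < a ∧ ∀ i, (r i).re ≤ -a := by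
  rcases isEmpty_or_nonempty (Fin m) with h0 | h0
  · exact ⟨1, one_pos, fun i => (h0.false i).elim⟩
  · obtain ⟨i, -, hi⟩ := Finset.exists_max_image Finset.univ (fun i => (r i).re)
      Finset.univ_nonempty
    have := h i
    exact ⟨-(r i).re, by linarith, fun j => by simpa using hi j (Finset.mem_univ _)⟩

section Exponential

-- The derivative of the exponential is computed in an auxiliary normed algebra structure, the
-- statements about its entries do not refer to it.
attribute [local instance] Matrix.linftyOpNormedRing Matrix.linftyOpNormedAlgebra

theorem hasDerivAt_exp_smul_matrix (F : Matrix (Fin m) (Fin m) ℝ) (t : ℝ) (i j : Fin m) :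
    HasDerivAt (fun t : ℝ => NormedSpace.exp (t • F) i j)
      ((F * NormedSpace.exp (t • F)) i j) t := by
  have h := hasDerivAt_exp_smul_const' (𝕂 := ℝ) F t
  exact hasDerivAt_pi.1 (hasDerivAt_pi.1 h i) j

theorem exp_smul_add (F : Matrix (Fin m) (Fin m) ℝ) (s t : ℝ) :
    NormedSpace.exp ((s + t) • F) = NormedSpace.exp (s • F) * NormedSpace.exp (t • F) := by
  rw [add_smul]
  exact NormedSpace.exp_add_of_commute (((Commute.refl F).smul_left s).smul_right t)

end Exponential

theorem continuous_exp_smul_matrix (F : Matrix (Fin m) (Fin m) ℝ) :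
    Continuous (fun t : ℝ => NormedSpace.exp (t • F)) :=
  continuous_pi fun i => continuous_pi fun j =>
    continuous_iff_continuousAt.2 fun t => (hasDerivAt_exp_smul_matrix F t i j).continuousAt

theorem hasDerivAt_exp_mulVec (F : Matrix (Fin m) (Fin m) ℝ) {w : ℝ → Fin m → ℝ} {w' : Fin m → ℝ}
    {t : ℝ} (hw : HasDerivAt w w' t) :
    HasDerivAt (fun t => NormedSpace.exp (t • F) *ᵥ w t)
      (F *ᵥ (NormedSpace.exp (t • F) *ᵥ w t) + NormedSpace.exp (t • F) *ᵥ w') t := by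
  rw [hasDerivAt_pi]
  intro i
  have := HasDerivAt.fun_sum (u := Finset.univ) fun j _ =>
    (hasDerivAt_exp_smul_matrix F t i j).mul (hasDerivAt_pi.1 hw j)
  refine this.congr_deriv ?_
  rw [Finset.sum_add_distrib, mulVec_mulVec]
  rfl

theorem modal_exp {b : Fin m → ℝ} {r : Fin m → ℂ} {i : Fin m}
    (hr : (polyB b).eval (r i) = 0) (x : Fin m → ℝ) (t : ℝ) :
    modal r (NormedSpace.exp (t • matF b) *ᵥ x) i = Complex.exp (r i * t) * modal r x i := by
  have h1 : ∀ t : ℝ, HasDerivAt (fun t : ℝ => modal r (NormedSpace.exp (t • matF b) *ᵥ x) i)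
      (r i * modal r (NormedSpace.exp (t • matF b) *ᵥ x) i) t := by
    intro t
    have h2 := hasDerivAt_exp_mulVec (matF b) (hasDerivAt_const t x)
    have h3 := ((modal r).toContinuousLinearMap.hasFDerivAt.comp_hasDerivAt t h2)
    have h4 := (PiLp.proj 2 (𝕜 := ℝ) (fun _ : Fin m => ℂ) i).hasFDerivAt.comp_hasDerivAt t h3
    refine h4.congr_deriv ?_
    simp only [mulVec_zero, add_zero]
    exact modal_mulVec_matF hr _
  have h2 : ∀ t : ℝ, HasDerivAt (fun t : ℝ => modal r (NormedSpace.exp (t • matF b) *ᵥ x) i *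
      Complex.exp (-r i * t)) 0 t := by
    intro t
    have h3 : HasDerivAt (fun t : ℝ => Complex.exp (-r i * t))
        (Complex.exp (-r i * t) * -r i) t := by
      have := ((Complex.ofRealCLM.hasDerivAt (x := t)).const_mul (-r i)).cexp
      simpa using this
    refine ((h1 t).mul h3).congr_deriv (by ring)
  have h3 := is_const_of_deriv_eq_zero (fun t => (h2 t).differentiableAt)
    (fun t => (h2 t).deriv) t 0
  simp only [zero_smul, NormedSpace.exp_zero, one_mulVec, Complex.ofReal_zero, mul_zero,
    Complex.exp_zero, mul_one] at h3
  rw [← h3, mul_left_comm, ← Complex.exp_add]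
  simp

theorem norm_modal_exp_le {b : Fin m → ℝ} {r : Fin m → ℂ} {a : ℝ}
    (hr : ∀ i, (polyB b).eval (r i) = 0) (ha : ∀ i, (r i).re ≤ -a) (x : Fin m → ℝ) {t : ℝ}
    (ht : 0 ≤ t) :
    ‖modal r (NormedSpace.exp (t • matF b) *ᵥ x)‖ ≤ Real.exp (-a * t) * ‖modal r x‖ := by
  refine le_of_sq_le_sq ?_ (by positivity)
  rw [mul_pow, PiLp.norm_sq_eq_of_L2, PiLp.norm_sq_eq_of_L2, Finset.mul_sum]
  refine Finset.sum_le_sum fun i _ => ?_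
  rw [modal_exp (hr i), norm_mul, mul_pow, Complex.norm_exp]
  gcongr
  have : (r i * (t : ℂ)).re = (r i).re * t := by simp
  rw [this]
  exact mul_le_mul_of_nonneg_right (ha i) ht

/-- Exponential decay of the matrix exponential of `matF b`. -/
theorem exists_norm_exp_le {b : Fin m → ℝ} {r : Fin m → ℂ} {a : ℝ} (hinj : Function.Injective r)
    (hr : ∀ i, (polyB b).eval (r i) = 0) (ha : ∀ i, (r i).re ≤ -a) :
    ∃ C : ℝ, 0 < C ∧ ∀ (x : Fin m → ℝ) (t : ℝ), 0 ≤ t →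
      ‖NormedSpace.exp (t • matF b) *ᵥ x‖ ≤ C * Real.exp (-a * t) * ‖x‖ := by
  obtain ⟨C, hC, h⟩ := exists_norm_equiv (modal_injective hinj)
  refine ⟨C * C, by positivity, fun x t ht => ?_⟩
  calc _ ≤ C * ‖modal r (NormedSpace.exp (t • matF b) *ᵥ x)‖ := (h _).1
    _ ≤ C * (Real.exp (-a * t) * (C * ‖x‖)) := by
        gcongr
        exact (norm_modal_exp_le hr ha x ht).trans (by gcongr; exact (h x).2)
    _ = _ := by ring

end Modal

/-! ### Convolution with the past -/

section PastConvolution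

variable {m : ℕ}

/-- The forcing `u` of `x' = F x + u`, transported to time `0` by the linear flow. -/
def pulledBack (F : Matrix (Fin m) (Fin m) ℝ) (u : ℝ → Fin m → ℝ) (s : ℝ) : Fin m → ℝ :=
  NormedSpace.exp ((-s) • F) *ᵥ u s

/-- The value at time `0` of the bounded solution of `x' = F x + u` for a Hurwitz matrix `F`. -/
def pastConv (F : Matrix (Fin m) (Fin m) ℝ) (u : ℝ → Fin m → ℝ) : Fin m → ℝ :=
  ∫ s in Iic (0 : ℝ), pulledBack F u s

/-- `F` is Hurwitz with rate `a`: the operator norm of `exp (t F)` for the sup norm is at most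
`C exp (-a t)` for all `t ≥ 0`. -/
def ExpBound (F : Matrix (Fin m) (Fin m) ℝ) (C a : ℝ) : Prop :=
  ∀ (x : Fin m → ℝ) (t : ℝ), 0 ≤ t → ‖NormedSpace.exp (t • F) *ᵥ x‖ ≤ C * Real.exp (-a * t) * ‖x‖

variable {F : Matrix (Fin m) (Fin m) ℝ} {C a : ℝ}

theorem continuous_pulledBack (F : Matrix (Fin m) (Fin m) ℝ) {u : ℝ → Fin m → ℝ}
    (hu : Continuous u) : Continuous (pulledBack F u) :=
  ((continuous_exp_smul_matrix F).comp continuous_neg).matrix_mulVec hu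

theorem ExpBound.norm_le (hF : ExpBound F C a) (hC : 0 ≤ C) {u : ℝ → Fin m → ℝ} {B c : ℝ}
    (hB : ∀ s ≤ 0, ‖u s‖ ≤ B * Real.exp (-c * s)) {s : ℝ} (hs : s ≤ 0) :
    ‖pulledBack F u s‖ ≤ C * B * Real.exp ((a - c) * s) := by
  calc _ ≤ C * Real.exp (-a * -s) * ‖u s‖ := hF _ _ (by linarith)
    _ ≤ C * Real.exp (-a * -s) * (B * Real.exp (-c * s)) := by gcongr; exact hB s hs
    _ = C * B * (Real.exp (-a * -s) * Real.exp (-c * s)) := by ring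
    _ = _ := by rw [← Real.exp_add]; congr 2; ring

theorem ExpBound.integrableOn (hF : ExpBound F C a) (hC : 0 ≤ C) {u : ℝ → Fin m → ℝ} {B c : ℝ}
    (hca : c < a) (hu : Continuous u) (hB : ∀ s ≤ 0, ‖u s‖ ≤ B * Real.exp (-c * s)) :
    MeasureTheory.IntegrableOn (pulledBack F u) (Iic 0) := by
  refine MeasureTheory.Integrable.mono'
    ((integrableOn_exp_mul_Iic (sub_pos.2 hca) 0).const_mul (C * B))
    (continuous_pulledBack F hu).aestronglyMeasurable ?_
  exact (MeasureTheory.ae_restrict_iff' measurableSet_Iic).2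
    (Filter.Eventually.of_forall fun s hs => hF.norm_le hC hB hs)

/-- A forcing that grows backwards in time at a rate `c < a` is compensated by the decay of the
linear flow. -/
theorem ExpBound.norm_pastConv_le (hF : ExpBound F C a) (hC : 0 ≤ C) {u : ℝ → Fin m → ℝ} {B c : ℝ}
    (hca : c < a) (hB : ∀ s ≤ 0, ‖u s‖ ≤ B * Real.exp (-c * s)) :
    ‖pastConv F u‖ ≤ C * B / (a - c) := by
  have h := MeasureTheory.norm_integral_le_of_norm_le
    ((integrableOn_exp_mul_Iic (sub_pos.2 hca) 0).const_mul (C * B))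
    ((MeasureTheory.ae_restrict_iff' measurableSet_Iic).2
      (Filter.Eventually.of_forall fun s hs => hF.norm_le hC hB hs))
  rw [MeasureTheory.integral_const_mul, integral_exp_mul_Iic (sub_pos.2 hca)] at h
  simpa [pastConv, div_eq_mul_inv] using h

theorem ExpBound.pastConv_sub (hF : ExpBound F C a) (hC : 0 ≤ C) (ha : 0 < a)
    {u v : ℝ → Fin m → ℝ} {B : ℝ} (hu : Continuous u) (hv : Continuous v)
    (hBu : ∀ s, ‖u s‖ ≤ B) (hBv : ∀ s, ‖v s‖ ≤ B) :
    pastConv F (fun s => u s - v s) = pastConv F u - pastConv F v := by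
  have h1 := hF.integrableOn hC ha hu (B := B) (c := 0) (fun s _ => by simpa using hBu s)
  have h2 := hF.integrableOn hC ha hv (B := B) (c := 0) (fun s _ => by simpa using hBv s)
  simp only [pastConv, pulledBack, mulVec_sub]
  exact MeasureTheory.integral_sub h1 h2

theorem pastConv_apply {u : ℝ → Fin m → ℝ}
    (hi : MeasureTheory.IntegrableOn (pulledBack F u) (Iic 0))
    (i : Fin m) :
    pastConv F u i = ∫ s in Iic (0 : ℝ), pulledBack F u s i :=
  MeasureTheory.eval_integral (fun i => hi.eval i) i

/-- The bounded solution of `x' = F x + u` at time `t`, by variation of constants from its value at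
time `0`. -/
theorem pastConv_comp_add {u : ℝ → Fin m → ℝ} (t : ℝ)
    (hi : MeasureTheory.IntegrableOn (pulledBack F u) (Iic 0))
    (hu : Continuous u) :
    pastConv F (fun s => u (t + s)) = NormedSpace.exp (t • F) *ᵥ
      (pastConv F u + ∫ s in (0 : ℝ)..t, pulledBack F u s) := by
  have hit : MeasureTheory.IntegrableOn (pulledBack F u) (Iic t) := by
    have h2 : MeasureTheory.IntegrableOn (pulledBack F u) (Icc 0 t) :=
      (continuous_pulledBack F hu).integrableOn_Icc
    refine (hi.union h2).mono_set fun s hs => ?_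
    rcases le_total s 0 with h | h
    · exact Or.inl h
    · exact Or.inr ⟨h, hs⟩
  have h1 := intervalIntegral.integral_Iic_sub_Iic hi hit
  have h2 : pastConv F u + ∫ s in (0 : ℝ)..t, pulledBack F u s
      = ∫ s in Iic t, pulledBack F u s := by
    rw [← h1, pastConv]; abel
  rw [h2]
  have h3 := (Matrix.toLin' (NormedSpace.exp (t • F))).toContinuousLinearMap.integral_comp_comm hit
  simp only [LinearMap.coe_toContinuousLinearMap', Matrix.toLin'_apply] at h3
  rw [← h3, pastConv]
  have h4 := (MeasureTheory.measurePreserving_add_left MeasureTheory.volume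
    t).setIntegral_preimage_emb
    (measurableEmbedding_addLeft t) (fun s => NormedSpace.exp (t • F) *ᵥ pulledBack F u s) (Iic t)
  have h5 : (fun s => t + s) ⁻¹' Iic t = Iic 0 := by ext s; simp
  rw [← h4, h5]
  refine MeasureTheory.integral_congr_ae (Eventually.of_forall fun s => ?_)
  simp only [pulledBack, mulVec_mulVec]
  rw [← exp_smul_add]
  congr 3
  ring

theorem ExpBound.hasDerivAt_pastConv (hF : ExpBound F C a) (hC : 0 ≤ C) (ha : 0 < a)
    {u : ℝ → Fin m → ℝ} {B : ℝ} (hu : Continuous u) (hB : ∀ s, ‖u s‖ ≤ B) (t : ℝ) :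
    HasDerivAt (fun t => pastConv F (fun s => u (t + s)))
      (F *ᵥ pastConv F (fun s => u (t + s)) + u t) t := by
  have hi := hF.integrableOn hC ha hu (B := B) (c := 0) (fun s _ => by simpa using hB s)
  have h1 : HasDerivAt (fun t => pastConv F u +
      ∫ s in (0 : ℝ)..t, pulledBack F u s) (NormedSpace.exp ((-t) • F) *ᵥ u t) t :=
    ((continuous_pulledBack F hu).integral_hasStrictDerivAt 0 t).hasDerivAt.const_add _
  have h2 := hasDerivAt_exp_mulVec F h1
  simp only [← pastConv_comp_add _ hi hu] at h2
  rwa [mulVec_mulVec, ← exp_smul_add, add_neg_cancel, zero_smul, NormedSpace.exp_zero,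
    one_mulVec] at h2

end PastConvolution

/-! ### The attracting set of the zero dynamics of the plant -/

section AttractingSet

theorem omegaLimit_congr {α β : Type*} [TopologicalSpace β] {ϕ ϕ' : ℝ → α → β} {s : Set α}
    (h : ∀ t, 0 ≤ t → ∀ x ∈ s, ϕ t x = ϕ' t x) :
    omegaLimit atTop ϕ s = omegaLimit atTop ϕ' s := by
  rw [omegaLimit_eq_biInter_inter _ _ _ (Ici_mem_atTop (0 : ℝ)),
    omegaLimit_eq_biInter_inter _ _ _ (Ici_mem_atTop (0 : ℝ))]
  refine iInter₂_congr fun u _ => ?_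
  rw [image2_congr fun t ht x hx => h t ht.2 x hx]

variable {E : Type*} [NormedAddCommGroup E] [NormedSpace ℝ E]

/-- The limit set `A` of the set `B` of initial conditions of `ẋ = f x`, together with a global flow
`ψ` that agrees with the solutions near `A` and with those that start in `B`. Orbits of `ψ` separate
at most at the rate `K`, and `A` attracts its `d`-neighbourhood in `D` exponentially with constants
`M` and `a`. -/
structure AttractingSet (f : E → E) (D B A : Set E) (ψ : Flow ℝ E) (K M a d : ℝ) : Prop where
  isCompact : IsCompact A
  nonempty : A.Nonempty
  subset : A ⊆ D
  subset_initial : A ⊆ B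
  flow_mem : ∀ z ∈ A, ∀ t, ψ t z ∈ A
  odeFlow_eq : ∀ z ∈ A, ∀ t, odeFlow f t z = ψ t z
  hasDerivAt : ∀ z ∈ A, ∀ t, HasDerivAt (fun t => ψ t z) (f (ψ t z)) t
  nonneg_K : 0 ≤ K
  one_le_M : 1 ≤ M
  pos_a : 0 < a
  pos_d : 0 < d
  dist_flow_le : ∀ t x y, dist (ψ t x) (ψ t y) ≤ dist x y * Real.exp (K * |t|)
  attracts : ∀ z ∈ D, Metric.infDist z A ≤ d →
    IsIntegralCurveOn (fun t => ψ t z) (fun _ => f) (Ici 0) ∧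
      ∀ t, 0 ≤ t → Metric.infDist (ψ t z) A ≤ M * Real.exp (-a * t) * Metric.infDist z A
  isIntegralCurveOn : ∀ z ∈ B, IsIntegralCurveOn (fun t => ψ t z) (fun _ => f) (Ici 0)
  bounded : ∃ c ⊆ D, IsCompact c ∧ ∀ z ∈ B, ∀ t, 0 ≤ t → ψ t z ∈ c
  absorbs : ∀ ε > 0, ∃ T, 0 ≤ T ∧ ∀ z ∈ B, ∀ t, T ≤ t → Metric.infDist (ψ t z) A ≤ ε

/-- Solutions that stay in a ball, where `f` agrees with a bounded Lipschitz field, follow the flow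
of that field. -/
theorem eq_flow_of_mem_closedBall {f g : E → E} {K : NNReal} {R : ℝ} {ψ : Flow ℝ E}
    (hg : LipschitzWith K g) (hψ : ∀ x, IsIntegralCurve (fun t => ψ t x) (fun _ => g))
    (hgf : EqOn g f (Metric.closedBall 0 R)) {γ : ℝ → E}
    (hγ : IsIntegralCurveOn γ (fun _ => f) (Ici 0)) (hR : ∀ t, 0 ≤ t → ‖γ t‖ ≤ R) :
    (∀ t, 0 ≤ t → ψ t (γ 0) = γ t) ∧
      IsIntegralCurveOn (fun t => ψ t (γ 0)) (fun _ => f) (Ici 0) := by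
  have heq : ∀ t, 0 ≤ t → g (γ t) = f (γ t) := fun t ht => hgf (by simpa using hR t ht)
  have h1 : ∀ t, 0 ≤ t → ψ t (γ 0) = γ t := by
    intro t ht
    have hγ' : IsIntegralCurveOn γ (fun _ => f) (Icc 0 t) := hγ.mono Icc_subset_Ici_self
    have := ODE_solution_unique_of_mem_Icc_right (v := fun _ => g) (s := fun _ => univ)
      (f := fun t => ψ t (γ 0)) (g := γ) (a := 0) (b := t)
      (fun _ _ => hg.lipschitzOnWith) (hψ _).continuous.continuousOn
      (fun u _ => (hψ _ u).hasDerivWithinAt) (fun _ _ => mem_univ _) hγ'.continuousOn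
      (fun u hu => by rw [heq u hu.1]; exact hγ'.hasDerivWithinAt_Ici hu)
      (fun _ _ => mem_univ _) (by simp)
    exact this ⟨ht, le_rfl⟩
  refine ⟨h1, fun t ht => ?_⟩
  have : HasDerivWithinAt (fun t => ψ t (γ 0)) (g (ψ t (γ 0))) (Ici 0) t :=
    (hψ (γ 0) t).hasDerivWithinAt
  rwa [show g (ψ t (γ 0)) = f (ψ t (γ 0)) by rw [h1 t ht, heq t ht]] at this

/-- The flow `ψ` is that of a bounded Lipschitz field that agrees with `f` on a ball containing the
compact set `c` and the solutions that start near the limit set. -/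
theorem exists_attractingSet [FiniteDimensional ℝ E] {f : E → E} (hf : ContDiff ℝ 1 f)
    {D B c : Set E} (hc : IsCompact c) (hcD : c ⊆ D)
    (horb : ∀ z ∈ B, ∃ γ : ℝ → E, γ 0 = z ∧ IsIntegralCurveOn γ (fun _ => f) (Ici 0) ∧
      ∀ t, 0 ≤ t → γ t ∈ c)
    (hd : ∃ d₁ : ℝ, 0 < d₁ ∧ ∀ z ∈ D, Metric.infDist z (odeOmega f B) ≤ d₁ → z ∈ B)
    (hA : LocallyExponentiallyAttractive f D (odeOmega f B)) :
    odeOmega f B ⊆ c ∧ ∃ ψ K M a d, AttractingSet f D B (odeOmega f B) ψ K M a d := by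
  obtain ⟨hne, M, hM, a, ha, d, hdpos, hatt⟩ := hA
  obtain ⟨R, hR⟩ := hc.isBounded.exists_norm_le
  obtain ⟨g, K, C, hg, hC, hgf⟩ :=
    exists_lipschitz_bounded_eqOn_closedBall hf (max R (R + M * d + 1))
  obtain ⟨ψ, hψ, hdist⟩ := exists_flow_of_lipschitz_bounded hg hC
  have hBc : ∀ z ∈ B, (∀ t, 0 ≤ t → ψ t z ∈ c) ∧
      IsIntegralCurveOn (fun t => ψ t z) (fun _ => f) (Ici 0) := by
    rintro z hz
    obtain ⟨γ, rfl, hγ, hγc⟩ := horb z hz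
    obtain ⟨h1, h2⟩ := eq_flow_of_mem_closedBall hg hψ hgf hγ
      (fun t ht => (hR _ (hγc t ht)).trans (le_max_left _ _))
    exact ⟨fun t ht => by rw [h1 t ht]; exact hγc t ht, h2⟩
  have hω : odeOmega f B = omegaLimit atTop ψ B := by
    refine omegaLimit_congr fun t ht z hz => ?_
    refine odeFlow_eq_of_contDiff hf (γ := fun t => ψ t z) (by simp) ?_
    rw [uIcc_of_le ht]
    exact (hBc z hz).2.mono Icc_subset_Ici_self
  have hAc : odeOmega f B ⊆ c := by
    rw [hω]
    refine (omegaLimit_subset_closure_image2 _ _ _ (Ici_mem_atTop (0 : ℝ))).trans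
      (closure_minimal ?_ hc.isClosed)
    rintro _ ⟨t, ht, z, hz, rfl⟩
    exact (hBc z hz).1 t ht
  have hclosed : IsClosed (odeOmega f B) := isClosed_omegaLimit _ _ _
  have hcomp : IsCompact (odeOmega f B) := hc.of_isClosed_subset hclosed hAc
  have hinv : ∀ z ∈ odeOmega f B, ∀ t, ψ t z ∈ odeOmega f B := by
    intro z hz t
    rw [hω] at hz ⊢
    exact Flow.isInvariant_omegaLimit atTop ψ B
      (fun t => tendsto_atTop_add_const_left _ t tendsto_id)
      t hz
  have hder : ∀ z ∈ odeOmega f B, ∀ t, HasDerivAt (fun t => ψ t z) (f (ψ t z)) t := by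
    intro z hz t
    have h1 : g (ψ t z) = f (ψ t z) := hgf (by
      simpa using Or.inl (hR _ (hAc (hinv z hz t))))
    have : HasDerivAt (fun t => ψ t z) (g (ψ t z)) t := hψ z t
    rwa [h1] at this
  obtain ⟨d₁, hd₁, hsub⟩ := hd
  refine ⟨hAc, ψ, K, M, a, d, hcomp, hne, hAc.trans hcD, fun z hz => hsub z (hcD (hAc hz))
    (by rw [Metric.infDist_zero_of_mem hz]; exact hd₁.le), hinv, fun z hz t => ?_, hder, K.2, hM,
    ha, hdpos, hdist, fun z hz hzd => ?_, fun z hz => (hBc z hz).2,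
    ⟨c, hcD, hc, fun z hz => (hBc z hz).1⟩,
    fun ε hε => ?_⟩
  · exact odeFlow_eq_of_contDiff hf (γ := fun t => ψ t z) (by simp)
      fun u _ => (hder z hz u).hasDerivWithinAt
  · obtain ⟨γ, rfl, hγ, hγd⟩ := hatt z hz hzd
    have hle : ∀ t, 0 ≤ t → ‖γ t‖ ≤ max R (R + M * d + 1) := by
      intro t ht
      refine le_max_of_le_right ?_
      obtain ⟨y, hy, hyd⟩ := hcomp.exists_infDist_eq_dist hne (γ t)
      have h1 : M * Real.exp (-a * t) * Metric.infDist (γ 0) (odeOmega f B) ≤ M * d := by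
        have : Real.exp (-a * t) ≤ 1 := Real.exp_le_one_iff.2 (by nlinarith)
        calc _ ≤ M * 1 * d := by
              gcongr
              exact Metric.infDist_nonneg
          _ = M * d := by ring
      have h2 := hγd t ht
      have h3 := hR y (hAc hy)
      have h4 : ‖γ t‖ ≤ ‖y‖ + dist (γ t) y := by
        rw [dist_eq_norm]
        simpa using norm_add_le y (γ t - y)
      linarith
    obtain ⟨h1, h2⟩ := eq_flow_of_mem_closedBall hg hψ hgf hγ hle
    exact ⟨h2, fun t ht => by rw [h1 t ht]; exact hγd t ht⟩
  · have hev := eventually_mapsTo_of_isCompact_absorbing_of_isOpen_of_omegaLimit_subset atTop ψ B hc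
      (eventually_atTop.2 ⟨0, fun t ht z hz => (hBc z hz).1 t ht⟩)
      (n := {x | Metric.infDist x (odeOmega f B) < ε})
      (isOpen_lt (Metric.continuous_infDist_pt _) continuous_const)
      (by rw [← hω]; intro x hx; simpa [Metric.infDist_zero_of_mem hx] using hε)
    obtain ⟨T, hT⟩ := eventually_atTop.1 hev
    exact ⟨max T 0, le_max_right _ _, fun z hz t ht =>
      le_of_lt (hT t ((le_max_left _ _).trans ht) hz)⟩

end AttractingSet

/-! ### Uniform persistence of excitation -/

section Excitation

/-- Along a flow on a compact invariant set, observability of a constant vector from the output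
`Fn (ψ t z) γ` over all times is uniform over a finite window of positive times, in integrated
form. -/
theorem exists_excitation_window {E V F : Type*} [TopologicalSpace E]
    [NormedAddCommGroup V] [NormedSpace ℝ V] [ProperSpace V]
    [NormedAddCommGroup F] [NormedSpace ℝ F] [CompleteSpace F] {ψ : Flow ℝ E} {A : Set E}
    (hA : IsCompact A) (hinv : ∀ z ∈ A, ∀ t, ψ t z ∈ A) {Fn : E → V → F}
    (hcont : ContinuousOn (fun p : E × V => Fn p.1 p.2) (A ×ˢ univ))
    (hsmul : ∀ z (c : ℝ) γ, Fn z (c • γ) = c • Fn z γ)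
    (hobs : ∀ z ∈ A, ∀ γ, (∀ t : ℝ, Fn (ψ t z) γ = 0) → γ = 0) :
    ∃ T κ : ℝ, 0 < T ∧ 0 < κ ∧ ∀ z ∈ A, ∀ γ, ∃ t ∈ Icc 0 T,
      κ * ‖γ‖ ≤ ‖∫ s in (0 : ℝ)..t, Fn (ψ s z) γ‖ := by
  have : CompactSpace A := isCompact_iff_compactSpace.1 hA
  let H : (A × Metric.sphere (0 : V) 1) → ℝ → F := fun p s => Fn (ψ s p.1) p.2
  have hH : Continuous (Function.uncurry H) := by
    have h1 : Continuous (fun q : (A × Metric.sphere (0 : V) 1) × ℝ =>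
        ((ψ q.2 q.1.1 : E), (q.1.2 : V))) :=
      (ψ.continuous continuous_snd (by fun_prop)).prodMk (by fun_prop)
    exact hcont.comp_continuous h1 fun q => ⟨hinv _ q.1.1.2 _, mem_univ _⟩
  have hHs : ∀ p, Continuous (H p) := fun p => hH.comp (Continuous.prodMk_right p)
  -- the pairs `(z, γ)`, with `γ` of norm one, for which excitation holds with constant `1 / (n +
  -- 1)` on the times of modulus at most `n`: these open sets increase to the whole compact space
  let U : ℕ → Set (A × Metric.sphere (0 : V) 1) := fun n =>
    {p | ∃ t : ℝ, |t| ≤ n ∧ 1 / ((n : ℝ) + 1) < ‖∫ s in (0 : ℝ)..t, H p s‖}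
  have hUo : ∀ n, IsOpen (U n) := by
    intro n
    have : U n = ⋃ t : ℝ, ⋃ _ : |t| ≤ n, {p | 1 / ((n : ℝ) + 1) < ‖∫ s in (0 : ℝ)..t, H p s‖} := by
      ext p; simp [U]
    rw [this]
    exact isOpen_iUnion fun t => isOpen_iUnion fun _ => isOpen_lt continuous_const
      (intervalIntegral.continuous_parametric_intervalIntegral_of_continuous' hH 0 t).norm
  have hUm : Monotone U := by
    rintro i j hij p ⟨t, ht, h⟩
    have hij' : (i : ℝ) ≤ j := by exact_mod_cast hij
    exact ⟨t, ht.trans hij', lt_of_le_of_lt (by gcongr) h⟩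
  have hUc : univ ⊆ ⋃ n, U n := by
    intro p _
    by_contra hp
    have hz : ∀ t : ℝ, ∫ s in (0 : ℝ)..t, H p s = 0 := by
      intro t
      by_contra hne
      obtain ⟨n, hn⟩ := exists_nat_one_div_lt (norm_pos_iff.2 hne)
      obtain ⟨n', hn'⟩ := exists_nat_ge |t|
      refine hp (mem_iUnion.2 ⟨max n n', t, hn'.trans (by push_cast; exact le_max_right _ _), ?_⟩)
      refine lt_of_le_of_lt ?_ hn
      push_cast
      gcongr
      exact le_max_left _ _
    have hzero : ∀ t, H p t = 0 := by
      intro t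
      have h1 := ((hHs p).integral_hasStrictDerivAt 0 t).hasDerivAt
      simp only [hz] at h1
      exact h1.unique (hasDerivAt_const t 0)
    have h2 := hobs _ p.1.2 _ hzero
    have h3 : ‖(p.2 : V)‖ = 1 := by simp
    rw [h2, norm_zero] at h3
    exact zero_ne_one h3
  obtain ⟨n, hn⟩ := isCompact_univ.elim_directed_cover U hUo hUc hUm.directed_le
  -- the window `[-n, n]` is moved to positive times by following the orbit of `ψ n z`; the integral
  -- from `n` to `t + n` is the difference of two integrals from `0`, whence the factor `1 / 2`
  refine ⟨2 * n + 1, 1 / ((n : ℝ) + 1) / 2, by positivity, by positivity, fun z hz γ => ?_⟩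
  rcases eq_or_ne γ 0 with rfl | hγ
  · exact ⟨0, ⟨le_rfl, by positivity⟩, by simp⟩
  have hγ' : 0 < ‖γ‖ := norm_pos_iff.2 hγ
  obtain ⟨t, ht, hlt⟩ := hn (mem_univ (⟨ψ n z, hinv z hz n⟩, ⟨‖γ‖⁻¹ • γ, by
    simp [norm_smul, hγ'.ne']⟩))
  have hcz : Continuous (fun s => Fn (ψ s z) γ) := by
    have h1 : Continuous (fun s : ℝ => (ψ s z, γ)) :=
      (ψ.continuous continuous_id continuous_const).prodMk continuous_const
    exact hcont.comp_continuous h1 fun s => ⟨hinv z hz s, mem_univ _⟩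
  have hint : ∫ s in (0 : ℝ)..t, H (⟨ψ n z, hinv z hz n⟩, ⟨‖γ‖⁻¹ • γ, by
      simp [norm_smul, hγ'.ne']⟩) s = ‖γ‖⁻¹ • ((∫ s in (0 : ℝ)..(t + n), Fn (ψ s z) γ)
        - ∫ s in (0 : ℝ)..n, Fn (ψ s z) γ) := by
    rw [intervalIntegral.integral_interval_sub_left (hcz.intervalIntegrable _ _)
      (hcz.intervalIntegrable _ _)]
    simp only [H, hsmul, ← Flow.map_add]
    rw [intervalIntegral.integral_smul, intervalIntegral.integral_comp_add_right
      (fun s => Fn (ψ s z) γ), zero_add]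
  rw [hint, norm_smul, norm_inv, norm_norm] at hlt
  have h1 : 1 / ((n : ℝ) + 1) * ‖γ‖ < ‖(∫ s in (0 : ℝ)..(t + n), Fn (ψ s z) γ)
        - ∫ s in (0 : ℝ)..n, Fn (ψ s z) γ‖ := by
    have := mul_lt_mul_of_pos_right hlt hγ'
    rwa [mul_right_comm, inv_mul_cancel₀ hγ'.ne', one_mul] at this
  have h2 := norm_sub_le (∫ s in (0 : ℝ)..(t + n), Fn (ψ s z) γ) (∫ s in (0 : ℝ)..n, Fn (ψ s z) γ)
  have ht' := abs_le.1 ht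
  by_contra! hcon
  have h3 := hcon (t + n) ⟨by linarith, by linarith⟩
  have h4 := hcon n ⟨by positivity, by linarith [(Nat.cast_nonneg n : (0 : ℝ) ≤ n)]⟩
  linarith

end Excitation

/-! ### The steady state on the attracting set -/

section SteadyState

theorem norm_mulVec_le {a b : ℕ} (M : Fin a → Fin b → ℝ) (v : Fin b → ℝ) :
    ‖Matrix.of M *ᵥ v‖ ≤ b * ‖M‖ * ‖v‖ := by
  refine (pi_norm_le_iff_of_nonneg (by positivity)).2 fun i => ?_
  simp only [mulVec, dotProduct, of_apply]
  refine (norm_sum_le _ _).trans ?_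
  calc ∑ j, ‖M i j * v j‖ ≤ ∑ _j : Fin b, ‖M‖ * ‖v‖ := Finset.sum_le_sum fun j _ => by
        rw [norm_mul]
        exact mul_le_mul ((norm_le_pi_norm (M i) j).trans (norm_le_pi_norm M i))
          (norm_le_pi_norm v j) (norm_nonneg _) (norm_nonneg _)
    _ = b * ‖M‖ * ‖v‖ := by simp; ring

theorem norm_matrix_mulVec_le {a b : ℕ} (M : Matrix (Fin a) (Fin b) ℝ) (v : Fin b → ℝ) :
    ‖M *ᵥ v‖ ≤ b * ‖Matrix.of.symm M‖ * ‖v‖ :=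
  norm_mulVec_le (Matrix.of.symm M) v

theorem primeC_dotProduct {m : ℕ} (x : Fin (m + 1) → ℝ) : primeC m ⬝ᵥ x = x 0 := by
  simp [primeC]

theorem matM_mulVec {m k : ℕ} (X : Fin m → Fin k → ℝ) (v : Fin k → ℝ) :
    matM X *ᵥ v = Fin.cons 0 (Matrix.of X *ᵥ v) := by
  funext i
  refine Fin.cases ?_ (fun i => ?_) i
  · simp [matM, mulVec]
  · simp [matM, mulVec]

theorem betaFn_dotProduct {m k : ℕ} (Ω : ℝ → Fin (m + 1) → Fin k → ℝ) (X : Fin m → Fin k → ℝ)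
    (y : ℝ) (v : Fin k → ℝ) :
    betaFn Ω X y ⬝ᵥ v =
      (primeA m *ᵥ (Fin.cons 0 (Matrix.of X *ᵥ v) : Fin (m + 1) → ℝ) + Matrix.of (Ω y) *ᵥ v) 0 := by
  rw [betaFn, ← dotProduct_mulVec, primeC_dotProduct, add_mulVec, ← mulVec_mulVec, matM_mulVec]

variable {p s n m k : ℕ} {S : Plant p s n}

theorem Plant.contDiff_zeroField (S : Plant p s n) : ContDiff ℝ 1 S.zeroField :=
  (contDiff_const.prodMk (S.contDiff_exo.comp contDiff_fst)).prodMk S.contDiff_f₀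

/-- The parameter `ϱ` is constant along solutions. -/
theorem Plant.param_eq {T : ℝ} (hT : 0 ≤ T) {γ : ℝ → ZState p s n}
    (h : IsIntegralCurveOn γ (fun _ => S.zeroField) (Icc 0 T)) : (γ T).1.1 = (γ 0).1.1 := by
  have hd : ∀ t ∈ Icc 0 T, HasDerivWithinAt (fun t => (γ t).1.1) 0 (Icc 0 T) t := fun t ht =>
    ((ContinuousLinearMap.fst ℝ (Fin p → ℝ) (Fin s → ℝ)).comp
      (ContinuousLinearMap.fst ℝ (ExoState p s) (Fin n → ℝ))).hasFDerivAt.comp_hasDerivWithinAt t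
        (h t ht)
  refine constant_of_derivWithin_zero (fun t ht => (hd t ht).differentiableWithinAt)
    (fun t ht => ?_) T ⟨hT, le_rfl⟩
  exact (hd t (Ico_subset_Icc_self ht)).derivWithin
    (uniqueDiffOn_Icc (lt_of_le_of_lt ht.1 ht.2) t (Ico_subset_Icc_self ht))

/-- The steady state of the closed loop over the limit set `A` of the plant: `(τ, σ)` solve the
internal-model equations along the orbits of `A`, they depend in a Lipschitz way on the point of
`A`, and the regressor is exciting on windows of length `T`. -/
structure SteadyState (S : Plant p s n) (A : Set (ZState p s n)) (ψ : Flow ℝ (ZState p s n))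
    (b : Fin m → ℝ) (τ : ZState p s n → Fin (m + 1) → ℝ)
    (σ : ZState p s n → Fin m → Fin k → ℝ) (θ : (Fin p → ℝ) → Fin k → ℝ)
    (φ : ℝ → Fin (m + 1) → ℝ) (Ω : ℝ → Fin (m + 1) → Fin k → ℝ) (L T κ : ℝ) : Prop where
  param_eq : ∀ z ∈ A, ∀ t, (ψ t z).1.1 = z.1.1
  hasDerivAt_tau : ∀ z ∈ A, ∀ t, HasDerivAt (fun t => τ (ψ t z))
    (primeA m *ᵥ τ (ψ t z) + φ (τ (ψ t z) 0) + Matrix.of (Ω (τ (ψ t z) 0)) *ᵥ θ z.1.1) t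
  c_eq : ∀ z ∈ A, -S.q (z, 0) = τ z 0
  hasDerivAt_sigma : ∀ z ∈ A, ∀ t, ∀ j, HasDerivAt (fun t => fun i => σ (ψ t z) i j)
    (matF b *ᵥ (fun i => σ (ψ t z) i j) + matG b *ᵥ fun l => Ω (τ (ψ t z) 0) l j) t
  nonneg_L : 0 ≤ L
  tau_lipschitz : ∀ z ∈ A, ∀ z' ∈ A, ‖τ z - τ z'‖ ≤ L * dist z z'
  sigma_lipschitz : ∀ z ∈ A, ∀ z' ∈ A, ‖σ z - σ z'‖ ≤ L * dist z z'
  theta_lipschitz : ∀ z ∈ A, ∀ z' ∈ A, ‖θ z.1.1 - θ z'.1.1‖ ≤ L * dist z z'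
  pos_T : 0 < T
  pos_κ : 0 < κ
  excitation : ∀ z ∈ A, ∀ γ : EuclideanSpace ℝ (Fin k), ∃ t ∈ Icc 0 T,
    κ * ‖γ‖ ≤ |∫ s in (0 : ℝ)..t, inner ℝ (WithLp.toLp 2 (betaFn Ω (σ (ψ s z)) (τ (ψ s z) 0))) γ|

theorem exists_tau_lipschitz {A U : Set (ZState p s n)} (hA : IsCompact A) (hU : IsOpen U)
    (hAU : A ⊆ U) {τ : ZState p s n → Fin (m + 1) → ℝ} (hτ : ContDiffOn ℝ 1 τ U) :
    ∃ L, LipschitzOnWith L τ A := by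
  have hloc : LocallyLipschitzOn A τ := by
    intro x hx
    obtain ⟨K, t, ht, h⟩ := (hτ.contDiffAt (hU.mem_nhds (hAU hx))).exists_lipschitzOnWith
    exact ⟨K, t, mem_nhdsWithin_of_mem_nhds ht, h⟩
  exact hloc.exists_lipschitzOnWith_of_compact hA

theorem hasDerivAt_tau {D B A U : Set (ZState p s n)} {ψ : Flow ℝ (ZState p s n)} {K M a d : ℝ}
    (hA : AttractingSet S.zeroField D B A ψ K M a d) (hU : IsOpen U)
    (hAU : A ⊆ U) {τ : ZState p s n → Fin (m + 1) → ℝ} (hτ : ContDiffOn ℝ 1 τ U)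
    {z : ZState p s n} (hz : z ∈ A) (t : ℝ) :
    HasDerivAt (fun t => τ (ψ t z)) (fderiv ℝ τ (ψ t z) (S.zeroField (ψ t z))) t :=
  ((hτ.contDiffAt (hU.mem_nhds (hAU (hA.flow_mem z hz t)))).differentiableAt
    one_ne_zero).hasFDerivAt.comp_hasDerivAt t (hA.hasDerivAt z hz t)

theorem AttractingSet.param_eq {D B A : Set (ZState p s n)} {ψ : Flow ℝ (ZState p s n)}
    {K M a d : ℝ} (hA : AttractingSet S.zeroField D B A ψ K M a d) {z : ZState p s n} (hz : z ∈ A)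
    (t : ℝ) : (ψ t z).1.1 = z.1.1 := by
  have key : ∀ z ∈ A, ∀ t, 0 ≤ t → (ψ t z).1.1 = z.1.1 := fun z hz t ht => by
    have := Plant.param_eq (γ := fun t => ψ t z) ht
      (fun u _ => (hA.hasDerivAt z hz u).hasDerivWithinAt)
    simpa using this
  rcases le_total 0 t with ht | ht
  · exact key z hz t ht
  · have := key _ (hA.flow_mem z hz t) (-t) (by linarith)
    rw [← Flow.map_add] at this
    simpa using this.symm

section Sigma

variable {D B A : Set (ZState p s n)} {ψ : Flow ℝ (ZState p s n)} {K M a d : ℝ}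
  {b : Fin m → ℝ} {τ : ZState p s n → Fin (m + 1) → ℝ} {Ω : ℝ → Fin (m + 1) → Fin k → ℝ}

/-- The `j`-th column of the forcing `G Ω(τ₁)` along the orbit of `z`. -/
def sigmaForcing (b : Fin m → ℝ) (τ : ZState p s n → Fin (m + 1) → ℝ)
    (Ω : ℝ → Fin (m + 1) → Fin k → ℝ) (ψ : Flow ℝ (ZState p s n)) (z : ZState p s n) (j : Fin k)
    (t : ℝ) : Fin m → ℝ :=
  matG b *ᵥ fun l => Ω (τ (ψ t z) 0) l j

theorem AttractingSet.continuous_comp (hA : AttractingSet S.zeroField D B A ψ K M a d)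
    {F : Type*} [TopologicalSpace F] {g : ZState p s n → F} (hg : ContinuousOn g A)
    {z : ZState p s n} (hz : z ∈ A) : Continuous fun t => g (ψ t z) :=
  hg.comp_continuous (ψ.continuous continuous_id continuous_const) fun t => hA.flow_mem z hz t

theorem continuous_sigmaForcing (hA : AttractingSet S.zeroField D B A ψ K M a d)
    (hτ : ContinuousOn τ A) (hΩ : Continuous Ω) {z : ZState p s n} (hz : z ∈ A) (j : Fin k) :
    Continuous (sigmaForcing b τ Ω ψ z j) := by
  have h1 := hA.continuous_comp hτ hz
  refine continuous_const.matrix_mulVec (continuous_pi fun l => ?_)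
  have : Continuous fun y => Ω y l j := by fun_prop
  exact this.comp ((continuous_apply 0).comp h1)

theorem norm_sigmaForcing_le {C : ℝ} (hC : ∀ y, ‖Ω y‖ ≤ C) (z : ZState p s n) (j : Fin k) (t : ℝ) :
    ‖sigmaForcing b τ Ω ψ z j t‖ ≤ (m + 1 : ℕ) * ‖Matrix.of.symm (matG b)‖ * C := by
  refine (norm_matrix_mulVec_le (matG b) _).trans ?_
  gcongr
  refine (pi_norm_le_iff_of_nonneg ((norm_nonneg _).trans (hC 0))).2 fun l => ?_
  exact ((norm_le_pi_norm _ j).trans (norm_le_pi_norm _ l)).trans (hC _)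

theorem sigma_integrand (hA : AttractingSet S.zeroField D B A ψ K M a d) {z : ZState p s n}
    (hz : z ∈ A) (i : Fin m) (j : Fin k) (t : ℝ) :
    (NormedSpace.exp ((-t) • matF b) *
      (matG b * Matrix.of (Ω (τ (odeFlow S.zeroField t z) 0)))) i j
      = pulledBack (matF b) (sigmaForcing b τ Ω ψ z j) t i := by
  rw [hA.odeFlow_eq z hz]
  rfl

/-- The columns of `σ` are the values at time `0` of the bounded solutions of `x' = F x + G Ω(τ₁)`.
-/
theorem sigma_eq_pastConv (hA : AttractingSet S.zeroField D B A ψ K M a d)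
    (hτ : ContinuousOn τ A) (hΩ : Continuous Ω) {C Cf af : ℝ} (hC : ∀ y, ‖Ω y‖ ≤ C)
    (hF : ExpBound (matF b) Cf af) (hCf : 0 ≤ Cf) (haf : 0 < af) {z : ZState p s n} (hz : z ∈ A)
    (j : Fin k) :
    (fun i => S.sigma b τ Ω z i j) = pastConv (matF b) (sigmaForcing b τ Ω ψ z j) := by
  funext i
  rw [pastConv_apply (hF.integrableOn hCf haf (continuous_sigmaForcing hA hτ hΩ hz j) (c := 0)
    (fun t _ => by simpa using norm_sigmaForcing_le hC z j t))]
  simp only [Plant.sigma, sigma_integrand hA hz]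

theorem hasDerivAt_sigma (hA : AttractingSet S.zeroField D B A ψ K M a d)
    (hτ : ContinuousOn τ A) (hΩ : Continuous Ω) {C Cf af : ℝ} (hC : ∀ y, ‖Ω y‖ ≤ C)
    (hF : ExpBound (matF b) Cf af) (hCf : 0 ≤ Cf) (haf : 0 < af) {z : ZState p s n} (hz : z ∈ A)
    (t : ℝ) (j : Fin k) :
    HasDerivAt (fun t => fun i => S.sigma b τ Ω (ψ t z) i j)
      (matF b *ᵥ (fun i => S.sigma b τ Ω (ψ t z) i j) + matG b *ᵥ fun l => Ω (τ (ψ t z) 0) l j)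
      t := by
  have h1 := hF.hasDerivAt_pastConv hCf haf (continuous_sigmaForcing hA hτ hΩ hz j)
    (norm_sigmaForcing_le (b := b) (τ := τ) (ψ := ψ) hC z j) t
  have h2 : ∀ t, pastConv (matF b) (fun u => sigmaForcing b τ Ω ψ z j (t + u)) =
      fun i => S.sigma b τ Ω (ψ t z) i j := by
    intro t
    rw [sigma_eq_pastConv hA hτ hΩ hC hF hCf haf (hA.flow_mem z hz t)]
    congr 1
    funext u
    simp only [sigmaForcing, ← Flow.map_add, add_comm t u]
  simp only [h2] at h1
  exact h1

/-- If `F` decays faster than orbits separate backwards in time, then `σ` is Lipschitz on `A`. -/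
theorem sigma_lipschitz (hA : AttractingSet S.zeroField D B A ψ K M a d) {Lτ LΩ : NNReal}
    (hτ : LipschitzOnWith Lτ τ A) (hΩ : LipschitzWith LΩ Ω) {C Cf af : ℝ} (hC : ∀ y, ‖Ω y‖ ≤ C)
    (hF : ExpBound (matF b) Cf af) (hCf : 0 ≤ Cf) (haf : K < af) :
    ∃ L, LipschitzOnWith L (S.sigma b τ Ω) A := by
  have haf0 : 0 < af := lt_of_le_of_lt hA.nonneg_K haf
  obtain ⟨Q, hQ⟩ : ∃ Q, Q = Cf * ((m + 1 : ℕ) * ‖Matrix.of.symm (matG b)‖ *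
    (LΩ * Lτ)) / (af - K) := ⟨_, rfl⟩
  have hQ0 : 0 ≤ Q := by
    have := sub_pos.2 haf
    rw [hQ]
    positivity
  refine ⟨Q.toNNReal, LipschitzOnWith.of_dist_le_mul fun z hz z' hz' => ?_⟩
  rw [Real.coe_toNNReal _ hQ0, dist_eq_norm]
  refine (pi_norm_le_iff_of_nonneg (by positivity)).2 fun i =>
    (pi_norm_le_iff_of_nonneg (by positivity)).2 fun j => ?_
  have hu := continuous_sigmaForcing (b := b) hA hτ.continuousOn hΩ.continuous hz j
  have hu' := continuous_sigmaForcing (b := b) hA hτ.continuousOn hΩ.continuous hz' j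
  have h1 := hF.pastConv_sub hCf haf0 hu hu' (norm_sigmaForcing_le hC z j)
    (norm_sigmaForcing_le hC z' j)
  have h2 : ∀ t ≤ 0, ‖sigmaForcing b τ Ω ψ z j t - sigmaForcing b τ Ω ψ z' j t‖ ≤
      (m + 1 : ℕ) * ‖Matrix.of.symm (matG b)‖ * (LΩ * Lτ) * dist z z' *
        Real.exp (-K * t) := by
    intro t ht
    rw [sigmaForcing, sigmaForcing, ← mulVec_sub]
    refine (norm_matrix_mulVec_le (matG b) _).trans ?_
    rw [mul_assoc (_ * _) (_ * _), mul_assoc (_ * _) (_ * _)]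
    gcongr
    have h3 : ‖Ω (τ (ψ t z) 0) - Ω (τ (ψ t z') 0)‖ ≤
        LΩ * Lτ * dist z z' * Real.exp (-K * t) := by
      rw [← dist_eq_norm]
      calc _ ≤ LΩ * dist (τ (ψ t z) 0) (τ (ψ t z') 0) := hΩ.dist_le_mul _ _
        _ ≤ LΩ * dist (τ (ψ t z)) (τ (ψ t z')) := by gcongr; exact dist_le_pi_dist _ _ _
        _ ≤ LΩ * (Lτ * dist (ψ t z) (ψ t z')) := by
            gcongr
            exact hτ.dist_le_mul _ (hA.flow_mem z hz t) _ (hA.flow_mem z' hz' t)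
        _ ≤ LΩ * (Lτ * (dist z z' * Real.exp (K * |t|))) := by gcongr; exact hA.dist_flow_le _ _ _
        _ = _ := by rw [abs_of_nonpos ht]; ring_nf
    refine (pi_norm_le_iff_of_nonneg (by positivity)).2 fun l => ?_
    exact ((norm_le_pi_norm ((Ω (τ (ψ t z) 0) - Ω (τ (ψ t z') 0)) l) j).trans
      (norm_le_pi_norm _ l)).trans (h3.trans_eq (by ring))
  have h4 := hF.norm_pastConv_le hCf haf h2
  rw [h1, ← sigma_eq_pastConv hA hτ.continuousOn hΩ.continuous hC hF hCf haf0 hz,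
    ← sigma_eq_pastConv hA hτ.continuousOn hΩ.continuous hC hF hCf haf0 hz'] at h4
  refine ((norm_le_pi_norm _ i).trans h4).trans_eq ?_
  rw [hQ]
  ring

/-- A parameter direction that `Ω(τ₁)` does not see along an orbit is not seen by the regressor
`β(σ, τ₁)` either. -/
theorem sigma_mulVec_eq_zero (hA : AttractingSet S.zeroField D B A ψ K M a d)
    (hτ : ContinuousOn τ A) (hΩ : Continuous Ω) {C Cf af : ℝ} (hC : ∀ y, ‖Ω y‖ ≤ C)
    (hF : ExpBound (matF b) Cf af) (hCf : 0 ≤ Cf) (haf : 0 < af) {z : ZState p s n} (hz : z ∈ A)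
    {γ : Fin k → ℝ} (h : ∀ t, Matrix.of (Ω (τ (ψ t z) 0)) *ᵥ γ = 0) :
    Matrix.of (S.sigma b τ Ω z) *ᵥ γ = 0 := by
  funext i
  have hi : ∀ j, MeasureTheory.Integrable
      (fun t => pulledBack (matF b) (sigmaForcing b τ Ω ψ z j) t i * γ j)
      (MeasureTheory.volume.restrict (Iic 0)) := fun j =>
    ((hF.integrableOn hCf haf (continuous_sigmaForcing hA hτ hΩ hz j) (c := 0)
      (fun t _ => by simpa using norm_sigmaForcing_le hC z j t)).eval i).mul_const _
  simp only [mulVec, dotProduct, of_apply, Plant.sigma, sigma_integrand hA hz]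
  simp only [← MeasureTheory.integral_mul_const]
  rw [← MeasureTheory.integral_finsetSum _ fun j _ => hi j]
  refine MeasureTheory.integral_eq_zero_of_ae (Eventually.of_forall fun t => ?_)
  have h1 : ∑ j, pulledBack (matF b) (sigmaForcing b τ Ω ψ z j) t i * γ j =
      ((NormedSpace.exp ((-t) • matF b) * (matG b * Matrix.of (Ω (τ (ψ t z) 0)))) *ᵥ γ) i := rfl
  refine h1.trans ?_
  rw [← mulVec_mulVec, ← mulVec_mulVec, h]
  simp

end Sigma

end SteadyState

/-! ### Existence of the steady state -/

section SteadyStateExistence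

variable {p s n m k : ℕ} {S : Plant p s n}
variable {D B A : Set (ZState p s n)} {ψ : Flow ℝ (ZState p s n)} {K M a d : ℝ}
  {b : Fin m → ℝ} {τ : ZState p s n → Fin (m + 1) → ℝ} {Ω : ℝ → Fin (m + 1) → Fin k → ℝ}
  {θ : (Fin p → ℝ) → Fin k → ℝ} {φ : ℝ → Fin (m + 1) → ℝ}

theorem norm_toLp_le {k : ℕ} (x : Fin k → ℝ) : ‖WithLp.toLp 2 x‖ ≤ k * ‖x‖ := by
  rw [EuclideanSpace.norm_eq]
  refine Real.sqrt_le_iff.2 ⟨by positivity, ?_⟩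
  rcases Nat.eq_zero_or_pos k with rfl | hk
  · simp
  have hk' : (1 : ℝ) ≤ k := by exact_mod_cast hk
  calc ∑ i, ‖x i‖ ^ 2 ≤ ∑ _i : Fin k, ‖x‖ ^ 2 := Finset.sum_le_sum fun i _ => by
        gcongr; exact norm_le_pi_norm x i
    _ = k * ‖x‖ ^ 2 := by simp
    _ ≤ (k * ‖x‖) ^ 2 := by
        rw [mul_pow]
        have : (k : ℝ) ≤ k ^ 2 := by nlinarith
        gcongr

theorem inner_toLp {k : ℕ} (x : Fin k → ℝ) (γ : EuclideanSpace ℝ (Fin k)) :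
    inner ℝ (WithLp.toLp 2 x) γ = x ⬝ᵥ γ.ofLp := by
  simp [PiLp.inner_apply, dotProduct, mul_comm]

theorem continuous_betaFn (hΩ : Continuous Ω) :
    Continuous fun q : (Fin m → Fin k → ℝ) × ℝ => betaFn Ω q.1 q.2 := by
  have h1 : Continuous fun q : (Fin m → Fin k → ℝ) × ℝ =>
      (primeA m * matM q.1 + Matrix.of (Ω q.2) : Matrix (Fin (m + 1)) (Fin k) ℝ) := by
    refine (continuous_const.matrix_mul ?_).add (hΩ.comp continuous_snd)
    refine continuous_pi fun i => ?_
    refine Fin.cases ?_ (fun i => ?_) i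
    · exact continuous_const (y := (0 : Fin k → ℝ))
    · exact (continuous_apply i).comp continuous_fst
  exact continuous_const.matrix_vecMul h1

theorem continuousOn_betaFn {E : Type*} [TopologicalSpace E] {A : Set E} (hΩ : Continuous Ω)
    {σ : E → Fin m → Fin k → ℝ} {y : E → ℝ} (hσ : ContinuousOn σ A) (hy : ContinuousOn y A) :
    ContinuousOn (fun z => WithLp.toLp 2 (betaFn Ω (σ z) (y z))) A :=
  (PiLp.continuous_toLp 2 _).comp_continuousOn ((continuous_betaFn hΩ).comp_continuousOn
    (f := fun z => (σ z, y z)) (hσ.prodMk hy))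

/-- The immersion equation along two orbits of `A`, integrated over an exciting window, bounds the
difference of the parameters. -/
theorem theta_lipschitz (hA : AttractingSet S.zeroField D B A ψ K M a d) {Lτ Lφ LΩ : NNReal}
    (hτ : LipschitzOnWith Lτ τ A) (hφ : LipschitzWith Lφ φ) (hΩ : LipschitzWith LΩ Ω) {Bθ : ℝ}
    (hθ : ∀ z ∈ A, ‖θ z.1.1‖ ≤ Bθ)
    (hder : ∀ z ∈ A, ∀ t, HasDerivAt (fun t => τ (ψ t z))
      (primeA m *ᵥ τ (ψ t z) + φ (τ (ψ t z) 0) + Matrix.of (Ω (τ (ψ t z) 0)) *ᵥ θ z.1.1) t)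
    {T κ : ℝ} (hT : 0 < T) (hκ : 0 < κ)
    (hexc : ∀ z ∈ A, ∀ γ : Fin k → ℝ, ∃ t ∈ Icc 0 T,
      κ * ‖γ‖ ≤ ‖∫ s in (0 : ℝ)..t, Matrix.of (Ω (τ (ψ s z) 0)) *ᵥ γ‖) :
    ∃ L : ℝ, 0 ≤ L ∧ ∀ z ∈ A, ∀ z' ∈ A, ‖θ z.1.1 - θ z'.1.1‖ ≤ L * dist z z' := by
  have hBθ : 0 ≤ Bθ := by
    obtain ⟨z, hz⟩ := hA.nonempty
    exact (norm_nonneg _).trans (hθ z hz)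
  obtain ⟨Q, hQ⟩ : ∃ Q, Q = (Lτ : ℝ) * Real.exp (K * T) := ⟨_, rfl⟩
  obtain ⟨CA, hCA⟩ : ∃ CA, CA = ((m + 1 : ℕ) : ℝ) * ‖Matrix.of.symm (primeA m)‖ := ⟨_, rfl⟩
  have hQ0 : 0 ≤ Q := by rw [hQ]; positivity
  have hCA0 : 0 ≤ CA := by rw [hCA]; positivity
  obtain ⟨Cr, hCr⟩ : ∃ Cr, Cr = (CA + Lφ + k * LΩ * Bθ) * Q := ⟨_, rfl⟩
  have hCr0 : 0 ≤ Cr := by rw [hCr]; positivity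
  refine ⟨κ⁻¹ * (2 * Q + Cr * T), by positivity, fun z hz z' hz' => ?_⟩
  obtain ⟨γ, hγ⟩ : ∃ γ, γ = θ z.1.1 - θ z'.1.1 := ⟨_, rfl⟩
  obtain ⟨t, ht, hle⟩ := hexc z hz γ
  -- the difference `f` of `τ` along the two orbits solves `f' = r + Ω(τ₁) γ` with `f` and `r` small
  obtain ⟨f, hf⟩ : ∃ f : ℝ → Fin (m + 1) → ℝ, f = fun t => τ (ψ t z) - τ (ψ t z') := ⟨_, rfl⟩
  obtain ⟨r, hr⟩ : ∃ r : ℝ → Fin (m + 1) → ℝ, r = fun t => primeA m *ᵥ f t +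
    (φ (τ (ψ t z) 0) - φ (τ (ψ t z') 0)) +
    Matrix.of (Ω (τ (ψ t z) 0) - Ω (τ (ψ t z') 0)) *ᵥ θ z'.1.1 := ⟨_, rfl⟩
  have hfd : ∀ t, HasDerivAt f (r t + Matrix.of (Ω (τ (ψ t z) 0)) *ᵥ γ) t := by
    intro t
    rw [hf]
    refine ((hder z hz t).sub (hder z' hz' t)).congr_deriv ?_
    have : (Matrix.of (Ω (τ (ψ t z) 0) - Ω (τ (ψ t z') 0)) : Matrix (Fin (m + 1)) (Fin k) ℝ) =
      Matrix.of (Ω (τ (ψ t z) 0)) - Matrix.of (Ω (τ (ψ t z') 0)) := rfl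
    simp only [hr, hf, hγ, this, mulVec_sub, sub_mulVec]
    abel
  have hcz := hA.continuous_comp hτ.continuousOn hz
  have hcz' := hA.continuous_comp hτ.continuousOn hz'
  have hcz0 : Continuous fun t => τ (ψ t z) 0 := (continuous_apply 0).comp hcz
  have hcz0' : Continuous fun t => τ (ψ t z') 0 := (continuous_apply 0).comp hcz'
  have hΩγ : Continuous fun t => Matrix.of (Ω (τ (ψ t z) 0)) *ᵥ γ :=
    (hΩ.continuous.comp hcz0).matrix_mulVec continuous_const
  have hrc : Continuous r := by
    rw [hr, hf]
    refine ((continuous_const.matrix_mulVec (hcz.sub hcz')).add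
      ((hφ.continuous.comp hcz0).sub (hφ.continuous.comp hcz0'))).add ?_
    exact ((hΩ.continuous.comp hcz0).sub (hΩ.continuous.comp hcz0')).matrix_mulVec continuous_const
  have hfle : ∀ u ∈ Icc 0 T, ‖f u‖ ≤ Q * dist z z' := by
    intro u hu
    rw [hf, hQ]
    simp only
    rw [← dist_eq_norm]
    calc _ ≤ Lτ * dist (ψ u z) (ψ u z') :=
          hτ.dist_le_mul _ (hA.flow_mem z hz u) _ (hA.flow_mem z' hz' u)
      _ ≤ Lτ * (dist z z' * Real.exp (K * |u|)) := by gcongr; exact hA.dist_flow_le _ _ _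
      _ ≤ Lτ * (dist z z' * Real.exp (K * T)) := by
          have := hA.nonneg_K
          gcongr
          rw [abs_of_nonneg hu.1]; exact hu.2
      _ = _ := by ring
  have hf0 : ∀ u ∈ Icc 0 T, |τ (ψ u z) 0 - τ (ψ u z') 0| ≤ Q * dist z z' := fun u hu => by
    refine le_trans ?_ (hfle u hu)
    rw [hf]
    exact norm_le_pi_norm (τ (ψ u z) - τ (ψ u z')) 0
  have hrle : ∀ u ∈ Icc 0 T, ‖r u‖ ≤ Cr * dist z z' := by
    intro u hu
    have h1 : ‖primeA m *ᵥ f u‖ ≤ CA * (Q * dist z z') := by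
      refine (norm_matrix_mulVec_le _ _).trans ?_
      rw [← hCA]
      gcongr
      exact hfle u hu
    have h2 : ‖φ (τ (ψ u z) 0) - φ (τ (ψ u z') 0)‖ ≤ Lφ * (Q * dist z z') := by
      rw [← dist_eq_norm]
      refine (hφ.dist_le_mul _ _).trans ?_
      gcongr
      exact hf0 u hu
    have h3 : ‖Matrix.of (Ω (τ (ψ u z) 0) - Ω (τ (ψ u z') 0)) *ᵥ θ z'.1.1‖ ≤
        k * (LΩ * (Q * dist z z')) * Bθ := by
      refine (norm_mulVec_le _ _).trans ?_
      gcongr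
      · rw [← dist_eq_norm]
        refine (hΩ.dist_le_mul _ _).trans ?_
        gcongr
        exact hf0 u hu
      · exact hθ z' hz'
    rw [hr, hCr]
    refine (norm_add₃_le).trans ?_
    linarith
  have hint : ∫ u in (0 : ℝ)..t, Matrix.of (Ω (τ (ψ u z) 0)) *ᵥ γ =
      f t - f 0 - ∫ u in (0 : ℝ)..t, r u := by
    rw [← intervalIntegral.integral_eq_sub_of_hasDerivAt (fun u _ => hfd u)
      ((hrc.add hΩγ).intervalIntegrable _ _),
      intervalIntegral.integral_add (hrc.intervalIntegrable _ _) (hΩγ.intervalIntegrable _ _)]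
    abel
  have h4 : ‖∫ u in (0 : ℝ)..t, r u‖ ≤ Cr * dist z z' * T := by
    refine (intervalIntegral.norm_integral_le_of_norm_le_const (C := Cr * dist z z')
      fun u hu => ?_).trans ?_
    · rw [uIoc_of_le ht.1] at hu
      exact hrle u ⟨hu.1.le, hu.2.trans ht.2⟩
    · rw [sub_zero, abs_of_nonneg ht.1]
      gcongr
      exact ht.2
  have h5 : κ * ‖γ‖ ≤ (2 * Q + Cr * T) * dist z z' := by
    refine hle.trans ?_
    rw [hint]
    refine (norm_sub_le _ _).trans ?_
    have := norm_sub_le (f t) (f 0)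
    have := hfle t ht
    have := hfle 0 ⟨le_rfl, hT.le⟩
    linarith
  rw [← hγ, mul_assoc, le_inv_mul_iff₀ hκ]
  exact h5

theorem exists_excitation_window_inner {E V : Type*} [TopologicalSpace E]
    [NormedAddCommGroup V] [InnerProductSpace ℝ V] [ProperSpace V] {ψ : Flow ℝ E} {A : Set E}
    (hA : IsCompact A) (hinv : ∀ z ∈ A, ∀ t, ψ t z ∈ A) {g : E → V} (hg : ContinuousOn g A)
    (hobs : ∀ z ∈ A, ∀ γ, (∀ t : ℝ, inner ℝ (g (ψ t z)) γ = 0) → γ = 0) :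
    ∃ T κ : ℝ, 0 < T ∧ 0 < κ ∧ ∀ z ∈ A, ∀ γ, ∃ t ∈ Icc 0 T,
      κ * ‖γ‖ ≤ |∫ s in (0 : ℝ)..t, inner ℝ (g (ψ s z)) γ| :=
  exists_excitation_window (Fn := fun z γ => inner ℝ (g z) γ) hA hinv
    ((hg.comp continuousOn_fst fun _ hq => hq.1).inner continuousOn_snd)
    (fun _ c _ => inner_smul_right _ _ c) hobs

/-- Under the immersion property and persistence of excitation, the closed loop has a steady state
over `A`.  Excitation of the regressor `β(σ, τ₁)` implies that of `Ω(τ₁)`, which makes the parameter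
Lipschitz on `A`. -/
theorem exists_steadyState (hA : AttractingSet S.zeroField D B A ψ K M a d)
    {U : Set (ZState p s n)} (hU : IsOpen U) (hAU : A ⊆ U) (hτ : ContDiffOn ℝ 1 τ U)
    (hφ : ContDiff ℝ 1 φ) (hφs : HasCompactSupport φ) (hΩ : ContDiff ℝ 1 Ω)
    (hΩs : HasCompactSupport Ω) {Bθ : ℝ} (hθ : ∀ z ∈ A, ‖θ z.1.1‖ ≤ Bθ)
    (himm : ∀ z ∈ A, fderiv ℝ τ z (S.zeroField z) =
      primeA m *ᵥ τ z + φ (primeC m ⬝ᵥ τ z) + Matrix.of (Ω (primeC m ⬝ᵥ τ z)) *ᵥ θ z.1.1 ∧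
      S.c z = primeC m ⬝ᵥ τ z)
    {Cf af : ℝ} (hF : ExpBound (matF b) Cf af) (hCf : 0 ≤ Cf) (haf : 0 < af)
    (hσ : K < af ∨ ∃ L, LipschitzOnWith L (S.sigma b τ Ω) A)
    (hpe : ∀ z₀ ∈ A, ∀ g : Fin k → ℝ,
      (∀ t : ℝ, g ⬝ᵥ betaFn Ω (S.sigma b τ Ω (odeFlow S.zeroField t z₀))
        (τ (odeFlow S.zeroField t z₀) 0) = 0) → g = 0) :
    ∃ L T κ, SteadyState S A ψ b τ (S.sigma b τ Ω) θ φ Ω L T κ := by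
  obtain ⟨Lτ, hLτ⟩ := exists_tau_lipschitz hA.isCompact hU hAU hτ
  obtain ⟨Lφ, hLφ⟩ := hφ.lipschitzWith_of_hasCompactSupport hφs one_ne_zero
  obtain ⟨LΩ, hLΩ⟩ := hΩ.lipschitzWith_of_hasCompactSupport hΩs one_ne_zero
  obtain ⟨C, hC⟩ := hΩs.exists_bound_of_continuous hΩ.continuous
  have hLσ : ∃ L, LipschitzOnWith L (S.sigma b τ Ω) A :=
    hσ.elim (fun h => sigma_lipschitz hA hLτ hLΩ hC hF hCf h) id
  obtain ⟨Lσ, hLσ⟩ := hLσ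
  have hder : ∀ z ∈ A, ∀ t, HasDerivAt (fun t => τ (ψ t z))
      (primeA m *ᵥ τ (ψ t z) + φ (τ (ψ t z) 0) + Matrix.of (Ω (τ (ψ t z) 0)) *ᵥ θ z.1.1) t := by
    intro z hz t
    have h1 := hasDerivAt_tau hA hU hAU hτ hz t
    rw [(himm _ (hA.flow_mem z hz t)).1] at h1
    simpa only [primeC_dotProduct, hA.param_eq hz] using h1
  have hβobs : ∀ z ∈ A, ∀ g : Fin k → ℝ,
      (∀ t : ℝ, betaFn Ω (S.sigma b τ Ω (ψ t z)) (τ (ψ t z) 0) ⬝ᵥ g = 0) → g = 0 := by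
    intro z hz g h
    refine hpe z hz g fun t => ?_
    rw [hA.odeFlow_eq z hz, dotProduct_comm]
    exact h t
  have hτ0 : ContinuousOn (fun z => τ z 0) A :=
    (continuous_apply 0).comp_continuousOn hLτ.continuousOn
  obtain ⟨T₁, κ₁, hT₁, hκ₁, h₁⟩ := exists_excitation_window (ψ := ψ) hA.isCompact hA.flow_mem
    (Fn := fun z (γ : Fin k → ℝ) => Matrix.of (Ω (τ z 0)) *ᵥ γ) (by
      refine continuousOn_iff_continuous_domRestrict.2 ?_
      refine Continuous.matrix_mulVec (A := fun q :
        (A ×ˢ univ : Set (ZState p s n × (Fin k → ℝ))) =>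
        Matrix.of (Ω (τ q.1.1 0))) ?_ (by fun_prop)
      exact hΩ.continuous.comp (hτ0.comp_continuous (by fun_prop) fun q => q.2.1))
    (fun z c γ => by simp only [mulVec_smul]) (by
      intro z hz γ h
      refine hβobs z hz γ fun t => ?_
      rw [betaFn_dotProduct, h t, sigma_mulVec_eq_zero hA hLτ.continuousOn hΩ.continuous hC hF hCf
        haf (hA.flow_mem z hz t) fun u => by rw [← Flow.map_add]; exact h _]
      have : (Fin.cons 0 (0 : Fin m → ℝ) : Fin (m + 1) → ℝ) = 0 := by
        funext i; refine Fin.cases ?_ (fun i => ?_) i <;> simp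
      rw [this]
      simp)
  obtain ⟨Lθ, hLθ0, hLθ⟩ := theta_lipschitz hA hLτ hLφ hLΩ hθ hder hT₁ hκ₁ h₁
  have hβc : ContinuousOn (fun z => WithLp.toLp 2 (betaFn Ω (S.sigma b τ Ω z) (τ z 0))) A :=
    continuousOn_betaFn hΩ.continuous hLσ.continuousOn hτ0
  obtain ⟨T, κ, hT, hκ, h₂⟩ := exists_excitation_window_inner (ψ := ψ) hA.isCompact hA.flow_mem hβc
    fun z hz γ h => (WithLp.ofLp_eq_zero 2).1
      (hβobs z hz γ.ofLp fun t => (inner_toLp _ _).symm.trans (h t))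
  refine ⟨max Lτ (max Lσ Lθ), T, κ, fun z hz t => hA.param_eq hz t, hder, fun z hz => ?_,
    fun z hz t j => hasDerivAt_sigma hA hLτ.continuousOn hΩ.continuous hC hF hCf haf hz t j,
    le_max_of_le_left Lτ.2, fun z hz z' hz' => ?_, fun z hz z' hz' => ?_, fun z hz z' hz' => ?_,
    hT, hκ, h₂⟩
  · simpa [Plant.c, primeC_dotProduct] using (himm z hz).2
  · rw [← dist_eq_norm]
    exact (hLτ.dist_le_mul z hz z' hz').trans (by gcongr; exact le_max_left _ _)
  · rw [← dist_eq_norm]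
    exact (hLσ.dist_le_mul z hz z' hz').trans
      (by gcongr; exact (le_max_left _ _).trans (le_max_right _ _))
  · exact (hLθ z hz z' hz').trans (by gcongr; exact (le_max_right _ _).trans (le_max_right _ _))

end SteadyStateExistence

/-! ### Error coordinates and the dead zone -/

section ErrorCoordinates

variable {m k : ℕ}

/-- The range of the modal coordinates of a family of vectors, indexed by `none` and the columns. -/
abbrev ModalFamily (m k : ℕ) : Type :=
  PiLp 2 (fun _ : Option (Fin k) => PiLp 2 (fun _ : Fin m => ℂ))

/-- Modal coordinates of each vector of a family. -/
def modalFamily (r : Fin m → ℂ) : (Option (Fin k) → Fin m → ℝ) →ₗ[ℝ] ModalFamily m k where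
  toFun v := WithLp.toLp 2 fun o => modal r (v o)
  map_add' v w := by
    ext o : 1
    simp
  map_smul' c v := by
    ext o : 1
    simp

theorem modalFamily_apply (r : Fin m → ℂ) (v : Option (Fin k) → Fin m → ℝ) (o : Option (Fin k)) :
    modalFamily r v o = modal r (v o) := rfl

theorem modalFamily_injective {r : Fin m → ℂ} (hr : Function.Injective r) :
    Function.Injective (modalFamily (k := k) r) := by
  intro v w h
  funext o
  refine modal_injective hr ?_
  rw [← modalFamily_apply, ← modalFamily_apply, h]

theorem inner_modalFamily_le {b : Fin m → ℝ} {r : Fin m → ℂ} {a : ℝ}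
    (hr : ∀ i, (polyB b).eval (r i) = 0) (ha : ∀ i, (r i).re ≤ -a)
    (v : Option (Fin k) → Fin m → ℝ) :
    inner ℝ (modalFamily r v) (modalFamily r fun o => matF b *ᵥ v o) ≤
      -a * ‖modalFamily r v‖ ^ 2 := by
  rw [PiLp.inner_apply, PiLp.norm_sq_eq_of_L2, Finset.mul_sum]
  exact Finset.sum_le_sum fun o _ => inner_modal_matF_le hr ha (v o)

theorem matG_mulVec (b : Fin m → ℝ) (v : Fin (m + 1) → ℝ) (i : Fin m) :
    (matG b *ᵥ v) i = v i.succ - b i * v 0 := by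
  simp only [mulVec, dotProduct, matG, of_apply, Fin.sum_univ_succ, Fin.val_zero, Fin.val_succ]
  rw [Finset.sum_eq_single i]
  · simp
    ring
  · intro j _ hj
    have : j.val ≠ i.val := fun h => hj (Fin.ext h)
    simp [this]
  · simp

theorem matG_mulVec_bCol (b : Fin m → ℝ) : matG b *ᵥ bCol b = 0 := by
  funext i
  simp [matG_mulVec, bCol]

/-- A vector is determined by its first entry and by its image under `G`, whose kernel is spanned by
the column `b`. -/
theorem eq_smul_bCol_add (b : Fin m → ℝ) (x : Fin (m + 1) → ℝ) :
    x = x 0 • bCol b + (Fin.cons 0 (matG b *ᵥ x) : Fin (m + 1) → ℝ) := by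
  funext i
  refine Fin.cases ?_ (fun i => ?_) i
  · simp [bCol]
  · simp [bCol, matG_mulVec]
    ring

/-- In the coordinates `G η`, the filter `A` restricted to vectors with vanishing first entry
becomes the companion matrix `F`. -/
theorem matG_mulVec_primeA (b : Fin m → ℝ) (ξ : Fin m → ℝ) :
    matG b *ᵥ (primeA m *ᵥ (Fin.cons 0 ξ : Fin (m + 1) → ℝ)) = matF b *ᵥ ξ := by
  funext i
  rw [matG_mulVec]
  simp only [mulVec, dotProduct, primeA, matF, of_apply, Fin.sum_univ_succ, Fin.val_zero,
    Fin.val_succ, Fin.cons_zero, Fin.cons_succ, mul_zero, zero_add, add_mul, Finset.sum_add_distrib,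
    Finset.mul_sum]
  rw [sub_eq_add_neg, add_comm, ← Finset.sum_neg_distrib]
  congr 1
  · refine Finset.sum_congr rfl fun j _ => ?_
    by_cases h : j.val = 0 <;> simp [h]
  · refine Finset.sum_congr rfl fun j _ => ?_
    simp

/-- The space of the errors `(η - τ, θ̃, X - σ)`. -/
abbrev ErrorState (m k : ℕ) : Type :=
  (Fin (m + 1) → ℝ) × (Fin k → ℝ) × (Fin m → Fin k → ℝ)

/-- The part of the error that evolves under the Hurwitz matrix `F`: the vector `G (η - τ)` and the
columns of `X - σ`. -/
def filterPart (b : Fin m → ℝ) : ErrorState m k →ₗ[ℝ] (Option (Fin k) → Fin m → ℝ) where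
  toFun e o := o.elim (matG b *ᵥ e.1) fun j i => e.2.2 i j
  map_add' e f := by
    funext o
    cases o <;> simp [mulVec_add]
    rfl
  map_smul' c e := by
    funext o
    cases o <;> simp [mulVec_smul]
    rfl

/-- Coordinates in which the squared norm of the error is the Lyapunov function. -/
def errorCoord (r : Fin m → ℂ) (b : Fin m → ℝ) : ErrorState m k →ₗ[ℝ]
    WithLp 2 (ℝ × WithLp 2 (EuclideanSpace ℝ (Fin k) × ModalFamily m k)) where
  toFun e := WithLp.toLp 2 (e.1 0,
    WithLp.toLp 2 (WithLp.toLp 2 e.2.1, modalFamily r (filterPart b e)))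
  map_add' e f := by
    simp only [map_add]
    rfl
  map_smul' c e := by
    simp only [map_smul]
    rfl

theorem norm_errorCoord_sq (r : Fin m → ℂ) (b : Fin m → ℝ) (e : ErrorState m k) :
    ‖errorCoord r b e‖ ^ 2 =
      e.1 0 ^ 2 + ‖WithLp.toLp 2 e.2.1‖ ^ 2 + ‖modalFamily r (filterPart b e)‖ ^ 2 := by
  rw [WithLp.prod_norm_sq_eq_of_L2]
  change ‖e.1 0‖ ^ 2 + ‖WithLp.toLp 2 (WithLp.toLp 2 e.2.1, modalFamily r (filterPart b e))‖ ^ 2 = _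
  rw [WithLp.prod_norm_sq_eq_of_L2, Real.norm_eq_abs, sq_abs, add_assoc]
  rfl

theorem errorCoord_injective {r : Fin m → ℂ} (hr : Function.Injective r) (b : Fin m → ℝ) :
    Function.Injective (errorCoord (k := k) r b) := by
  rw [← LinearMap.ker_eq_bot, LinearMap.ker_eq_bot']
  intro e he
  have h := norm_errorCoord_sq r b e
  rw [he, norm_zero] at h
  have h1 : e.1 0 = 0 := by
    have : e.1 0 ^ 2 = 0 := by
      nlinarith [sq_nonneg (e.1 0), sq_nonneg ‖WithLp.toLp 2 e.2.1‖,
        sq_nonneg ‖modalFamily r (filterPart b e)‖]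
    exact pow_eq_zero_iff two_ne_zero |>.1 this
  have h2 : WithLp.toLp 2 e.2.1 = 0 := by
    have : ‖WithLp.toLp 2 e.2.1‖ ^ 2 = 0 := by
      nlinarith [sq_nonneg (e.1 0), sq_nonneg ‖WithLp.toLp 2 e.2.1‖,
        sq_nonneg ‖modalFamily r (filterPart b e)‖]
    exact norm_eq_zero.1 (pow_eq_zero_iff two_ne_zero |>.1 this)
  have h3 : modalFamily r (filterPart b e) = 0 := by
    have : ‖modalFamily r (filterPart b e)‖ ^ 2 = 0 := by
      nlinarith [sq_nonneg (e.1 0), sq_nonneg ‖WithLp.toLp 2 e.2.1‖,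
        sq_nonneg ‖modalFamily r (filterPart b e)‖]
    exact norm_eq_zero.1 (pow_eq_zero_iff two_ne_zero |>.1 this)
  have h4 : filterPart b e = 0 := modalFamily_injective hr (h3.trans (map_zero _).symm)
  have h5 : matG b *ᵥ e.1 = 0 := congrFun h4 none
  refine Prod.ext ?_ (Prod.ext ((WithLp.toLp_eq_zero 2).1 h2) ?_)
  · rw [eq_smul_bCol_add b e.1, h1, h5]
    funext i
    refine Fin.cases ?_ (fun i => ?_) i <;> simp
  · funext i j
    exact congrFun (congrFun h4 (some j)) i

end ErrorCoordinates

section DeadZone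

/-- The dead zone vanishes unless `|ϑ + x| > ℓ`, and then `|x| ≤ ℓ'` leaves `ϑ` a component of at
least `ℓ - ℓ'` in the direction of `ϑ + x`. -/
theorem dead_zone_coercive {ℓ ℓ' : ℝ} {dz : ℝ → ℝ} (hdz : IsDeadZone ℓ dz) {x ϑ : ℝ}
    (hx : |x| ≤ ℓ') : (ℓ - ℓ') * |dz (ϑ + x)| ≤ ϑ * dz (ϑ + x) := by
  rcases le_or_gt |ϑ + x| ℓ with h | h
  · simp [hdz.2.1 _ h]
  · have h1 := hdz.2.2.2 (ϑ + x)
    have h2 : (ϑ + x) * dz (ϑ + x) = |ϑ + x| * |dz (ϑ + x)| := by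
      rw [← abs_mul, abs_of_nonneg h1]
    have h3 : x * dz (ϑ + x) ≤ ℓ' * |dz (ϑ + x)| := by
      refine (le_abs_self _).trans ?_
      rw [abs_mul]
      gcongr
    have h4 : ℓ * |dz (ϑ + x)| ≤ |ϑ + x| * |dz (ϑ + x)| := by gcongr
    linarith

/-- The leakage through the dead zone acts against the parameter error, in proportion to its
size. -/
theorem dead_zone_inner {k : ℕ} {ℓ ℓ' : ℝ} {dz : ℝ → ℝ} (hdz : IsDeadZone ℓ dz) (hℓ : ℓ' < ℓ)
    {θ₀ ϑ : Fin k → ℝ} (hθ : ∀ i, |θ₀ i| ≤ ℓ') :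
    (ℓ - ℓ') / (k + 1) * ‖WithLp.toLp 2 fun i => dz (ϑ i + θ₀ i)‖ ≤
      inner ℝ (WithLp.toLp 2 ϑ) (WithLp.toLp 2 fun i => dz (ϑ i + θ₀ i)) := by
  have hpos := sub_pos.2 hℓ
  obtain ⟨Q, hQ⟩ : ∃ Q, Q = ∑ i, |dz (ϑ i + θ₀ i)| := ⟨_, rfl⟩
  have hQ0 : 0 ≤ Q := by rw [hQ]; positivity
  have h1 : ‖fun i => dz (ϑ i + θ₀ i)‖ ≤ Q := by
    refine (pi_norm_le_iff_of_nonneg hQ0).2 fun i => ?_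
    rw [hQ]
    exact Finset.single_le_sum (f := fun i => |dz (ϑ i + θ₀ i)|) (fun _ _ => abs_nonneg _)
      (Finset.mem_univ i)
  have h2 : ‖WithLp.toLp 2 fun i => dz (ϑ i + θ₀ i)‖ ≤ (k + 1) * Q :=
    (norm_toLp_le _).trans (by nlinarith [norm_nonneg fun i => dz (ϑ i + θ₀ i)])
  calc _ ≤ (ℓ - ℓ') / (k + 1) * ((k + 1) * Q) := by gcongr
    _ = (ℓ - ℓ') * Q := by field_simp
    _ = ∑ i, (ℓ - ℓ') * |dz (ϑ i + θ₀ i)| := by rw [hQ, Finset.mul_sum]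
    _ ≤ ∑ i, ϑ i * dz (ϑ i + θ₀ i) :=
        Finset.sum_le_sum fun i _ => dead_zone_coercive hdz (hθ i)
    _ = _ := by rw [inner_toLp]; rfl

end DeadZone

/-! ### Error equations along solutions of the closed loop -/

section LoopError

theorem HasDerivWithinAt.fst_comp {E F : Type*} [NormedAddCommGroup E] [NormedSpace ℝ E]
    [NormedAddCommGroup F] [NormedSpace ℝ F] {γ : ℝ → E × F} {v : E × F} {I : Set ℝ} {t : ℝ}
    (h : HasDerivWithinAt γ v I t) : HasDerivWithinAt (fun t => (γ t).1) v.1 I t :=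
  (ContinuousLinearMap.fst ℝ E F).hasFDerivAt.comp_hasDerivWithinAt t h

theorem HasDerivWithinAt.snd_comp {E F : Type*} [NormedAddCommGroup E] [NormedSpace ℝ E]
    [NormedAddCommGroup F] [NormedSpace ℝ F] {γ : ℝ → E × F} {v : E × F} {I : Set ℝ} {t : ℝ}
    (h : HasDerivWithinAt γ v I t) : HasDerivWithinAt (fun t => (γ t).2) v.2 I t :=
  (ContinuousLinearMap.snd ℝ E F).hasFDerivAt.comp_hasDerivWithinAt t h

variable {p s n m k : ℕ} {S : Plant p s n}

/-- The error of a state of the closed loop with respect to the steady state over the point `zs`. -/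
def steadyError (τ : ZState p s n → Fin (m + 1) → ℝ) (σ : ZState p s n → Fin m → Fin k → ℝ)
    (zs : ZState p s n) (x : LoopState p s n m k) : ErrorState m k :=
  (x.2.1 - τ zs, x.2.2.1, x.2.2.2 - σ zs)

/-- The mismatch between the internal models driven by `y` with parameter `θ₀` and by `ys` with
parameter `θs`. -/
def modelMismatch (φ : ℝ → Fin (m + 1) → ℝ) (Ω : ℝ → Fin (m + 1) → Fin k → ℝ)
    (θ₀ θs : Fin k → ℝ) (y ys : ℝ) : Fin (m + 1) → ℝ :=
  φ y - φ ys + Matrix.of (Ω y - Ω ys) *ᵥ θ₀ + Matrix.of (Ω ys) *ᵥ (θ₀ - θs)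

theorem norm_modelMismatch_le {φ : ℝ → Fin (m + 1) → ℝ} {Ω : ℝ → Fin (m + 1) → Fin k → ℝ}
    {Lφ LΩ : NNReal} (hφ : LipschitzWith Lφ φ) (hΩ : LipschitzWith LΩ Ω) {C : ℝ}
    (hC : ∀ y, ‖Ω y‖ ≤ C) {ℓ' δ : ℝ} {θ₀ θs : Fin k → ℝ} (hℓ : 0 ≤ ℓ') (hθ₀ : ‖θ₀‖ ≤ ℓ')
    (hθ : ‖θ₀ - θs‖ ≤ δ) (y ys : ℝ) :
    ‖modelMismatch φ Ω θ₀ θs y ys‖ ≤ (Lφ + k * LΩ * ℓ' + k * C) * (|y - ys| + δ) := by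
  have hC0 : 0 ≤ C := (norm_nonneg _).trans (hC 0)
  have hδ : 0 ≤ δ := (norm_nonneg _).trans hθ
  have h1 : ‖φ y - φ ys‖ ≤ Lφ * |y - ys| := by
    rw [← dist_eq_norm, ← Real.dist_eq]; exact hφ.dist_le_mul _ _
  have h2 : ‖Matrix.of (Ω y - Ω ys) *ᵥ θ₀‖ ≤ k * (LΩ * |y - ys|) * ℓ' := by
    refine (norm_mulVec_le _ _).trans ?_
    gcongr
    rw [← dist_eq_norm, ← Real.dist_eq]
    exact hΩ.dist_le_mul _ _
  have h3 : ‖Matrix.of (Ω ys) *ᵥ (θ₀ - θs)‖ ≤ k * C * δ := by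
    refine (norm_mulVec_le _ _).trans ?_
    gcongr
    exact hC ys
  refine norm_add₃_le.trans ?_
  have h4 : 0 ≤ (Lφ + k * LΩ * ℓ') * δ := by positivity
  have h5 : 0 ≤ k * C * |y - ys| := by positivity
  linarith

/-- The vector field of the error, when the plant output differs by `ν` from that of the
reference. -/
def errorField (b : Fin m → ℝ) (lam : ℝ) (dz : ℝ → ℝ) (θ₀ : Fin k → ℝ) (Δ : Fin (m + 1) → ℝ)
    (ΔΩ : Fin (m + 1) → Fin k → ℝ) (β : Fin k → ℝ) (ν : ℝ) (e : ErrorState m k) :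
    ErrorState m k :=
  (primeA m *ᵥ (Fin.cons 0 (matG b *ᵥ e.1) : Fin (m + 1) → ℝ) + ν • (primeA m *ᵥ bCol b) +
      (-lam * e.1 0 + β ⬝ᵥ e.2.1 + lam * ν) • bCol b + Δ,
    -(e.1 0 - ν) • β - fun i => dz (e.2.1 i + θ₀ i),
    fun i j => (matF b *ᵥ (fun i => e.2.2 i j) + matG b *ᵥ fun l => ΔΩ l j) i)

variable {A : Set (ZState p s n)} {ψ : Flow ℝ (ZState p s n)} {b : Fin m → ℝ}
  {τ : ZState p s n → Fin (m + 1) → ℝ} {σ : ZState p s n → Fin m → Fin k → ℝ}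
  {θ : (Fin p → ℝ) → Fin k → ℝ} {φ : ℝ → Fin (m + 1) → ℝ} {Ω : ℝ → Fin (m + 1) → Fin k → ℝ}
  {L T κ : ℝ}

/-- The gain `K = A b + λ b` is such that the output error `η₁ - τ₁` enters the
linear part of the equation of `η - τ` only along `b`, with the factor `-λ`. -/
theorem SteadyState.hasDerivWithinAt_steadyError (hs : SteadyState S A ψ b τ σ θ φ Ω L T κ)
    {lam : ℝ} {dz : ℝ → ℝ} {θ₀ : Fin k → ℝ} {γ : ℝ → LoopState p s n m k} {I : Set ℝ} {t : ℝ}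
    (hγ : HasDerivWithinAt γ (S.loopField b lam (fun _ => θ₀) φ Ω dz (γ t)) I t)
    {zs : ZState p s n} (hzs : zs ∈ A) (hzt : ψ t zs ∈ A) :
    HasDerivWithinAt (fun t => steadyError τ σ (ψ t zs) (γ t))
      (errorField b lam dz θ₀
        (modelMismatch φ Ω θ₀ (θ zs.1.1) ((γ t).2.1 0) (τ (ψ t zs) 0))
        (Ω ((γ t).2.1 0) - Ω (τ (ψ t zs) 0)) (betaFn Ω (γ t).2.2.2 ((γ t).2.1 0))
        (S.q (ψ t zs, 0) - S.q ((γ t).1, 0)) (steadyError τ σ (ψ t zs) (γ t))) I t := by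
  have hq : S.q (ψ t zs, 0) = -τ (ψ t zs) 0 := by rw [← hs.c_eq _ hzt, neg_neg]
  have hη := hγ.snd_comp.fst_comp
  have hϑ := hγ.snd_comp.snd_comp.fst_comp
  have hX := hγ.snd_comp.snd_comp.snd_comp
  have hXσ : HasDerivWithinAt (fun t => (γ t).2.2.2 - σ (ψ t zs))
      (fun i j => (matF b *ᵥ (fun i => ((γ t).2.2.2 - σ (ψ t zs)) i j) +
        matG b *ᵥ fun l => (Ω ((γ t).2.1 0) - Ω (τ (ψ t zs) 0)) l j) i) I t := by
    refine hasDerivWithinAt_pi.2 fun i => hasDerivWithinAt_pi.2 fun j => ?_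
    have h1 := hasDerivWithinAt_pi.1 (hasDerivWithinAt_pi.1 hX i) j
    have h2 := hasDerivAt_pi.1 (hs.hasDerivAt_sigma zs hzs t j) i
    refine (h1.sub h2.hasDerivWithinAt).congr_deriv ?_
    simp [Plant.loopField, mulVec, dotProduct, Matrix.mul_apply, mul_sub, Finset.sum_sub_distrib]
    ring
  refine ((hη.sub (hs.hasDerivAt_tau zs hzs t).hasDerivWithinAt).prodMk
    (hϑ.prodMk hXσ)).congr_deriv ?_
  refine Prod.ext ?_ (Prod.ext ?_ rfl)
  · have h1 : primeA m *ᵥ (γ t).2.1 - primeA m *ᵥ τ (ψ t zs) =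
        ((γ t).2.1 0 - τ (ψ t zs) 0) • (primeA m *ᵥ bCol b) + primeA m *ᵥ
          (Fin.cons 0 (matG b *ᵥ ((γ t).2.1 - τ (ψ t zs))) : Fin (m + 1) → ℝ) := by
      rw [← mulVec_sub]
      conv_lhs => rw [eq_smul_bCol_add b ((γ t).2.1 - τ (ψ t zs)), mulVec_add, mulVec_smul]
      rfl
    have h2 : Matrix.of (Ω ((γ t).2.1 0) - Ω (τ (ψ t zs) 0)) *ᵥ θ₀ =
        Matrix.of (Ω ((γ t).2.1 0)) *ᵥ θ₀ - Matrix.of (Ω (τ (ψ t zs) 0)) *ᵥ θ₀ := by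
      rw [← sub_mulVec]; rfl
    have h3 : primeA m *ᵥ (γ t).2.1 = primeA m *ᵥ τ (ψ t zs) +
        (((γ t).2.1 0 - τ (ψ t zs) 0) • (primeA m *ᵥ bCol b) + primeA m *ᵥ
          (Fin.cons 0 (matG b *ᵥ ((γ t).2.1 - τ (ψ t zs))) : Fin (m + 1) → ℝ)) :=
      sub_eq_iff_eq_add'.1 h1
    simp only [Plant.loopField, errorField, steadyError, modelMismatch, h2, h3, hq, gainK,
      Pi.sub_apply, mulVec_sub _ θ₀]
    module
  · simp only [Plant.loopField, errorField, steadyError, hq, Pi.sub_apply]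
    module

end LoopError

/-! ### Closed-loop trajectories are error windows -/

section LoopWindow

variable {p s n m k : ℕ} {S : Plant p s n}

theorem norm_cons_zero_le (ξ : Fin m → ℝ) : ‖(Fin.cons 0 ξ : Fin (m + 1) → ℝ)‖ ≤ ‖ξ‖ := by
  refine (pi_norm_le_iff_of_nonneg (norm_nonneg _)).2 fun i => ?_
  refine Fin.cases ?_ (fun i => ?_) i
  · simp
  · simpa using norm_le_pi_norm ξ i

theorem betaFn_apply (Ω : ℝ → Fin (m + 1) → Fin k → ℝ) (X : Fin m → Fin k → ℝ) (y : ℝ)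
    (j : Fin k) :
    betaFn Ω X y j =
      (primeA m *ᵥ (Fin.cons 0 fun i => X i j : Fin (m + 1) → ℝ)) 0 + Ω y 0 j := by
  have h := betaFn_dotProduct Ω X y (Pi.single j 1)
  simp only [dotProduct_single_one, mulVec_single_one] at h
  exact h

theorem norm_betaFn_sub_le {Ω : ℝ → Fin (m + 1) → Fin k → ℝ} {LΩ : NNReal}
    (hΩ : LipschitzWith LΩ Ω) (X X' : Fin m → Fin k → ℝ) (y y' : ℝ) :
    ‖betaFn Ω X y - betaFn Ω X' y'‖ ≤
      (m + 1 : ℕ) * ‖Matrix.of.symm (primeA m)‖ * ‖X - X'‖ + LΩ * |y - y'| := by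
  refine (pi_norm_le_iff_of_nonneg (by positivity)).2 fun j => ?_
  have h1 : (betaFn Ω X y - betaFn Ω X' y') j =
      (primeA m *ᵥ (Fin.cons 0 fun i => (X - X') i j : Fin (m + 1) → ℝ)) 0 +
        (Ω y - Ω y') 0 j := by
    have h2 : (Fin.cons 0 fun i => (X - X') i j : Fin (m + 1) → ℝ) =
        (Fin.cons 0 fun i => X i j) - Fin.cons 0 fun i => X' i j := by
      funext i
      refine Fin.cases ?_ (fun i => ?_) i <;> simp
    rw [Pi.sub_apply, betaFn_apply, betaFn_apply, h2, mulVec_sub]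
    simp only [Pi.sub_apply]
    ring
  rw [h1]
  refine (norm_add_le _ _).trans (add_le_add ?_ ?_)
  · refine (norm_le_pi_norm _ 0).trans ((norm_matrix_mulVec_le _ _).trans ?_)
    gcongr
    refine (norm_cons_zero_le _).trans ((pi_norm_le_iff_of_nonneg (norm_nonneg _)).2 fun i => ?_)
    exact (norm_le_pi_norm ((X - X') i) j).trans (norm_le_pi_norm _ i)
  · refine ((norm_le_pi_norm ((Ω y - Ω y') 0) j).trans (norm_le_pi_norm _ 0)).trans ?_
    rw [← dist_eq_norm, ← Real.dist_eq]
    exact hΩ.dist_le_mul _ _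

/-- The forcing of the Hurwitz part of the error. -/
def filterForcing (b : Fin m → ℝ) (Δ : Fin (m + 1) → ℝ) (ΔΩ : Fin (m + 1) → Fin k → ℝ) (ν : ℝ) :
    Option (Fin k) → Fin m → ℝ :=
  fun o => o.elim (ν • (matG b *ᵥ (primeA m *ᵥ bCol b)) + matG b *ᵥ Δ)
    fun j => matG b *ᵥ fun l => ΔΩ l j

theorem filterPart_errorField (b : Fin m → ℝ) (lam : ℝ) (dz : ℝ → ℝ) (θ₀ : Fin k → ℝ)
    (Δ : Fin (m + 1) → ℝ) (ΔΩ : Fin (m + 1) → Fin k → ℝ) (β : Fin k → ℝ) (ν : ℝ)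
    (e : ErrorState m k) :
    filterPart b (errorField b lam dz θ₀ Δ ΔΩ β ν e) =
      (fun o => matF b *ᵥ filterPart b e o) + filterForcing b Δ ΔΩ ν := by
  funext o
  cases o with
  | none =>
    change matG b *ᵥ (_ + _ + _ + _) = _
    simp only [mulVec_add, mulVec_smul, matG_mulVec_primeA, matG_mulVec_bCol, smul_zero, add_zero]
    rw [add_assoc]
    rfl
  | some j => rfl

theorem norm_filterForcing_le (b : Fin m → ℝ) {Δ : Fin (m + 1) → ℝ}
    {ΔΩ : Fin (m + 1) → Fin k → ℝ} {ν cΔ cΩ ε : ℝ} (hcΩ : 0 ≤ cΩ) (hε : 0 ≤ ε)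
    (hΔ : ‖Δ‖ ≤ cΔ * ε) (hΔΩ : ‖ΔΩ‖ ≤ cΩ * ε) (hν : |ν| ≤ ε) (hcΔ : 0 ≤ cΔ) :
    ‖filterForcing b Δ ΔΩ ν‖ ≤ (‖matG b *ᵥ (primeA m *ᵥ bCol b)‖ +
      (m + 1 : ℕ) * ‖Matrix.of.symm (matG b)‖ * (cΔ + cΩ)) * ε := by
  obtain ⟨G, hG⟩ : ∃ G, G = ((m + 1 : ℕ) : ℝ) * ‖Matrix.of.symm (matG b)‖ := ⟨_, rfl⟩
  have hG0 : 0 ≤ G := by rw [hG]; positivity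
  rw [← hG]
  refine (pi_norm_le_iff_of_nonneg (by positivity)).2 fun o => ?_
  cases o with
  | none =>
    refine (norm_add_le _ _).trans ?_
    have h1 := norm_matrix_mulVec_le (matG b) Δ
    rw [← hG] at h1
    have h2 : G * ‖Δ‖ ≤ G * (cΔ * ε) := by gcongr
    have h3 : ‖ν • (matG b *ᵥ (primeA m *ᵥ bCol b))‖ ≤ ε * ‖matG b *ᵥ (primeA m *ᵥ bCol b)‖ := by
      rw [norm_smul, Real.norm_eq_abs]; gcongr
    have h4 : 0 ≤ G * (cΩ * ε) := by positivity
    linarith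
  | some j =>
    have h1 := norm_matrix_mulVec_le (matG b) (fun l => ΔΩ l j)
    rw [← hG] at h1
    have h2 : ‖fun l => ΔΩ l j‖ ≤ cΩ * ε := (pi_norm_le_iff_of_nonneg (by positivity)).2 fun l =>
      ((norm_le_pi_norm (ΔΩ l) j).trans (norm_le_pi_norm _ l)).trans hΔΩ
    have h3 : G * ‖fun l => ΔΩ l j‖ ≤ G * (cΩ * ε) := by gcongr
    have h4 : 0 ≤ G * (cΔ * ε) := by positivity
    have h5 : 0 ≤ ‖matG b *ᵥ (primeA m *ᵥ bCol b)‖ * ε := by positivity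
    refine h1.trans ?_
    linarith

theorem norm_filterPart_fst_le (b : Fin m → ℝ) (e : ErrorState m k) :
    ‖matG b *ᵥ e.1‖ ≤ ‖filterPart b e‖ :=
  norm_le_pi_norm (filterPart b e) none

theorem norm_filterPart_snd_le (b : Fin m → ℝ) (e : ErrorState m k) :
    ‖e.2.2‖ ≤ ‖filterPart b e‖ :=
  (pi_norm_le_iff_of_nonneg (norm_nonneg _)).2 fun i =>
    (pi_norm_le_iff_of_nonneg (norm_nonneg _)).2 fun j =>
      (norm_le_pi_norm (filterPart b e (some j)) i).trans
        (norm_le_pi_norm (filterPart b e) (some j))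

variable {A : Set (ZState p s n)} {ψ : Flow ℝ (ZState p s n)} {b : Fin m → ℝ}
  {τ : ZState p s n → Fin (m + 1) → ℝ} {σ : ZState p s n → Fin m → Fin k → ℝ}
  {θ : (Fin p → ℝ) → Fin k → ℝ} {φ : ℝ → Fin (m + 1) → ℝ} {Ω : ℝ → Fin (m + 1) → Fin k → ℝ}
  {L T κ : ℝ}

theorem SteadyState.continuousOn_tau (hs : SteadyState S A ψ b τ σ θ φ Ω L T κ) :
    ContinuousOn τ A :=
  (LipschitzOnWith.of_dist_le_mul (K := L.toNNReal) fun z hz z' hz' => by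
    rw [Real.coe_toNNReal _ hs.nonneg_L, dist_eq_norm]
    exact hs.tau_lipschitz z hz z' hz').continuousOn

theorem SteadyState.continuousOn_sigma (hs : SteadyState S A ψ b τ σ θ φ Ω L T κ) :
    ContinuousOn σ A :=
  (LipschitzOnWith.of_dist_le_mul (K := L.toNNReal) fun z hz z' hz' => by
    rw [Real.coe_toNNReal _ hs.nonneg_L, dist_eq_norm]
    exact hs.sigma_lipschitz z hz z' hz').continuousOn

/-- Over a window, the error of a solution of the closed loop with respect to a steady-state
solution is governed by the error dynamics of a passive adaptive loop. The coupling constant `c₀`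
does not depend on the gain `lam`, so that the gain can be chosen to dominate it; the constant `c₁`
of the perturbations may depend on the gain. -/
theorem SteadyState.exists_errorWindow (hs : SteadyState S A ψ b τ σ θ φ Ω L T κ)
    (hA : IsCompact A) (hinv : ∀ z ∈ A, ∀ t, ψ t z ∈ A) {Lφ LΩ : NNReal}
    (hφ : LipschitzWith Lφ φ) (hΩ : LipschitzWith LΩ Ω) {C : ℝ} (hC : ∀ y, ‖Ω y‖ ≤ C)
    {ℓ ℓ' : ℝ} {dz : ℝ → ℝ} (hdz : IsDeadZone ℓ dz) (hℓ' : 0 ≤ ℓ') (hℓ : ℓ' < ℓ)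
    {r : Fin m → ℂ} {a : ℝ} (hinj : Function.Injective r)
    (hr : ∀ i, (polyB b).eval (r i) = 0) (ha : ∀ i, (r i).re ≤ -a) :
    ∃ c₀ ε₀ : ℝ, 0 ≤ c₀ ∧ 0 < ε₀ ∧ ∀ lam, 0 ≤ lam → ∃ c₁, 0 ≤ c₁ ∧
      ∀ θ₀ : Fin k → ℝ, (∀ i, |θ₀ i| ≤ ℓ') → ∀ zs ∈ A, ∀ δ, ‖θ₀ - θ zs.1.1‖ ≤ δ →
      ∀ γ : ℝ → LoopState p s n m k,
      IsIntegralCurveOn γ (fun _ => S.loopField b lam (fun _ => θ₀) φ Ω dz) (Icc 0 T) →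
      (∀ t ∈ Icc 0 T, |S.q (ψ t zs, 0) - S.q ((γ t).1, 0)| ≤ δ) →
      ∃ w : ErrorWindow (EuclideanSpace ℝ (Fin k)) (ModalFamily m k) T lam a c₀ c₁ ε₀ κ δ,
        ∀ t, w.energy t = ‖errorCoord r b (steadyError τ σ (ψ t zs) (γ t))‖ ^ 2 := by
  obtain ⟨Cm, hCm, hm⟩ := exists_norm_equiv (modalFamily_injective (k := k) hinj)
  have hτ0 : ContinuousOn (fun z => τ z 0) A :=
    (continuous_apply 0).comp_continuousOn hs.continuousOn_tau
  have hβc := continuousOn_betaFn hΩ.continuous hs.continuousOn_sigma hτ0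
  obtain ⟨Bβ, hBβ⟩ := hA.exists_bound_of_continuousOn hβc
  have hC0 : 0 ≤ C := (norm_nonneg _).trans (hC 0)
  obtain ⟨CA, hCA⟩ : ∃ CA, CA = ((m + 1 : ℕ) : ℝ) * ‖Matrix.of.symm (primeA m)‖ := ⟨_, rfl⟩
  obtain ⟨CF, hCF⟩ : ∃ CF, CF = (m : ℝ) * ‖Matrix.of.symm (matF b)‖ := ⟨_, rfl⟩
  obtain ⟨cΔ, hcΔ⟩ : ∃ cΔ, cΔ = (Lφ + k * LΩ * ℓ' + k * C : ℝ) := ⟨_, rfl⟩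
  obtain ⟨cp, hcp⟩ : ∃ cp, cp = ‖matG b *ᵥ (primeA m *ᵥ bCol b)‖ +
      (m + 1 : ℕ) * ‖Matrix.of.symm (matG b)‖ * (cΔ + LΩ) := ⟨_, rfl⟩
  have hCA0 : 0 ≤ CA := by rw [hCA]; positivity
  have hCF0 : 0 ≤ CF := by rw [hCF]; positivity
  have hcΔ0 : 0 ≤ cΔ := by rw [hcΔ]; positivity
  have hcp0 : 0 ≤ cp := by rw [hcp]; positivity
  obtain ⟨k₁, hk₁⟩ : ∃ k₁, k₁ = CA * Cm + cΔ := ⟨_, rfl⟩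
  obtain ⟨k₂, hk₂⟩ : ∃ k₂, k₂ = Cm * cp := ⟨_, rfl⟩
  obtain ⟨k₃, hk₃⟩ : ∃ k₃, k₃ = Cm * CF * Cm := ⟨_, rfl⟩
  obtain ⟨k₄, hk₄⟩ : ∃ k₄, k₄ = k * (CA * Cm + LΩ) := ⟨_, rfl⟩
  have hk₁0 : 0 ≤ k₁ := by rw [hk₁]; positivity
  have hk₂0 : 0 ≤ k₂ := by rw [hk₂]; positivity
  have hk₃0 : 0 ≤ k₃ := by rw [hk₃]; positivity
  have hk₄0 : 0 ≤ k₄ := by rw [hk₄]; positivity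
  obtain ⟨c₀, hc₀⟩ : ∃ c₀, c₀ = k₁ + k₂ + k₃ + k₄ + |Bβ| := ⟨_, rfl⟩
  have hBβ0 := abs_nonneg Bβ
  refine ⟨c₀, (ℓ - ℓ') / (k + 1), by rw [hc₀]; positivity,
    div_pos (sub_pos.2 hℓ) (by positivity), fun lam hlam => ?_⟩
  obtain ⟨c₁, hc₁⟩ : ∃ c₁, c₁ = 1 + c₀ + |(primeA m *ᵥ bCol b) 0| + lam := ⟨_, rfl⟩
  have hab0 := abs_nonneg ((primeA m *ᵥ bCol b) 0)
  have hc₁0 : 0 ≤ c₁ := by rw [hc₁, hc₀]; positivity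
  refine ⟨c₁, hc₁0, fun θ₀ hθ₀ zs hzs δ hδθ γ hγ hν => ?_⟩
  have hδ : 0 ≤ δ := (norm_nonneg _).trans hδθ
  have hθ₀' : ‖θ₀‖ ≤ ℓ' := (pi_norm_le_iff_of_nonneg hℓ').2 hθ₀
  obtain ⟨e, he⟩ : ∃ e : ℝ → ErrorState m k, e = fun t => steadyError τ σ (ψ t zs) (γ t) :=
    ⟨_, rfl⟩
  obtain ⟨y, hy⟩ : ∃ y : ℝ → ℝ, y = fun t => (e t).1 0 := ⟨_, rfl⟩
  obtain ⟨v, hv⟩ : ∃ v : ℝ → Option (Fin k) → Fin m → ℝ, v = fun t => filterPart b (e t) :=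
    ⟨_, rfl⟩
  obtain ⟨Δ, hΔ⟩ : ∃ Δ : ℝ → Fin (m + 1) → ℝ, Δ = fun t =>
    modelMismatch φ Ω θ₀ (θ zs.1.1) ((γ t).2.1 0) (τ (ψ t zs) 0) := ⟨_, rfl⟩
  obtain ⟨ΔΩ, hΔΩ⟩ : ∃ ΔΩ : ℝ → Fin (m + 1) → Fin k → ℝ, ΔΩ = fun t =>
    Ω ((γ t).2.1 0) - Ω (τ (ψ t zs) 0) := ⟨_, rfl⟩
  obtain ⟨β, hβ⟩ : ∃ β : ℝ → Fin k → ℝ, β = fun t => betaFn Ω (γ t).2.2.2 ((γ t).2.1 0) :=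
    ⟨_, rfl⟩
  obtain ⟨ν, hνd⟩ : ∃ ν : ℝ → ℝ, ν = fun t => S.q (ψ t zs, 0) - S.q ((γ t).1, 0) := ⟨_, rfl⟩
  have hed : ∀ t ∈ Icc 0 T, HasDerivWithinAt e
      (errorField b lam dz θ₀ (Δ t) (ΔΩ t) (β t) (ν t) (e t)) (Icc 0 T) t := by
    intro t ht
    rw [he, hΔ, hΔΩ, hβ, hνd]
    exact hs.hasDerivWithinAt_steadyError (hγ t ht) hzs (hinv zs hzs t)
  have hydiff : ∀ t, (γ t).2.1 0 - τ (ψ t zs) 0 = y t := fun t => by rw [hy, he]; rfl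
  have hΔle : ∀ t, ‖Δ t‖ ≤ cΔ * (|y t| + δ) := by
    intro t
    rw [hΔ, ← hydiff t, hcΔ]
    exact norm_modelMismatch_le hφ hΩ hC hℓ' hθ₀' hδθ _ _
  have hΔΩle : ∀ t, ‖ΔΩ t‖ ≤ LΩ * (|y t| + δ) := by
    intro t
    rw [hΔΩ, ← hydiff t]
    simp only
    rw [← dist_eq_norm]
    refine (hΩ.dist_le_mul _ _).trans ?_
    rw [Real.dist_eq]
    gcongr
    linarith
  have hvle : ∀ t, ‖v t‖ ≤ Cm * ‖modalFamily r (v t)‖ := fun t => (hm _).1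
  have hple : ∀ t ∈ Icc 0 T, ‖filterForcing b (Δ t) (ΔΩ t) (ν t)‖ ≤ cp * (|y t| + δ) := by
    intro t ht
    rw [hcp]
    refine norm_filterForcing_le b LΩ.2 (by positivity) (hΔle t) (hΔΩle t) ?_ hcΔ0
    rw [hνd]
    exact (hν t ht).trans (by linarith [abs_nonneg (y t)])
  have hmp : ∀ t ∈ Icc 0 T, ‖modalFamily r (filterForcing b (Δ t) (ΔΩ t) (ν t))‖ ≤
      k₂ * (|y t| + δ) := by
    intro t ht
    rw [hk₂, mul_assoc]
    refine (hm _).2.trans ?_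
    gcongr
    exact hple t ht
  have hc₁c₀ : c₀ ≤ c₁ := by rw [hc₁]; linarith
  have hx : ∀ {x c : ℝ} (t : ℝ), 0 ≤ c → c ≤ c₀ → x ≤ c * (|y t| + δ) →
      x ≤ c₀ * |y t| + c₁ * δ := by
    intro x c t hc hcc h
    have h1 : c * |y t| ≤ c₀ * |y t| := by gcongr
    have h2 : c * δ ≤ c₁ * δ := by gcongr; exact hcc.trans hc₁c₀
    linarith
  refine ⟨{ y := y
            ϑ := fun t => WithLp.toLp 2 (e t).2.1
            χ := fun t => modalFamily r (v t)
            r := fun t => (primeA m *ᵥ (Fin.cons 0 (matG b *ᵥ (e t).1) : Fin (m + 1) → ℝ)) 0 +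
              ν t * ((primeA m *ᵥ bCol b) 0 + lam) + Δ t 0
            ν := ν
            β := fun t => WithLp.toLp 2 (β t)
            βs := fun t => WithLp.toLp 2 (betaFn Ω (σ (ψ t zs)) (τ (ψ t zs) 0))
            D := fun t => WithLp.toLp 2 fun i => dz ((e t).2.1 i + θ₀ i)
            χ' := fun t => modalFamily r
              ((fun o => matF b *ᵥ v t o) + filterForcing b (Δ t) (ΔΩ t) (ν t))
            hy := fun t ht => ?_
            hϑ := fun t ht => ?_
            hχ := fun t ht => ?_
            hr := fun t ht => ?_
            hν := fun t ht => ?_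
            hstable := fun t ht => ?_
            hχ' := fun t ht => ?_
            hD := fun t ht => dead_zone_inner hdz hℓ hθ₀
            hβs := fun t ht => ?_
            hβs_cont := ?_
            hβ := fun t ht => ?_
            hpe := hs.excitation zs hzs }, fun t => ?_⟩
  · have h := hasDerivWithinAt_pi.1 (hed t ht).fst_comp 0
    rw [hy]
    refine h.congr_deriv ?_
    rw [inner_toLp]
    simp only [errorField, Pi.add_apply, Pi.smul_apply, smul_eq_mul, bCol, Fin.cons_zero]
    ring
  · have h := (hed t ht).snd_comp.fst_comp
    have h2 := (PiLp.continuousLinearEquiv 2 ℝ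
      (fun _ : Fin k => ℝ)).symm.toContinuousLinearMap.hasFDerivAt.comp_hasDerivWithinAt t h
    refine h2.congr_deriv ?_
    rw [hy]
    rfl
  · have h :=
      ((modalFamily r ∘ₗ filterPart b).toContinuousLinearMap).hasFDerivAt.comp_hasDerivWithinAt
      t (hed t ht)
    rw [hv]
    refine h.congr_deriv ?_
    simp only [LinearMap.coe_toContinuousLinearMap', LinearMap.comp_apply, filterPart_errorField]
  · have h1 : |(primeA m *ᵥ (Fin.cons 0 (matG b *ᵥ (e t).1) : Fin (m + 1) → ℝ)) 0| ≤
        CA * (Cm * ‖modalFamily r (v t)‖) := by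
      refine (norm_le_pi_norm (primeA m *ᵥ (Fin.cons 0 (matG b *ᵥ (e t).1) : Fin (m + 1) → ℝ))
        0).trans ((norm_matrix_mulVec_le _ _).trans ?_)
      rw [← hCA]
      gcongr
      refine ((norm_cons_zero_le _).trans (norm_filterPart_fst_le b (e t))).trans ?_
      have := hvle t
      rwa [hv] at this ⊢
    have h2 : |ν t * ((primeA m *ᵥ bCol b) 0 + lam)| ≤ δ * (|(primeA m *ᵥ bCol b) 0| + lam) := by
      rw [abs_mul]
      have h3 : |(primeA m *ᵥ bCol b) 0 + lam| ≤ |(primeA m *ᵥ bCol b) 0| + lam := by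
        refine (abs_add_le _ _).trans ?_
        rw [abs_of_nonneg hlam]
      have h4 : |ν t| ≤ δ := by rw [hνd]; exact hν t ht
      gcongr
    have h3 : |Δ t 0| ≤ cΔ * (|y t| + δ) := (norm_le_pi_norm (Δ t) 0).trans (hΔle t)
    refine (abs_add_three _ _ _).trans ?_
    have h4 : (CA * Cm) * ‖modalFamily r (v t)‖ ≤ c₀ * ‖modalFamily r (v t)‖ := by
      gcongr
      rw [hc₀, hk₁]; linarith
    have h5 : cΔ * |y t| ≤ c₀ * |y t| := by
      gcongr
      rw [hc₀, hk₁]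
      have : 0 ≤ CA * Cm := by positivity
      linarith
    have h6 : cΔ * δ ≤ c₀ * δ := by
      gcongr
      rw [hc₀, hk₁]
      have : 0 ≤ CA * Cm := by positivity
      linarith
    rw [hc₁]
    linarith
  · rw [hνd]
    refine (hν t ht).trans ?_
    have : 1 ≤ c₁ := by
      rw [hc₁, hc₀]; linarith
    exact le_mul_of_one_le_left hδ this
  · rw [map_add, inner_add_right]
    refine add_le_add (inner_modalFamily_le hr ha (v t)) ((real_inner_le_norm _ _).trans ?_)
    gcongr
    exact hx t hk₂0 (by rw [hc₀]; linarith) (hmp t ht)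
  · rw [map_add]
    refine (norm_add_le _ _).trans ?_
    have h1 : ‖modalFamily r fun o => matF b *ᵥ v t o‖ ≤ c₀ * ‖modalFamily r (v t)‖ := by
      have h2 : ‖fun o => matF b *ᵥ v t o‖ ≤ CF * ‖v t‖ :=
        (pi_norm_le_iff_of_nonneg (by positivity)).2 fun o => by
          refine (norm_matrix_mulVec_le _ _).trans ?_
          rw [← hCF]
          gcongr
          exact norm_le_pi_norm (v t) o
      calc _ ≤ Cm * (CF * ‖v t‖) := (hm _).2.trans (by gcongr)
        _ ≤ Cm * (CF * (Cm * ‖modalFamily r (v t)‖)) := by gcongr; exact hvle t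
        _ = k₃ * ‖modalFamily r (v t)‖ := by rw [hk₃]; ring
        _ ≤ _ := by gcongr; rw [hc₀]; linarith
    have h2 := hx t hk₂0 (by rw [hc₀]; linarith) (hmp t ht)
    linarith
  · refine (hBβ _ (hinv zs hzs t)).trans ?_
    rw [hc₀]
    linarith [le_abs_self Bβ]
  · exact hβc.comp_continuous (ψ.continuous continuous_id continuous_const) fun t => hinv zs hzs t
  · have h1 := norm_betaFn_sub_le hΩ (γ t).2.2.2 (σ (ψ t zs)) ((γ t).2.1 0) (τ (ψ t zs) 0)
    rw [hydiff, ← hCA] at h1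
    have h2 : ‖(γ t).2.2.2 - σ (ψ t zs)‖ ≤ Cm * ‖modalFamily r (v t)‖ := by
      have h3 := hvle t
      have h4 := norm_filterPart_snd_le b (e t)
      rw [hv] at h3 ⊢
      rw [he] at h3 h4 ⊢
      exact h4.trans h3
    rw [← WithLp.toLp_sub, hβ]
    refine (norm_toLp_le _).trans ?_
    calc _ ≤ k * (CA * (Cm * ‖modalFamily r (v t)‖) + LΩ * |y t|) := by
          gcongr
          exact h1.trans (by gcongr)
      _ ≤ k₄ * (|y t| + ‖modalFamily r (v t)‖) := by
          have h5 : 0 ≤ k * (CA * Cm) * |y t| := by positivity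
          have h6 : 0 ≤ k * LΩ * ‖modalFamily r (v t)‖ := by positivity
          rw [hk₄]
          linarith
      _ ≤ _ := by
          gcongr
          rw [hc₀]; linarith
  · rw [norm_errorCoord_sq, ErrorWindow.energy]
    simp only [hv, hy, he]

end LoopWindow

/-! ### A priori bounds for the closed loop -/

section Existence

theorem norm_le_gronwallBound {E : Type*} [NormedAddCommGroup E] [NormedSpace ℝ E]
    {f f' : ℝ → E} {t T ρ K ε : ℝ} (ht : t ∈ Icc 0 T) (hρ : 0 ≤ ρ) (hK : 0 ≤ K) (hε : 0 ≤ ε)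
    (hf : ∀ u ∈ Icc 0 t, HasDerivWithinAt f (f' u) (Icc 0 t) u) (h0 : ‖f 0‖ ≤ ρ)
    (hf' : ∀ u ∈ Icc 0 t, ‖f' u‖ ≤ K * ‖f u‖ + ε) : ‖f t‖ ≤ gronwallBound ρ K ε T := by
  refine (norm_le_gronwallBound_of_norm_deriv_right_le (f := f) (f' := f') (a := 0) (b := t)
    (fun u hu => (hf u hu).continuousWithinAt)
    (fun u hu => (hf u (Ico_subset_Icc_self hu)).mono_of_mem_nhdsWithin (Icc_mem_nhdsGE_of_mem hu))
    h0 (fun u hu => hf' u (Ico_subset_Icc_self hu)) t ⟨ht.1, le_rfl⟩).trans ?_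
  exact gronwallBound_mono hρ hε hK (by simpa using ht.2)

theorem IsDeadZone.exists_abs_le {ℓ : ℝ} {dz : ℝ → ℝ} (h : IsDeadZone ℓ dz) :
    ∃ C, 0 ≤ C ∧ ∀ x, |dz x| ≤ |x| + C := by
  obtain ⟨C, hC⟩ := (isCompact_Icc (a := -(ℓ + 1)) (b := ℓ + 1)).exists_bound_of_continuousOn
    h.1.continuous.continuousOn
  refine ⟨|C|, abs_nonneg _, fun x => ?_⟩
  rcases le_total (ℓ + 1) |x| with hx | hx
  · rw [h.2.2.1 x hx]
    linarith [abs_nonneg C]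
  · have := hC x (abs_le.1 hx)
    rw [Real.norm_eq_abs] at this
    linarith [le_abs_self C, abs_nonneg x]

variable {p s n m k : ℕ} {S : Plant p s n} {b : Fin m → ℝ} {θ : (Fin p → ℝ) → Fin k → ℝ}
  {φ : ℝ → Fin (m + 1) → ℝ} {Ω : ℝ → Fin (m + 1) → Fin k → ℝ} {dz : ℝ → ℝ} {lam : ℝ}

section Smoothness

variable {E : Type*} [NormedAddCommGroup E] [NormedSpace ℝ E]

theorem ContDiff.dotProduct {f g : E → Fin k → ℝ} (hf : ContDiff ℝ 1 f) (hg : ContDiff ℝ 1 g) :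
    ContDiff ℝ 1 fun x => f x ⬝ᵥ g x :=
  ContDiff.sum fun j _ => (contDiff_pi.1 hf j).mul (contDiff_pi.1 hg j)

theorem ContDiff.mulVec {l : ℕ} {M : E → Fin l → Fin k → ℝ} {v : E → Fin k → ℝ}
    (hM : ContDiff ℝ 1 M) (hv : ContDiff ℝ 1 v) :
    ContDiff ℝ 1 fun x => Matrix.of (M x) *ᵥ v x :=
  contDiff_pi.2 fun i => (contDiff_pi.1 hM i).dotProduct hv

theorem ContDiff.betaFn {X : E → Fin m → Fin k → ℝ} {y : E → ℝ} (hΩ : ContDiff ℝ 1 Ω)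
    (hX : ContDiff ℝ 1 X) (hy : ContDiff ℝ 1 y) : ContDiff ℝ 1 fun x => betaFn Ω (X x) (y x) := by
  refine contDiff_pi.2 fun j => ?_
  simp only [betaFn_apply, Matrix.mulVec, _root_.dotProduct, Fin.sum_univ_succ, Fin.cons_zero,
    Fin.cons_succ]
  refine ContDiff.add (contDiff_const.add (ContDiff.sum fun i _ => contDiff_const.mul ?_)) ?_
  · exact contDiff_pi.1 (contDiff_pi.1 hX i) j
  · exact contDiff_pi.1 (contDiff_pi.1 (hΩ.comp hy) 0) j

theorem ContDiff.matrix_mul_apply {l : ℕ} (M : Matrix (Fin l) (Fin m) ℝ) {N : E → Fin m → Fin k → ℝ}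
    (hN : ContDiff ℝ 1 N) (i : Fin l) (j : Fin k) :
    ContDiff ℝ 1 fun x => (M * Matrix.of (N x)) i j := by
  simp only [Matrix.mul_apply, Matrix.of_apply]
  exact ContDiff.sum fun l _ => contDiff_const.mul (contDiff_pi.1 (contDiff_pi.1 hN l) j)

end Smoothness

/-- With the parameter frozen, the field of the closed loop is `C¹`. -/
theorem contDiff_loopField (S : Plant p s n) (b : Fin m → ℝ) (lam : ℝ) (θ₀ : Fin k → ℝ)
    (hφ : ContDiff ℝ 1 φ) (hΩ : ContDiff ℝ 1 Ω) (hdz : ContDiff ℝ 1 dz) :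
    ContDiff ℝ 1 (S.loopField b lam (fun _ => θ₀) φ Ω dz) := by
  have hz : ContDiff ℝ 1 fun x : LoopState p s n m k => x.1 := contDiff_fst
  have hη : ContDiff ℝ 1 fun x : LoopState p s n m k => x.2.1 := contDiff_fst.comp contDiff_snd
  have hϑ : ContDiff ℝ 1 fun x : LoopState p s n m k => x.2.2.1 :=
    contDiff_fst.comp (contDiff_snd.comp contDiff_snd)
  have hX : ContDiff ℝ 1 fun x : LoopState p s n m k => x.2.2.2 :=
    contDiff_snd.comp (contDiff_snd.comp contDiff_snd)
  have hη0 : ContDiff ℝ 1 fun x : LoopState p s n m k => x.2.1 0 := contDiff_pi.1 hη 0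
  have hq : ContDiff ℝ 1 fun x : LoopState p s n m k => S.q (x.1, 0) + x.2.1 0 :=
    (S.contDiff_q.comp (hz.prodMk contDiff_const)).add hη0
  have hβ := hΩ.betaFn hX hη0
  have hdzϑ : ContDiff ℝ 1 fun x : LoopState p s n m k => fun i => dz (x.2.2.1 i + θ₀ i) :=
    contDiff_pi.2 fun i => hdz.comp ((contDiff_pi.1 hϑ i).add contDiff_const)
  have h1 := ((((contDiff_const (c := Matrix.of.symm (primeA m))).mulVec hη).sub (hq.smul
    (contDiff_const (c := gainK b lam)))).add ((hβ.dotProduct hϑ).smul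
    (contDiff_const (c := bCol b)))).add (hφ.comp hη0)
  have h2 := h1.add ((hΩ.comp hη0).mulVec (contDiff_const (c := θ₀)))
  have h3 := (hq.neg.smul hβ).sub hdzϑ
  have h4 : ContDiff ℝ 1 fun x : LoopState p s n m k => fun i j =>
      (matF b * Matrix.of x.2.2.2 + matG b * Matrix.of (Ω (x.2.1 0))) i j :=
    contDiff_pi.2 fun i => contDiff_pi.2 fun j =>
      (hX.matrix_mul_apply (matF b) i j).add ((hΩ.comp hη0).matrix_mul_apply (matG b) i j)
  exact (S.contDiff_zeroField.comp hz).prodMk (h2.prodMk (h3.prodMk h4))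

theorem norm_betaFn_le {C : ℝ} (hC : ∀ y, ‖Ω y‖ ≤ C) (X : Fin m → Fin k → ℝ) (y : ℝ) :
    ‖betaFn Ω X y‖ ≤ (m + 1 : ℕ) * ‖Matrix.of.symm (primeA m)‖ * ‖X‖ + C := by
  have hC0 : 0 ≤ C := (norm_nonneg _).trans (hC 0)
  refine (pi_norm_le_iff_of_nonneg (by positivity)).2 fun j => ?_
  rw [betaFn_apply]
  refine (norm_add_le _ _).trans (add_le_add ?_ ?_)
  · refine (norm_le_pi_norm _ 0).trans ((norm_matrix_mulVec_le _ _).trans ?_)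
    gcongr
    exact (norm_cons_zero_le _).trans ((pi_norm_le_iff_of_nonneg (norm_nonneg _)).2 fun i =>
      (norm_le_pi_norm (X i) j).trans (norm_le_pi_norm _ i))
  · exact ((norm_le_pi_norm (Ω y 0) j).trans (norm_le_pi_norm _ 0)).trans (hC y)

theorem abs_dotProduct_le (x y : Fin k → ℝ) : |x ⬝ᵥ y| ≤ k * ‖x‖ * ‖y‖ := by
  have := norm_le_pi_norm (Matrix.of (fun _ : Fin 1 => x) *ᵥ y) 0
  refine (this.trans (norm_mulVec_le _ _)).trans ?_
  gcongr
  exact (pi_norm_le_iff_of_nonneg (norm_nonneg _)).2 fun _ => le_rfl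

/-- On a finite horizon the states of the internal model and of the adaptation are bounded in terms
of their initial values and of a bound on the output of the plant: `X` obeys a linear equation,
and given a bound on `X` the field grows at most linearly in `(η, θ̃)`. -/
theorem exists_loop_bound (S : Plant p s n) (b : Fin m → ℝ) (lam : ℝ) {Cφ C : ℝ}
    (hφ : ∀ y, ‖φ y‖ ≤ Cφ) (hC : ∀ y, ‖Ω y‖ ≤ C)
    {ℓ ℓ' : ℝ} (hdz : IsDeadZone ℓ dz) (hℓ' : 0 ≤ ℓ') {ρ T Cq : ℝ} (hρ : 0 ≤ ρ) (hT : 0 ≤ T)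
    (hCq : 0 ≤ Cq) :
    ∃ R, ∀ θ₀ : Fin k → ℝ, (∀ i, |θ₀ i| ≤ ℓ') → ∀ t ∈ Icc 0 T,
      ∀ γ : ℝ → LoopState p s n m k, ‖(γ 0).2‖ ≤ ρ → (∀ u ∈ Icc 0 t, |S.q ((γ u).1, 0)| ≤ Cq) →
      IsIntegralCurveOn γ (fun _ => S.loopField b lam (fun _ => θ₀) φ Ω dz) (Icc 0 t) →
      ‖(γ t).2‖ ≤ R := by
  have hC0 : 0 ≤ C := (norm_nonneg _).trans (hC 0)
  have hCφ0 : 0 ≤ Cφ := (norm_nonneg _).trans (hφ 0)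
  obtain ⟨Cd, hCd0, hCd⟩ := hdz.exists_abs_le
  obtain ⟨CA, hCA⟩ : ∃ CA, CA = ((m + 1 : ℕ) : ℝ) * ‖Matrix.of.symm (primeA m)‖ := ⟨_, rfl⟩
  obtain ⟨CF, hCF⟩ : ∃ CF, CF = (m : ℝ) * ‖Matrix.of.symm (matF b)‖ := ⟨_, rfl⟩
  obtain ⟨CG, hCG⟩ : ∃ CG, CG = ((m + 1 : ℕ) : ℝ) * ‖Matrix.of.symm (matG b)‖ := ⟨_, rfl⟩
  have hCA0 : 0 ≤ CA := by rw [hCA]; positivity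
  have hCF0 : 0 ≤ CF := by rw [hCF]; positivity
  have hCG0 : 0 ≤ CG := by rw [hCG]; positivity
  obtain ⟨RX, hRX⟩ : ∃ RX, RX = gronwallBound ρ CF (CG * C) T := ⟨_, rfl⟩
  have hRX0 : 0 ≤ RX := by
    rw [hRX]
    have := gronwallBound_mono hρ (by positivity : 0 ≤ CG * C) hCF0 hT
    rw [gronwallBound_x0] at this
    exact hρ.trans this
  obtain ⟨Bβ, hBβ⟩ : ∃ Bβ, Bβ = CA * RX + C := ⟨_, rfl⟩
  have hBβ0 : 0 ≤ Bβ := by rw [hBβ]; positivity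
  obtain ⟨gK, hgK⟩ : ∃ gK, gK = ‖gainK b lam‖ := ⟨_, rfl⟩
  obtain ⟨nb, hnb⟩ : ∃ nb, nb = ‖bCol b‖ := ⟨_, rfl⟩
  have hgK0 : 0 ≤ gK := by rw [hgK]; positivity
  have hnb0 : 0 ≤ nb := by rw [hnb]; positivity
  obtain ⟨k₁, hk₁⟩ : ∃ k₁, k₁ = CA + gK + k * Bβ * nb + Bβ + 1 := ⟨_, rfl⟩
  obtain ⟨k₂, hk₂⟩ : ∃ k₂, k₂ = Cq * gK + Cφ + k * C * ℓ' + Cq * Bβ + ℓ' + Cd := ⟨_, rfl⟩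
  have hk₁0 : 0 ≤ k₁ := by rw [hk₁]; positivity
  have hk₂0 : 0 ≤ k₂ := by rw [hk₂]; positivity
  refine ⟨max RX (gronwallBound ρ k₁ k₂ T), fun θ₀ hθ₀ t ht γ h0 hq hγ => ?_⟩
  have hθ₀' : ‖θ₀‖ ≤ ℓ' := (pi_norm_le_iff_of_nonneg hℓ').2 hθ₀
  have hX : ∀ u ∈ Icc 0 t, ‖(γ u).2.2.2‖ ≤ RX := by
    intro u hu
    rw [hRX]
    refine norm_le_gronwallBound (f := fun t => (γ t).2.2.2)
      (f' := fun t => (S.loopField b lam (fun _ => θ₀) φ Ω dz (γ t)).2.2.2)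
      ⟨hu.1, hu.2.trans ht.2⟩ hρ hCF0 (by positivity) (fun w hw => ?_) ?_ (fun w hw => ?_)
    · exact ((hγ w ⟨hw.1, hw.2.trans hu.2⟩).mono
        (Icc_subset_Icc_right hu.2)).snd_comp.snd_comp.snd_comp
    · exact ((norm_snd_le (γ 0).2.2).trans (norm_snd_le _)).trans h0
    · refine (pi_norm_le_iff_of_nonneg (by positivity)).2 fun i =>
        (pi_norm_le_iff_of_nonneg (by positivity)).2 fun j => ?_
      change ‖(matF b *ᵥ fun i => (γ w).2.2.2 i j) i +
        (matG b *ᵥ fun l => Ω ((γ w).2.1 0) l j) i‖ ≤ _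
      refine (norm_add_le _ _).trans (add_le_add ?_ ?_)
      · refine (norm_le_pi_norm _ i).trans ((norm_matrix_mulVec_le _ _).trans ?_)
        rw [← hCF]
        gcongr
        exact (pi_norm_le_iff_of_nonneg (norm_nonneg _)).2 fun i =>
          (norm_le_pi_norm ((γ w).2.2.2 i) j).trans (norm_le_pi_norm _ i)
      · refine (norm_le_pi_norm _ i).trans ((norm_matrix_mulVec_le _ _).trans ?_)
        rw [← hCG]
        gcongr
        exact (pi_norm_le_iff_of_nonneg hC0).2 fun i =>
          ((norm_le_pi_norm (Ω ((γ w).2.1 0) i) j).trans (norm_le_pi_norm _ i)).trans (hC _)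
  have hηϑ : ‖((γ t).2.1, (γ t).2.2.1)‖ ≤ gronwallBound ρ k₁ k₂ T := by
    refine norm_le_gronwallBound (f := fun t => ((γ t).2.1, (γ t).2.2.1))
      (f' := fun t => ((S.loopField b lam (fun _ => θ₀) φ Ω dz (γ t)).2.1,
        (S.loopField b lam (fun _ => θ₀) φ Ω dz (γ t)).2.2.1))
      ht hρ hk₁0 hk₂0 (fun u hu => ?_) ?_ (fun u hu => ?_)
    · exact (hγ u hu).snd_comp.fst_comp.prodMk (hγ u hu).snd_comp.snd_comp.fst_comp
    · rw [Prod.norm_def]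
      exact max_le ((norm_fst_le (γ 0).2).trans h0)
        (((norm_fst_le (γ 0).2.2).trans (norm_snd_le _)).trans h0)
    · obtain ⟨N, hN⟩ : ∃ N, N = ‖((γ u).2.1, (γ u).2.2.1)‖ := ⟨_, rfl⟩
      have hN0 : 0 ≤ N := by rw [hN]; positivity
      have hη : ‖(γ u).2.1‖ ≤ N := by rw [hN]; exact norm_fst_le ((γ u).2.1, (γ u).2.2.1)
      have hϑ : ‖(γ u).2.2.1‖ ≤ N := by rw [hN]; exact norm_snd_le ((γ u).2.1, (γ u).2.2.1)
      have hβ : ‖betaFn Ω (γ u).2.2.2 ((γ u).2.1 0)‖ ≤ Bβ := by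
        refine (norm_betaFn_le hC _ _).trans ?_
        rw [← hCA, hBβ]
        gcongr
        exact hX u hu
      have hqη : |S.q ((γ u).1, 0) + (γ u).2.1 0| ≤ Cq + N :=
        (abs_add_le _ _).trans (add_le_add (hq u hu) ((norm_le_pi_norm _ 0).trans hη))
      rw [← hN, Prod.norm_def]
      refine max_le ?_ ?_
      · have h1 : ‖primeA m *ᵥ (γ u).2.1‖ ≤ CA * N := by
          refine (norm_matrix_mulVec_le _ _).trans ?_
          rw [← hCA]
          gcongr
        have h2 : ‖(S.q ((γ u).1, 0) + (γ u).2.1 0) • gainK b lam‖ ≤ (Cq + N) * gK := by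
          rw [norm_smul, ← hgK, Real.norm_eq_abs]
          gcongr
        have h3 : ‖(betaFn Ω (γ u).2.2.2 ((γ u).2.1 0) ⬝ᵥ (γ u).2.2.1) • bCol b‖ ≤
            k * Bβ * N * nb := by
          rw [norm_smul, ← hnb, Real.norm_eq_abs]
          gcongr
          refine (abs_dotProduct_le _ _).trans ?_
          gcongr
        have h4 : ‖Matrix.of (Ω ((γ u).2.1 0)) *ᵥ θ₀‖ ≤ k * C * ℓ' := by
          refine (norm_mulVec_le _ _).trans ?_
          gcongr
          exact hC _
        have h5 := hφ ((γ u).2.1 0)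
        change ‖primeA m *ᵥ (γ u).2.1 - (S.q ((γ u).1, 0) + (γ u).2.1 0) • gainK b lam +
          (betaFn Ω (γ u).2.2.2 ((γ u).2.1 0) ⬝ᵥ (γ u).2.2.1) • bCol b + φ ((γ u).2.1 0) +
          Matrix.of (Ω ((γ u).2.1 0)) *ᵥ θ₀‖ ≤ _
        refine (norm_add_le _ _).trans ?_
        have h6 := norm_add_le (primeA m *ᵥ (γ u).2.1 -
          (S.q ((γ u).1, 0) + (γ u).2.1 0) • gainK b lam +
          (betaFn Ω (γ u).2.2.2 ((γ u).2.1 0) ⬝ᵥ (γ u).2.2.1) • bCol b) (φ ((γ u).2.1 0))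
        have h7 := norm_add_le (primeA m *ᵥ (γ u).2.1 -
          (S.q ((γ u).1, 0) + (γ u).2.1 0) • gainK b lam)
          ((betaFn Ω (γ u).2.2.2 ((γ u).2.1 0) ⬝ᵥ (γ u).2.2.1) • bCol b)
        have h8 := norm_sub_le (primeA m *ᵥ (γ u).2.1)
          ((S.q ((γ u).1, 0) + (γ u).2.1 0) • gainK b lam)
        have h9 : 0 ≤ (Bβ + 1) * N + Cq * Bβ + ℓ' + Cd := by positivity
        rw [hk₁, hk₂]
        linarith
      · have h1 : ‖-(S.q ((γ u).1, 0) + (γ u).2.1 0) • betaFn Ω (γ u).2.2.2 ((γ u).2.1 0)‖ ≤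
            (Cq + N) * Bβ := by
          rw [norm_smul, norm_neg, Real.norm_eq_abs]
          gcongr
        have h2 : ‖fun i => dz ((γ u).2.2.1 i + θ₀ i)‖ ≤ N + ℓ' + Cd := by
          refine (pi_norm_le_iff_of_nonneg (by positivity)).2 fun i => ?_
          refine (hCd _).trans ?_
          have h3 := abs_add_le ((γ u).2.2.1 i) (θ₀ i)
          have h4 : |(γ u).2.2.1 i| ≤ N := (norm_le_pi_norm _ i).trans hϑ
          linarith [hθ₀ i]
        change ‖-(S.q ((γ u).1, 0) + (γ u).2.1 0) • betaFn Ω (γ u).2.2.2 ((γ u).2.1 0) -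
          fun i => dz ((γ u).2.2.1 i + θ₀ i)‖ ≤ _
        refine (norm_sub_le _ _).trans ?_
        have h9 : 0 ≤ (CA + gK + k * Bβ * nb) * N + Cq * gK + Cφ + k * C * ℓ' := by positivity
        rw [hk₁, hk₂]
        linarith
  rw [Prod.norm_def, Prod.norm_def (γ t).2.2]
  refine max_le (((norm_fst_le ((γ t).2.1, (γ t).2.2.1)).trans hηϑ).trans (le_max_right _ _))
    (max_le (((norm_snd_le ((γ t).2.1, (γ t).2.2.1)).trans hηϑ).trans (le_max_right _ _))
      ((hX t ⟨ht.1, le_rfl⟩).trans (le_max_left _ _)))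

end Existence

/-! ### Global solutions of the closed loop -/

section LoopSolution

variable {p s n m k : ℕ} {S : Plant p s n} {b : Fin m → ℝ} {θ : (Fin p → ℝ) → Fin k → ℝ}
  {φ : ℝ → Fin (m + 1) → ℝ} {Ω : ℝ → Fin (m + 1) → Fin k → ℝ} {dz : ℝ → ℝ} {lam : ℝ}

theorem isIntegralCurveOn_fst {γ : ℝ → LoopState p s n m k} {I : Set ℝ}
    (h : IsIntegralCurveOn γ (fun _ => S.loopField b lam θ φ Ω dz) I) :
    IsIntegralCurveOn (fun t => (γ t).1) (fun _ => S.zeroField) I :=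
  fun t ht => (h t ht).fst_comp

/-- As long as the plant parameter does not change, it may be frozen in the field of the loop. -/
theorem isIntegralCurveOn_freeze {γ : ℝ → LoopState p s n m k} {I : Set ℝ} {ϱ₀ : Fin p → ℝ}
    (hϱ : ∀ t ∈ I, (γ t).1.1.1 = ϱ₀) :
    IsIntegralCurveOn γ (fun _ => S.loopField b lam θ φ Ω dz) I ↔
      IsIntegralCurveOn γ (fun _ => S.loopField b lam (fun _ => θ ϱ₀) φ Ω dz) I := by
  have h : ∀ t ∈ I, S.loopField b lam θ φ Ω dz (γ t) =
      S.loopField b lam (fun _ => θ ϱ₀) φ Ω dz (γ t) := fun t ht => by rw [← hϱ t ht]; rfl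
  constructor
  · intro hγ t ht
    have := hγ t ht
    simp only [h t ht] at this
    exact this
  · intro hγ t ht
    have := hγ t ht
    simp only [← h t ht] at this
    exact this

/-- Solutions of the closed loop exist for all positive times and are unique, although `θ` is only
continuous: the parameter is constant along solutions and may be frozen. -/
theorem exists_loop_solution (hφ : ContDiff ℝ 1 φ) (hφs : HasCompactSupport φ)
    (hΩ : ContDiff ℝ 1 Ω) (hΩs : HasCompactSupport Ω) {ℓ ℓ' : ℝ} (hdz : IsDeadZone ℓ dz)
    {ψ : Flow ℝ (ZState p s n)} {z₀ : ZState p s n}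
    (hz : IsIntegralCurveOn (fun t => ψ t z₀) (fun _ => S.zeroField) (Ici 0)) (hℓ' : 0 ≤ ℓ')
    (hθ : ∀ i, |θ z₀.1.1 i| ≤ ℓ') (b : Fin m → ℝ) (lam : ℝ) (y : ErrorState m k) :
    ∃ γ : ℝ → LoopState p s n m k, γ 0 = (z₀, y) ∧
      IsIntegralCurveOn γ (fun _ => S.loopField b lam θ φ Ω dz) (Ici 0) ∧
      IsIntegralCurveOn γ (fun _ => S.loopField b lam (fun _ => θ z₀.1.1) φ Ω dz) (Ici 0) ∧
      (∀ t, 0 ≤ t → (γ t).1 = ψ t z₀) ∧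
      ∀ t, 0 ≤ t → odeFlow (S.loopField b lam θ φ Ω dz) t (z₀, y) = γ t := by
  obtain ⟨Cφ, hCφ⟩ := hφs.exists_bound_of_continuous hφ.continuous
  obtain ⟨C, hC⟩ := hΩs.exists_bound_of_continuous hΩ.continuous
  have hfrozen := contDiff_loopField S b lam (θ z₀.1.1) hφ hΩ hdz.1
  have hbase : ∀ {θ' : (Fin p → ℝ) → Fin k → ℝ} {γ : ℝ → LoopState p s n m k} {t : ℝ}, 0 ≤ t →
      γ 0 = (z₀, y) → IsIntegralCurveOn γ (fun _ => S.loopField b lam θ' φ Ω dz) (Icc 0 t) →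
      ∀ u ∈ Icc 0 t, (γ u).1 = ψ u z₀ := by
    intro θ' γ t ht h0 hγ
    rw [← uIcc_of_le ht] at hγ ⊢
    refine isIntegralCurveOn_eq_of_contDiff S.contDiff_zeroField (isIntegralCurveOn_fst hγ)
      (γ' := fun t => ψ t z₀) ?_ (by rw [h0]; simp)
    rw [uIcc_of_le ht]
    exact hz.mono Icc_subset_Ici_self
  have hparam : ∀ t, 0 ≤ t → (ψ t z₀).1.1 = z₀.1.1 := fun t ht => by
    have := Plant.param_eq ht (hz.mono Icc_subset_Ici_self)
    simpa using this
  obtain ⟨γ, h0, hγ⟩ := exists_isIntegralCurveOn_Ici hfrozen (x := (z₀, y)) (by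
    intro T
    rcases lt_or_ge T 0 with hT | hT
    · exact ⟨0, fun t ht => absurd (ht.1.trans ht.2) (not_le.2 hT)⟩
    have hc : Continuous fun t => ψ t z₀ := ψ.continuous continuous_id continuous_const
    obtain ⟨Rz, hRz⟩ := isCompact_Icc.exists_bound_of_continuousOn (hc.continuousOn (s := Icc 0 T))
    obtain ⟨Cq, hCq⟩ := isCompact_Icc.exists_bound_of_continuousOn
      ((S.contDiff_q.continuous.comp (hc.prodMk continuous_const)).continuousOn (s := Icc 0 T))
    have hCq0 : 0 ≤ Cq := (norm_nonneg _).trans (hCq 0 ⟨le_rfl, hT⟩)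
    obtain ⟨R, hR⟩ := exists_loop_bound (dz := dz) S b lam hCφ hC hdz hℓ' (norm_nonneg y) hT hCq0
    refine ⟨max Rz R, fun t ht γ h0 hγ => ?_⟩
    have hb := hbase ht.1 h0 hγ
    rw [Prod.norm_def]
    refine max_le_max ?_ (hR _ hθ t ht γ (by rw [h0]) (fun u hu => ?_) hγ)
    · rw [hb t ⟨ht.1, le_rfl⟩]; exact hRz t ht
    · rw [hb u hu]; exact hCq u ⟨hu.1, hu.2.trans ht.2⟩)
  have hb : ∀ t, 0 ≤ t → (γ t).1 = ψ t z₀ := fun t ht =>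
    hbase ht h0 (hγ.mono Icc_subset_Ici_self) t ⟨ht, le_rfl⟩
  have hγ' : IsIntegralCurveOn γ (fun _ => S.loopField b lam θ φ Ω dz) (Ici 0) :=
    (isIntegralCurveOn_freeze fun t ht => by rw [hb t ht, hparam t ht]).2 hγ
  refine ⟨γ, h0, hγ', hγ, hb, fun t ht => ?_⟩
  refine odeFlow_eq_of_unique h0 (hγ'.mono (by rw [uIcc_of_le ht]; exact Icc_subset_Ici_self))
    fun γ' h0' hγ'' => ?_
  rw [uIcc_of_le ht] at hγ''
  have hb' := hbase ht h0' hγ''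
  have hf : IsIntegralCurveOn γ'
      (fun _ => S.loopField b lam (fun _ => θ z₀.1.1) φ Ω dz) (Icc 0 t) :=
    (isIntegralCurveOn_freeze fun u hu => by rw [hb' u hu, hparam u hu.1]).1 hγ''
  rw [← uIcc_of_le ht] at hf
  exact isIntegralCurveOn_eq_of_contDiff hfrozen hf
    (hγ.mono (by rw [uIcc_of_le ht]; exact Icc_subset_Ici_self)) (h0'.trans h0.symm) right_mem_uIcc

end LoopSolution

/-! ### Iteration of windows -/

section Iteration

theorem sqrt_add_sq_le {x y : ℝ} (hx : 0 ≤ x) (hy : 0 ≤ y) : √(x ^ 2 + y ^ 2) ≤ x + y :=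
  Real.sqrt_le_iff.2 ⟨by positivity, by nlinarith [mul_nonneg hx hy]⟩

namespace ErrorWindow

variable {H X : Type*} [NormedAddCommGroup H] [InnerProductSpace ℝ H]
  [NormedAddCommGroup X] [InnerProductSpace ℝ X] {T lam a c₀ c₁ ε₀ κ : ℝ}

/-- Along a sequence of windows with geometrically decreasing perturbations and jumps, the energy
stays bounded. -/
theorem bounded_of_windows (hT : 0 < T) (ha : 0 < a) (hc₀ : 0 ≤ c₀) (hc₁ : 0 ≤ c₁) (hε₀ : 0 ≤ ε₀)
    (hlam : c₀ + 2 * c₀ ^ 2 / a + a / 2 ≤ lam) {q C₂ δ₀ : ℝ} (hq0 : 0 ≤ q) (hq1 : q < 1)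
    (hC₂ : 0 ≤ C₂) (hδ₀ : 0 ≤ δ₀) (hδ₁ : δ₀ ≤ 1)
    (w : ∀ j : ℕ, ErrorWindow H X T lam a c₀ c₁ ε₀ κ (δ₀ * q ^ j)) {N : ℕ → ℝ}
    (hN0 : ∀ j, 0 ≤ N j) (hN : ∀ j, (w j).energy 0 = N j ^ 2)
    (hjump : ∀ j, N (j + 1) ≤ √((w j).energy T) + C₂ * (δ₀ * q ^ j)) (j : ℕ) :
    1 + 2 * N j ^ 2 ≤ (1 + 2 * N 0 ^ 2) *
      Real.exp ((8 * c₁ * (1 + c₀) * T + 2 * C₂ + 2 * C₂ ^ 2) / (1 - q) * (1 - q ^ j)) := by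
  obtain ⟨c, hc⟩ : ∃ c, c = 8 * c₁ * (1 + c₀) * T + 2 * C₂ + 2 * C₂ ^ 2 := ⟨_, rfl⟩
  have hc0 : 0 ≤ c := by rw [hc]; positivity
  have hq1' : 0 < 1 - q := sub_pos.2 hq1
  rw [← hc]
  induction j with
  | zero => simp
  | succ j ih =>
    obtain ⟨δ, hδ⟩ : ∃ δ, δ = δ₀ * q ^ j := ⟨_, rfl⟩
    have hqj : q ^ j ≤ 1 := pow_le_one₀ hq0 hq1.le
    have hqj0 : 0 ≤ q ^ j := by positivity
    have hδ0 : 0 ≤ δ := by rw [hδ]; positivity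
    have hδ1 : δ ≤ 1 := by rw [hδ]; exact mul_le_one₀ hδ₁ hqj0 hqj
    have hδq : δ ≤ q ^ j := by rw [hδ]; exact mul_le_of_le_one_left hqj0 hδ₁
    have h1 := (w j).energy_growth ha hc₀ hc₁ (by positivity) hε₀ hlam
      (show T ∈ Icc 0 T from ⟨hT.le, le_rfl⟩)
    have h2 := hjump j
    rw [hN] at h1
    obtain ⟨x, hx⟩ : ∃ x, x = √((w j).energy T) := ⟨_, rfl⟩
    have hx0 : 0 ≤ x := by rw [hx]; positivity
    have hxe : (w j).energy T = x ^ 2 := by rw [hx, Real.sq_sqrt ((w j).energy_nonneg T)]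
    rw [← hx, ← hδ] at h2
    rw [hxe, ← hδ] at h1
    have h3 : 1 + 2 * N (j + 1) ^ 2 ≤ (1 + 2 * x ^ 2) * (1 + (2 * C₂ + 2 * C₂ ^ 2) * δ) := by
      have h4 : N (j + 1) ^ 2 ≤ (x + C₂ * δ) ^ 2 := by gcongr; exact hN0 _
      have h5 : 2 * x ≤ 1 + x ^ 2 := by nlinarith [sq_nonneg (x - 1)]
      have h6 : 2 * x * (C₂ * δ) ≤ (1 + x ^ 2) * (C₂ * δ) := by gcongr
      have h7 : C₂ ^ 2 * δ * δ ≤ C₂ ^ 2 * δ * 1 := by gcongr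
      have h8 : 0 ≤ x ^ 2 * (C₂ * δ) := by positivity
      have h9 : 0 ≤ x ^ 2 * (C₂ ^ 2 * δ) := by positivity
      nlinarith
    have h4 : 1 + (2 * C₂ + 2 * C₂ ^ 2) * δ ≤ Real.exp ((2 * C₂ + 2 * C₂ ^ 2) * δ) := by
      linarith [Real.add_one_le_exp ((2 * C₂ + 2 * C₂ ^ 2) * δ)]
    calc _ ≤ (1 + 2 * x ^ 2) * (1 + (2 * C₂ + 2 * C₂ ^ 2) * δ) := h3
      _ ≤ ((1 + 2 * N j ^ 2) * Real.exp (8 * c₁ * (1 + c₀) * δ * T)) *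
          Real.exp ((2 * C₂ + 2 * C₂ ^ 2) * δ) := by gcongr
      _ = (1 + 2 * N j ^ 2) * Real.exp (c * δ) := by
          rw [mul_assoc, ← Real.exp_add, hc]; ring_nf
      _ ≤ ((1 + 2 * N 0 ^ 2) * Real.exp (c / (1 - q) * (1 - q ^ j))) *
          Real.exp (c * q ^ j) := by gcongr
      _ = _ := by
          rw [mul_assoc, ← Real.exp_add]
          congr 2
          field_simp
          ring

/-- Along a sequence of windows with geometrically decreasing perturbations and jumps, the energy
decays exponentially, uniformly for bounded initial energies. -/
theorem exists_decay_of_windows (hT : 0 < T) (ha : 0 < a) (hc₀ : 0 ≤ c₀) (hc₁ : 0 ≤ c₁)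
    (hε₀ : 0 < ε₀) (hκ : 0 < κ)
    (hlam : c₀ + 2 * c₀ ^ 2 / a + a / 2 ≤ lam) {q C₂ : ℝ} (hq0 : 0 ≤ q) (hq1 : q < 1)
    (hC₂ : 0 ≤ C₂) (R₀ : ℝ) (H X : Type*) [NormedAddCommGroup H] [InnerProductSpace ℝ H]
    [NormedAddCommGroup X] [InnerProductSpace ℝ X] :
    ∃ C s : ℝ, 0 ≤ C ∧ 0 < s ∧ s < 1 ∧ q ≤ s ∧ ∀ δ₀, 0 ≤ δ₀ → δ₀ ≤ 1 →
      ∀ (w : ∀ j : ℕ, ErrorWindow H X T lam a c₀ c₁ ε₀ κ (δ₀ * q ^ j)) (N : ℕ → ℝ),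
      (∀ j, 0 ≤ N j) → (∀ j, (w j).energy 0 = N j ^ 2) →
      (∀ j, N (j + 1) ≤ √((w j).energy T) + C₂ * (δ₀ * q ^ j)) → N 0 ≤ R₀ →
      ∀ j, ∀ t ∈ Icc 0 T, √((w j).energy t) ≤ C * s ^ j * (N 0 + δ₀) := by
  obtain ⟨R, hR⟩ : ∃ R, R = (1 + 2 * R₀ ^ 2) *
    Real.exp ((8 * c₁ * (1 + c₀) * T + 2 * C₂ + 2 * C₂ ^ 2) / (1 - q)) := ⟨_, rfl⟩
  obtain ⟨ρ, C, hρ0, hρ1, hC0, hcon⟩ := exists_contraction (R := R) hT ha hc₀ hc₁ hε₀ hκ hlam H X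
  have hq1' : 0 < 1 - q := sub_pos.2 hq1
  have hsρ1 : √ρ < 1 := by rw [Real.sqrt_lt' one_pos]; simpa using hρ1
  have hsρ0 := Real.sqrt_nonneg ρ
  have hsC0 := Real.sqrt_nonneg C
  obtain ⟨s, hs⟩ : ∃ s, s = (1 + max √ρ q) / 2 := ⟨_, rfl⟩
  have hmax : max √ρ q < 1 := max_lt hsρ1 hq1
  have hs1 : s < 1 := by rw [hs]; linarith
  have hsm : max √ρ q < s := by rw [hs]; linarith
  have hsρ : √ρ ≤ s := (le_max_left _ _).trans hsm.le
  have hsq : q < s := (le_max_right _ _).trans_lt hsm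
  have hs0 : 0 < s := hq0.trans_lt hsq
  have hsq' : 0 < s - q := sub_pos.2 hsq
  obtain ⟨B, hB⟩ : ∃ B, B = (√C + C₂) / (s - q) := ⟨_, rfl⟩
  have hB0 : 0 ≤ B := by rw [hB]; positivity
  refine ⟨√C * (2 + B), s, by positivity, hs0, hs1, hsq.le,
    fun δ₀ hδ₀ hδ₁ w N hN0 hN hjump hNR => ?_⟩
  have hbd : ∀ j, (w j).energy 0 ≤ R := by
    intro j
    have h1 := bounded_of_windows hT ha hc₀ hc₁ hε₀.le hlam hq0 hq1 hC₂ hδ₀ hδ₁ w hN0 hN hjump j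
    rw [hN, hR]
    have h2 : (1 + 2 * N 0 ^ 2) *
        Real.exp ((8 * c₁ * (1 + c₀) * T + 2 * C₂ + 2 * C₂ ^ 2) / (1 - q) * (1 - q ^ j)) ≤
        (1 + 2 * R₀ ^ 2) *
        Real.exp ((8 * c₁ * (1 + c₀) * T + 2 * C₂ + 2 * C₂ ^ 2) / (1 - q)) := by
      gcongr
      · exact hN0 0
      · refine mul_le_of_le_one_right (by positivity) ?_
        have : 0 ≤ q ^ j := by positivity
        linarith
    nlinarith [sq_nonneg (N j)]
  have hδj : ∀ j, 0 ≤ δ₀ * q ^ j ∧ δ₀ * q ^ j ≤ 1 := fun j =>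
    ⟨by positivity, mul_le_one₀ hδ₁ (by positivity) (pow_le_one₀ hq0 hq1.le)⟩
  have hstep : ∀ j, N (j + 1) ≤ √ρ * N j + (√C + C₂) * (δ₀ * q ^ j) := by
    intro j
    have h1 := (hcon _ (hδj j).1 (hδj j).2 (w j) (hbd j)).1
    rw [hN] at h1
    have h2 : √((w j).energy T) ≤ √ρ * N j + √C * (δ₀ * q ^ j) := by
      refine (Real.sqrt_le_sqrt (y := (√ρ * N j) ^ 2 + (√C * (δ₀ * q ^ j)) ^ 2) ?_).trans
        (sqrt_add_sq_le (mul_nonneg hsρ0 (hN0 j)) (mul_nonneg hsC0 (hδj j).1))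
      rwa [mul_pow, mul_pow (√C), Real.sq_sqrt hρ0, Real.sq_sqrt hC0]
    linarith [hjump j]
  -- `B` is chosen so that `N j + B δ₀ q ^ j` decreases by the factor `s` in each step
  have hdec : ∀ j, N j + B * (δ₀ * q ^ j) ≤ s ^ j * (N 0 + B * δ₀) := by
    intro j
    induction j with
    | zero => simp
    | succ j ih =>
      have h1 : √ρ * N j ≤ s * N j := mul_le_mul_of_nonneg_right hsρ (hN0 j)
      have h2 : (√C + C₂) * (δ₀ * q ^ j) = (s - q) * B * (δ₀ * q ^ j) := by
        rw [hB]; field_simp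
      have h3 := hstep j
      have h4 := mul_le_mul_of_nonneg_left ih hs0.le
      rw [pow_succ, pow_succ]
      linarith
  intro j t ht
  have h1 := (hcon _ (hδj j).1 (hδj j).2 (w j) (hbd j)).2 t ht
  rw [hN] at h1
  have h2 : √((w j).energy t) ≤ √C * (N j + δ₀ * q ^ j) := by
    refine (Real.sqrt_le_sqrt h1).trans ?_
    rw [Real.sqrt_mul hC0]
    exact mul_le_mul_of_nonneg_left (sqrt_add_sq_le (hN0 j) (hδj j).1) hsC0
  have h3 : N j ≤ s ^ j * (N 0 + B * δ₀) :=
    le_trans (le_add_of_nonneg_right (mul_nonneg hB0 (hδj j).1)) (hdec j)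
  have h4 : δ₀ * q ^ j ≤ δ₀ * s ^ j := by gcongr
  have hN00 := hN0 0
  calc _ ≤ √C * (N j + δ₀ * q ^ j) := h2
    _ ≤ √C * (s ^ j * (N 0 + B * δ₀) + δ₀ * s ^ j) := by gcongr
    _ ≤ √C * (s ^ j * ((2 + B) * (N 0 + δ₀))) := by
        gcongr
        have : 0 ≤ s ^ j * ((1 + B) * N 0 + δ₀) := by positivity
        linarith
    _ = _ := by ring

end ErrorWindow

end Iteration

/-! ### Convergence to the steady state -/

section Convergence

variable {p s n m k : ℕ} {S : Plant p s n}

theorem exists_floor_decomp {T t : ℝ} (hT : 0 < T) (ht : 0 ≤ t) :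
    ∃ (j : ℕ) (u : ℝ), u ∈ Icc 0 T ∧ t = u + j * T := by
  refine ⟨⌊t / T⌋₊, t - ⌊t / T⌋₊ * T, ⟨?_, ?_⟩, by ring⟩
  · have := Nat.floor_le (div_nonneg ht hT.le)
    rw [le_div_iff₀ hT] at this
    linarith
  · have := (Nat.lt_floor_add_one (t / T)).le
    rw [div_le_iff₀ hT] at this
    linarith

/-- Geometric decay over the windows is exponential decay in time. -/
theorem pow_le_exp_of_window {T r u : ℝ} (hT : 0 < T) (hr : 0 < r) (hr1 : r < 1) (hu : u ≤ T)
    (j : ℕ) : r ^ j ≤ r⁻¹ * Real.exp (-(-Real.log r / T) * (u + j * T)) := by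
  have hlog := Real.log_neg hr hr1
  have h1 : Real.log r * (j + 1) ≤ -(-Real.log r / T) * (u + j * T) := by
    have h2 : (u + j * T) / T ≤ j + 1 := by
      rw [div_le_iff₀ hT]; linarith
    have h3 := mul_le_mul_of_nonpos_left h2 hlog.le
    calc _ ≤ Real.log r * ((u + j * T) / T) := h3
      _ = _ := by ring
  have h2 : r ^ (j + 1) ≤ Real.exp (-(-Real.log r / T) * (u + j * T)) := by
    refine le_trans (le_of_eq ?_) (Real.exp_le_exp.2 h1)
    rw [mul_comm, ← Nat.cast_add_one, Real.exp_nat_mul, Real.exp_log hr]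
  rw [le_inv_mul_iff₀ hr, ← pow_succ']
  exact h2

variable {D B A : Set (ZState p s n)} {ψ : Flow ℝ (ZState p s n)} {K M α d : ℝ}
  {b : Fin m → ℝ} {τ : ZState p s n → Fin (m + 1) → ℝ} {σ : ZState p s n → Fin m → Fin k → ℝ}
  {θ : (Fin p → ℝ) → Fin k → ℝ} {φ : ℝ → Fin (m + 1) → ℝ} {Ω : ℝ → Fin (m + 1) → Fin k → ℝ}
  {L T κ : ℝ}

theorem SteadyState.norm_steadyError_sub_le (hs : SteadyState S A ψ b τ σ θ φ Ω L T κ)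
    {zs zs' : ZState p s n} (hzs : zs ∈ A) (hzs' : zs' ∈ A) (x : LoopState p s n m k) :
    ‖steadyError τ σ zs x - steadyError τ σ zs' x‖ ≤ L * dist zs zs' := by
  have h0 : 0 ≤ L * dist zs zs' := mul_nonneg hs.nonneg_L dist_nonneg
  have h : steadyError τ σ zs x - steadyError τ σ zs' x = (τ zs' - τ zs, 0, σ zs' - σ zs) := by
    refine Prod.ext ?_ (Prod.ext ?_ ?_)
    · simp [steadyError]
    · simp [steadyError]
    · simp [steadyError]
  rw [h, Prod.norm_def, Prod.norm_def, dist_comm]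
  rw [dist_comm] at h0
  exact max_le (hs.tau_lipschitz _ hzs' _ hzs) (max_le (by simpa using h0)
    (hs.sigma_lipschitz _ hzs' _ hzs))

theorem AttractingSet.param_eq_of_mem (hA : AttractingSet S.zeroField D B A ψ K M α d)
    {z : ZState p s n} (hz : z ∈ D) (hzd : Metric.infDist z A ≤ d) {t : ℝ} (ht : 0 ≤ t) :
    (ψ t z).1.1 = z.1.1 := by
  have := Plant.param_eq (γ := fun t => ψ t z) ht
    ((hA.attracts z hz hzd).1.mono Icc_subset_Ici_self)
  simpa using this

/-- Near the limit set of the plant, on each window one may follow the orbit `ψ u (zs j)` of a point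
`zs j` of the limit set that is nearest to the state of the plant at the start of the window; these
orbits, their mutual jumps and their parameters approach geometrically. -/
theorem exists_shadowing (hA : AttractingSet S.zeroField D B A ψ K M α d)
    (hs : SteadyState S A ψ b τ σ θ φ Ω L T κ) {P : Set (Fin p → ℝ)} (hDP : ∀ z ∈ D, z.1.1 ∈ P)
    (hθc : ContinuousOn θ P) :
    ∃ Λ q : ℝ, 1 ≤ Λ ∧ 0 ≤ q ∧ q < 1 ∧ ∀ z₀ ∈ D, Metric.infDist z₀ A ≤ d → ∀ zs₀ ∈ A,
      dist z₀ zs₀ = Metric.infDist z₀ A → ∃ zs : ℕ → ZState p s n, zs 0 = zs₀ ∧ ∀ j, zs j ∈ A ∧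
        (∀ u ∈ Icc 0 T, dist (ψ (u + j * T) z₀) (ψ u (zs j)) ≤ Λ * Metric.infDist z₀ A * q ^ j ∧
          |S.q (ψ u (zs j), 0) - S.q (ψ (u + j * T) z₀, 0)| ≤ Λ * Metric.infDist z₀ A * q ^ j) ∧
        dist (zs (j + 1)) (ψ T (zs j)) ≤ Λ * Metric.infDist z₀ A * q ^ j ∧
        ‖θ z₀.1.1 - θ (zs j).1.1‖ ≤ Λ * Metric.infDist z₀ A * q ^ j := by
  obtain ⟨q, hq⟩ : ∃ q, q = Real.exp (-α * T) := ⟨_, rfl⟩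
  have hq0 : 0 < q := by rw [hq]; positivity
  have hq1 : q < 1 := by
    rw [hq, Real.exp_lt_one_iff]
    nlinarith [hA.pos_a, hs.pos_T]
  have hq1' : 0 < 1 - q := sub_pos.2 hq1
  have hM0 : 0 ≤ M := zero_le_one.trans hA.one_le_M
  obtain ⟨RA, hRA⟩ := hA.isCompact.isBounded.exists_norm_le
  have hq' : ContDiff ℝ 1 fun z : ZState p s n => S.q (z, 0) :=
    S.contDiff_q.comp (contDiff_id.prodMk contDiff_const)
  obtain ⟨Lq, hLq⟩ := hq'.exists_lipschitzOnWith_closedBall (RA + M * d)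
  obtain ⟨G, hG⟩ : ∃ G, G = M * Real.exp (K * T) := ⟨_, rfl⟩
  have hexp1 : 1 ≤ Real.exp (K * T) := Real.one_le_exp (mul_nonneg hA.nonneg_K hs.pos_T.le)
  have hG0 : 0 ≤ G := by rw [hG]; positivity
  have hMG : M ≤ G := by rw [hG]; exact le_mul_of_one_le_right hM0 hexp1
  have hL0 := hs.nonneg_L
  obtain ⟨Λ, hΛ⟩ : ∃ Λ, Λ = 1 + 2 * G + Lq * G + L * (2 * G) / (1 - q) := ⟨_, rfl⟩
  have hΛ1 : 0 ≤ L * (2 * G) / (1 - q) := by positivity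
  have hΛ2 : 0 ≤ Lq * G := by positivity
  refine ⟨Λ, q, by rw [hΛ]; linarith, hq0.le, hq1, fun z₀ hz₀ hd zs₀ hzs₀ hdist₀ => ?_⟩
  obtain ⟨δ₀, hδ⟩ : ∃ δ₀, δ₀ = Metric.infDist z₀ A := ⟨_, rfl⟩
  have hδ0 : 0 ≤ δ₀ := by rw [hδ]; exact Metric.infDist_nonneg
  have hT := hs.pos_T
  have hinf : ∀ j : ℕ, Metric.infDist (ψ (j * T) z₀) A ≤ M * q ^ j * δ₀ := by
    intro j
    have := (hA.attracts z₀ hz₀ hd).2 (j * T) (by positivity)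
    rwa [show -α * (j * T) = j * (-α * T) by ring, Real.exp_nat_mul, ← hq, ← hδ] at this
  have hex : ∀ j : ℕ, ∃ y ∈ A, dist (ψ (j * T) z₀) y ≤ M * q ^ j * δ₀ ∧ (j = 0 → y = zs₀) := by
    intro j
    rcases Nat.eq_zero_or_pos j with rfl | hj
    · refine ⟨zs₀, hzs₀, ?_, fun _ => rfl⟩
      simp only [Nat.cast_zero, zero_mul, Flow.map_zero_apply, pow_zero, mul_one]
      rw [hdist₀, ← hδ]
      exact le_mul_of_one_le_left hδ0 hA.one_le_M
    · obtain ⟨y, hy, hyd⟩ := hA.isCompact.exists_infDist_eq_dist hA.nonempty (ψ (j * T) z₀)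
      exact ⟨y, hy, by rw [← hyd]; exact hinf j, fun h => absurd h hj.ne'⟩
  choose zs hzsA hzsd hzs0 using hex
  have hΛle : ∀ {c : ℝ} (j : ℕ), c ≤ Λ → c * δ₀ * q ^ j ≤ Λ * δ₀ * q ^ j := fun j h => by gcongr
  have hwin : ∀ j : ℕ, ∀ u ∈ Icc 0 T, dist (ψ (u + j * T) z₀) (ψ u (zs j)) ≤ G * δ₀ * q ^ j := by
    intro j u hu
    rw [Flow.map_add, hG]
    calc _ ≤ dist (ψ (j * T) z₀) (zs j) * Real.exp (K * |u|) := hA.dist_flow_le _ _ _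
      _ ≤ (M * q ^ j * δ₀) * Real.exp (K * T) := by
          have := hA.nonneg_K
          gcongr
          · exact hzsd j
          · rw [abs_of_nonneg hu.1]; exact hu.2
      _ = _ := by ring
  have hnext : ∀ j : ℕ, dist (zs (j + 1)) (ψ T (zs j)) ≤ 2 * G * δ₀ * q ^ j := by
    intro j
    have h1 := hzsd (j + 1)
    have h2 := hwin j T ⟨hT.le, le_rfl⟩
    have h3 : ((j + 1 : ℕ) : ℝ) * T = T + j * T := by push_cast; ring
    rw [h3, dist_comm] at h1
    have h4 : M * q ^ (j + 1) * δ₀ ≤ G * δ₀ * q ^ j := by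
      rw [pow_succ]
      have : q ^ j * q ≤ q ^ j * 1 := by gcongr
      calc _ = M * δ₀ * (q ^ j * q) := by ring
        _ ≤ G * δ₀ * (q ^ j * 1) := by gcongr
        _ = _ := by ring
    have := dist_triangle (zs (j + 1)) (ψ (T + j * T) z₀) (ψ T (zs j))
    linarith
  have hparam : ∀ j : ℕ, (ψ (j * T) z₀).1.1 = z₀.1.1 := fun j =>
    hA.param_eq_of_mem hz₀ hd (by positivity)
  have hlim : Tendsto (fun j => (zs j).1.1) atTop (𝓝 z₀.1.1) := by
    rw [tendsto_iff_dist_tendsto_zero]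
    have h0 : Tendsto (fun j : ℕ => M * q ^ j * δ₀) atTop (𝓝 0) := by
      have := ((tendsto_pow_atTop_nhds_zero_of_lt_one hq0.le hq1).const_mul M).mul_const δ₀
      simpa using this
    refine squeeze_zero (fun _ => dist_nonneg) (fun j => ?_) h0
    rw [← hparam j, dist_comm]
    refine le_trans ?_ (hzsd j)
    exact (le_max_left _ _).trans (le_max_left (max _ _) _)
  have hθlim : Tendsto (fun j => θ (zs j).1.1) atTop (𝓝 (θ z₀.1.1)) := by
    have h1 : Tendsto (fun j => (zs j).1.1) atTop (𝓝[P] z₀.1.1) :=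
      tendsto_nhdsWithin_iff.2 ⟨hlim, Eventually.of_forall fun j => hDP _ (hA.subset (hzsA j))⟩
    exact (hθc z₀.1.1 (hDP z₀ hz₀)).tendsto.comp h1
  have hθstep : ∀ j, dist (θ (zs j).1.1) (θ (zs (j + 1)).1.1) ≤ L * (2 * G) * δ₀ * q ^ j := by
    intro j
    rw [dist_comm, dist_eq_norm, ← hs.param_eq _ (hzsA j) T]
    refine (hs.theta_lipschitz _ (hzsA _) _ (hA.flow_mem _ (hzsA j) T)).trans ?_
    calc _ ≤ L * (2 * G * δ₀ * q ^ j) := by gcongr; exact hnext j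
      _ = _ := by ring
  have hθ := dist_le_of_le_geometric_of_tendsto q (L * (2 * G) * δ₀) hq1 hθstep hθlim
  have hball : ∀ {x y : ZState p s n}, y ∈ A → dist x y ≤ M * d →
      x ∈ Metric.closedBall (0 : ZState p s n) (RA + M * d) := by
    intro x y hy hxy
    rw [mem_closedBall_zero_iff]
    have h4 : ‖x‖ ≤ ‖y‖ + dist x y := by
      rw [dist_eq_norm]
      simpa using norm_add_le y (x - y)
    linarith [hRA y hy]
  rw [← hδ]
  refine ⟨zs, hzs0 0 rfl, fun j => ⟨hzsA j, fun u hu => ⟨?_, ?_⟩, ?_, ?_⟩⟩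
  · exact (hwin j u hu).trans (hΛle j (by rw [hΛ]; linarith))
  · have hd0 := hA.pos_d
    have h1 : ψ (u + j * T) z₀ ∈ Metric.closedBall (0 : ZState p s n) (RA + M * d) := by
      have ht : 0 ≤ u + j * T := add_nonneg hu.1 (by positivity)
      obtain ⟨y, hy, hyd⟩ := hA.isCompact.exists_infDist_eq_dist hA.nonempty (ψ (u + j * T) z₀)
      refine hball hy ?_
      rw [← hyd]
      refine ((hA.attracts z₀ hz₀ hd).2 _ ht).trans ?_
      have : Real.exp (-α * (u + j * T)) ≤ 1 := Real.exp_le_one_iff.2 (by nlinarith [hA.pos_a])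
      calc _ ≤ M * 1 * d := by
            gcongr
            exact Metric.infDist_nonneg
        _ = M * d := by ring
    have h2 : ψ u (zs j) ∈ Metric.closedBall (0 : ZState p s n) (RA + M * d) :=
      hball (hA.flow_mem _ (hzsA j) u) (by rw [dist_self]; positivity)
    have h3 := hLq.dist_le_mul _ h2 _ h1
    rw [Real.dist_eq] at h3
    refine h3.trans ?_
    rw [dist_comm]
    calc _ ≤ Lq * (G * δ₀ * q ^ j) := by gcongr; exact hwin j u hu
      _ = Lq * G * δ₀ * q ^ j := by ring
      _ ≤ _ := hΛle j (by rw [hΛ]; linarith)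
  · exact (hnext j).trans (hΛle j (by rw [hΛ]; linarith))
  · rw [← dist_eq_norm, dist_comm]
    refine (hθ j).trans ?_
    calc _ = L * (2 * G) / (1 - q) * δ₀ * q ^ j := by ring
      _ ≤ _ := hΛle j (by rw [hΛ]; linarith)

/-- Solutions of the closed loop that start with a bounded error, over a plant state whose distance
to the limit set `A` of the plant is at most `d'`, converge exponentially to the steady state: at
each time they are close to the steady state over some point `zs` of `A`. -/
def ConvergesToSteadyState (S : Plant p s n) (D A : Set (ZState p s n)) (ψ : Flow ℝ (ZState p s n))
    (b : Fin m → ℝ) (lam : ℝ) (τ : ZState p s n → Fin (m + 1) → ℝ)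
    (σ : ZState p s n → Fin m → Fin k → ℝ) (θ : (Fin p → ℝ) → Fin k → ℝ)
    (φ : ℝ → Fin (m + 1) → ℝ) (Ω : ℝ → Fin (m + 1) → Fin k → ℝ) (dz : ℝ → ℝ) (d' : ℝ) : Prop :=
  ∀ R₀ : ℝ, ∃ Q ω : ℝ, 0 ≤ Q ∧ 0 < ω ∧
    ∀ z₀ ∈ D, Metric.infDist z₀ A ≤ d' → ∀ zs₀ ∈ A, dist z₀ zs₀ = Metric.infDist z₀ A →
    ∀ γ : ℝ → LoopState p s n m k,
    IsIntegralCurveOn γ (fun _ => S.loopField b lam (fun _ => θ z₀.1.1) φ Ω dz) (Ici 0) →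
    (∀ t, 0 ≤ t → (γ t).1 = ψ t z₀) → ‖steadyError τ σ zs₀ (γ 0)‖ ≤ R₀ →
    ∀ t, 0 ≤ t → ∃ zs ∈ A,
      dist (γ t).1 zs ≤ Q * Real.exp (-ω * t) * Metric.infDist z₀ A ∧
      ‖steadyError τ σ zs (γ t)‖ ≤ Q * Real.exp (-ω * t) *
        (‖steadyError τ σ zs₀ (γ 0)‖ + Metric.infDist z₀ A)

/-- For large gains the closed loop converges to its steady state: the error is followed over
windows of length `T`, with a new reference orbit on each. -/
theorem SteadyState.exists_loop_convergence (hs : SteadyState S A ψ b τ σ θ φ Ω L T κ)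
    (hA : AttractingSet S.zeroField D B A ψ K M α d) {P : Set (Fin p → ℝ)}
    (hDP : ∀ z ∈ D, z.1.1 ∈ P) (hθc : ContinuousOn θ P) {Lφ LΩ : NNReal}
    (hφ : LipschitzWith Lφ φ) (hΩ : LipschitzWith LΩ Ω) {C : ℝ} (hC : ∀ y, ‖Ω y‖ ≤ C)
    {ℓ ℓ' : ℝ} {dz : ℝ → ℝ} (hdz : IsDeadZone ℓ dz) (hℓ' : 0 ≤ ℓ') (hℓ : ℓ' < ℓ)
    (hθ : ∀ ϱ ∈ P, ∀ i, |θ ϱ i| ≤ ℓ')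
    {r : Fin m → ℂ} {a : ℝ} (hinj : Function.Injective r)
    (hr : ∀ i, (polyB b).eval (r i) = 0) (ha0 : 0 < a) (ha : ∀ i, (r i).re ≤ -a) :
    ∃ lamStar : ℝ, 0 < lamStar ∧ ∀ lam, lamStar ≤ lam → ∃ d' : ℝ, 0 < d' ∧ d' ≤ d ∧
      ConvergesToSteadyState S D A ψ b lam τ σ θ φ Ω dz d' := by
  obtain ⟨c₀, ε₀, hc₀, hε₀, hwindow⟩ := hs.exists_errorWindow hA.isCompact hA.flow_mem hφ hΩ hC hdz
    hℓ' hℓ hinj hr ha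
  obtain ⟨Λ, q, hΛ1, hq0, hq1, hshadow⟩ := exists_shadowing hA hs hDP hθc
  obtain ⟨Ce, hCe0, hCe⟩ := exists_norm_equiv (errorCoord_injective (k := k) hinj b)
  have hT := hs.pos_T
  have hL0 := hs.nonneg_L
  have hΛ0 : 0 < Λ := zero_lt_one.trans_le hΛ1
  refine ⟨max 1 (c₀ + 2 * c₀ ^ 2 / a + a / 2), lt_max_of_lt_left one_pos, fun lam hlam => ?_⟩
  have hlam0 : 0 ≤ lam := zero_le_one.trans ((le_max_left _ _).trans hlam)
  obtain ⟨c₁, hc₁, hw⟩ := hwindow lam hlam0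
  -- below the distance `Λ⁻¹` the perturbations have size at most one on every window
  refine ⟨min d Λ⁻¹, lt_min hA.pos_d (by positivity), min_le_left _ _, fun R₀ => ?_⟩
  obtain ⟨C', r', hC', hr0, hr1, hqr, hdecay⟩ := ErrorWindow.exists_decay_of_windows (q := q)
    (C₂ := Ce * L) hT ha0 hc₀ hc₁ hε₀ hs.pos_κ ((le_max_right _ _).trans hlam) hq0 hq1
    (by positivity) (Ce * R₀) (EuclideanSpace ℝ (Fin k)) (ModalFamily m k)
  have hω : 0 < -Real.log r' / T := div_pos (neg_pos.2 (Real.log_neg hr0 hr1)) hT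
  refine ⟨r'⁻¹ * (Λ + Ce * C' * (Ce + Λ)), -Real.log r' / T, by positivity, hω,
    fun z₀ hz₀ hd zs₀ hzs₀ hdist₀ γ hγ hγz hR t ht => ?_⟩
  obtain ⟨zs, hzs0, hzs⟩ := hshadow z₀ hz₀ (hd.trans (min_le_left _ _)) zs₀ hzs₀ hdist₀
  obtain ⟨δ₀, hδ⟩ : ∃ δ₀, δ₀ = Metric.infDist z₀ A := ⟨_, rfl⟩
  rw [← hδ] at hzs hd ⊢
  have hδ0 : 0 ≤ δ₀ := by rw [hδ]; exact Metric.infDist_nonneg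
  have hδ1 : Λ * δ₀ ≤ 1 := by
    have := mul_le_mul_of_nonneg_left (hd.trans (min_le_right _ _)) hΛ0.le
    rwa [mul_inv_cancel₀ hΛ0.ne'] at this
  have hshift : ∀ j : ℕ, IsIntegralCurveOn (fun u => γ (u + j * T))
      (fun _ => S.loopField b lam (fun _ => θ z₀.1.1) φ Ω dz) (Icc 0 T) := by
    intro j
    have h1 := hγ.comp_add (j * T)
    refine h1.mono fun u hu => ?_
    have : 0 ≤ u + j * T := add_nonneg hu.1 (by positivity)
    exact ⟨u + j * T, this, neg_add_cancel_comm_assoc _ _⟩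
  have hwj : ∀ j : ℕ, ∃ w : ErrorWindow (EuclideanSpace ℝ (Fin k)) (ModalFamily m k) T lam a c₀ c₁
      ε₀ κ (Λ * δ₀ * q ^ j), ∀ u, w.energy u =
        ‖errorCoord r b (steadyError τ σ (ψ u (zs j)) (γ (u + j * T)))‖ ^ 2 := by
    intro j
    refine hw (θ z₀.1.1) (hθ _ (hDP z₀ hz₀)) (zs j) (hzs j).1 _ (hzs j).2.2.2
      (fun u => γ (u + j * T)) (hshift j) fun u hu => ?_
    rw [hγz _ (add_nonneg hu.1 (by positivity))]
    exact ((hzs j).2.1 u hu).2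
  choose w hwe using hwj
  have hen : ∀ (j : ℕ) u, √((w j).energy u) =
      ‖errorCoord r b (steadyError τ σ (ψ u (zs j)) (γ (u + j * T)))‖ := fun j u => by
    rw [hwe, Real.sqrt_sq (norm_nonneg _)]
  obtain ⟨N, hN⟩ : ∃ N : ℕ → ℝ, N = fun j =>
    ‖errorCoord r b (steadyError τ σ (zs j) (γ (j * T)))‖ := ⟨_, rfl⟩
  have hN0 : N 0 ≤ Ce * ‖steadyError τ σ zs₀ (γ 0)‖ := by
    rw [hN]
    simp only [Nat.cast_zero, zero_mul, hzs0]
    exact (hCe _).2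
  have hdec := hdecay (Λ * δ₀) (by positivity) hδ1 w N (fun j => by rw [hN]; positivity)
    (fun j => by rw [hwe, hN]; simp) (fun j => ?_) (hN0.trans (by gcongr))
  · obtain ⟨j, u, hu, rfl⟩ := exists_floor_decomp hT ht
    have hpow := pow_le_exp_of_window hT hr0 hr1 hu.2 j
    obtain ⟨e, he⟩ : ∃ e, e = Real.exp (-(-Real.log r' / T) * (u + j * T)) := ⟨_, rfl⟩
    have he0 : 0 ≤ e := by rw [he]; positivity
    rw [← he] at hpow ⊢
    have hE0 := norm_nonneg (steadyError τ σ zs₀ (γ 0))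
    refine ⟨ψ u (zs j), hA.flow_mem _ (hzs j).1 u, ?_, ?_⟩
    · rw [hγz _ ht]
      calc _ ≤ Λ * δ₀ * q ^ j := ((hzs j).2.1 u hu).1
        _ ≤ Λ * δ₀ * r' ^ j := by gcongr
        _ ≤ Λ * δ₀ * (r'⁻¹ * e) := by gcongr
        _ = r'⁻¹ * Λ * e * δ₀ := by ring
        _ ≤ _ := by
            gcongr
            have : 0 ≤ Ce * C' * (Ce + Λ) := by positivity
            linarith
    · have h1 := hdec j u hu
      rw [hen] at h1
      calc _ ≤ Ce * ‖errorCoord r b (steadyError τ σ (ψ u (zs j)) (γ (u + j * T)))‖ := (hCe _).1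
        _ ≤ Ce * (C' * r' ^ j * (N 0 + Λ * δ₀)) := by gcongr
        _ ≤ Ce * (C' * (r'⁻¹ * e) * (Ce * ‖steadyError τ σ zs₀ (γ 0)‖ + Λ * δ₀)) := by
            have : 0 ≤ N 0 := by rw [hN]; positivity
            gcongr
        _ ≤ Ce * (C' * (r'⁻¹ * e) * ((Ce + Λ) * (‖steadyError τ σ zs₀ (γ 0)‖ + δ₀))) := by
            gcongr
            have h2 : 0 ≤ Ce * δ₀ := by positivity
            have h3 : 0 ≤ Λ * ‖steadyError τ σ zs₀ (γ 0)‖ := by positivity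
            linarith
        _ = r'⁻¹ * (Ce * C' * (Ce + Λ)) * e * (‖steadyError τ σ zs₀ (γ 0)‖ + δ₀) := by ring
        _ ≤ _ := by
            gcongr
            linarith
  · have h3 : ((j + 1 : ℕ) : ℝ) * T = T + j * T := by push_cast; ring
    rw [hen, hN]
    simp only [h3]
    have h4 := hs.norm_steadyError_sub_le (hzs (j + 1)).1 (hA.flow_mem _ (hzs j).1 T)
      (γ (T + j * T))
    have h5 : ‖errorCoord r b (steadyError τ σ (zs (j + 1)) (γ (T + j * T)) -
        steadyError τ σ (ψ T (zs j)) (γ (T + j * T)))‖ ≤ Ce * L * (Λ * δ₀ * q ^ j) := by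
      refine (hCe _).2.trans ?_
      rw [mul_assoc]
      gcongr
      exact h4.trans (by gcongr; exact (hzs j).2.2.1)
    rw [map_sub] at h5
    have h6 := norm_add_le (errorCoord r b (steadyError τ σ (ψ T (zs j)) (γ (T + j * T))))
      (errorCoord r b (steadyError τ σ (zs (j + 1)) (γ (T + j * T))) -
        errorCoord r b (steadyError τ σ (ψ T (zs j)) (γ (T + j * T))))
    rw [add_sub_cancel] at h6
    linarith

end Convergence

/-! ### The limit set of the closed loop -/

section LimitSet

variable {p s n m k : ℕ} {S : Plant p s n} {D B A : Set (ZState p s n)}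
  {ψ : Flow ℝ (ZState p s n)} {K M α d d' : ℝ}
  {b : Fin m → ℝ} {τ : ZState p s n → Fin (m + 1) → ℝ} {σ : ZState p s n → Fin m → Fin k → ℝ}
  {θ : (Fin p → ℝ) → Fin k → ℝ} {φ : ℝ → Fin (m + 1) → ℝ} {Ω : ℝ → Fin (m + 1) → Fin k → ℝ}
  {L T κ lam : ℝ} {dz : ℝ → ℝ}

/-- The steady state of the closed loop over the plant state `z`. -/
def steadyPoint (τ : ZState p s n → Fin (m + 1) → ℝ) (σ : ZState p s n → Fin m → Fin k → ℝ)
    (z : ZState p s n) : LoopState p s n m k :=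
  (z, τ z, 0, σ z)

theorem dist_steadyPoint (zs : ZState p s n) (x : LoopState p s n m k) :
    dist x (steadyPoint τ σ zs) = max (dist x.1 zs) ‖steadyError τ σ zs x‖ := by
  have : steadyError τ σ zs x = x.2 - (τ zs, 0, σ zs) := by
    refine Prod.ext rfl (Prod.ext ?_ rfl)
    simp [steadyError]
  rw [Prod.dist_eq, this, ← dist_eq_norm]
  rfl

theorem SteadyState.isCompact_image (hs : SteadyState S A ψ b τ σ θ φ Ω L T κ) (hA : IsCompact A) :
    IsCompact (steadyPoint τ σ '' A) :=
  hA.image_of_continuousOn (continuousOn_id.prodMk (hs.continuousOn_tau.prodMk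
    (continuousOn_const.prodMk hs.continuousOn_sigma)))

theorem infDist_image_le {zs : ZState p s n} (hzs : zs ∈ A) (x : LoopState p s n m k) {c : ℝ}
    (h1 : dist x.1 zs ≤ c) (h2 : ‖steadyError τ σ zs x‖ ≤ c) :
    Metric.infDist x (steadyPoint τ σ '' A) ≤ c := by
  refine (Metric.infDist_le_dist_of_mem (mem_image_of_mem _ hzs)).trans ?_
  rw [dist_steadyPoint]
  exact max_le h1 h2

/-- Every initial condition over an admissible plant state has a solution of the closed loop, which
is the flow `ψ` in the plant coordinates. -/
def LoopSolvable (S : Plant p s n) (D : Set (ZState p s n)) (ψ : Flow ℝ (ZState p s n))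
    (b : Fin m → ℝ) (lam : ℝ) (θ : (Fin p → ℝ) → Fin k → ℝ)
    (φ : ℝ → Fin (m + 1) → ℝ) (Ω : ℝ → Fin (m + 1) → Fin k → ℝ) (dz : ℝ → ℝ) : Prop :=
  ∀ z₀ ∈ D, IsIntegralCurveOn (fun t => ψ t z₀) (fun _ => S.zeroField) (Ici 0) →
    ∀ y : ErrorState m k, ∃ γ : ℝ → LoopState p s n m k, γ 0 = (z₀, y) ∧
      IsIntegralCurveOn γ (fun _ => S.loopField b lam θ φ Ω dz) (Ici 0) ∧
      IsIntegralCurveOn γ (fun _ => S.loopField b lam (fun _ => θ z₀.1.1) φ Ω dz) (Ici 0) ∧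
      (∀ t, 0 ≤ t → (γ t).1 = ψ t z₀) ∧
      ∀ t, 0 ≤ t → odeFlow (S.loopField b lam θ φ Ω dz) t (z₀, y) = γ t

/-- Near the graph of the steady state the initial error is bounded, so that exponential convergence
holds with uniform constants; the error is linear in the distance to the graph because `τ` and `σ`
are Lipschitz on `A`. -/
theorem SteadyState.locallyExponentiallyAttractive (hs : SteadyState S A ψ b τ σ θ φ Ω L T κ)
    (hA : AttractingSet S.zeroField D B A ψ K M α d)
    (hsolv : LoopSolvable S D ψ b lam θ φ Ω dz) (hd' : 0 < d') (hdd : d' ≤ d)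
    (hconv : ConvergesToSteadyState S D A ψ b lam τ σ θ φ Ω dz d') :
    LocallyExponentiallyAttractive (S.loopField b lam θ φ Ω dz) (D ×ˢ univ)
      (steadyPoint τ σ '' A) := by
  have hL0 := hs.nonneg_L
  obtain ⟨Q, ω, hQ, hω, h⟩ := hconv (1 + 2 * L)
  refine ⟨hA.nonempty.image _, max 1 (Q * (2 + 2 * L)), le_max_left _ _, ω, hω, min d' 1,
    lt_min hd' one_pos, ?_⟩
  rintro ⟨z₀, y⟩ hx hxd
  have hz₀ : z₀ ∈ D := hx.1
  obtain ⟨_, ⟨z', hz', rfl⟩, hdist⟩ := (hs.isCompact_image hA.isCompact).exists_infDist_eq_dist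
    (hA.nonempty.image _) ((z₀, y) : LoopState p s n m k)
  obtain ⟨ρ, hρ⟩ : ∃ ρ, ρ = Metric.infDist ((z₀, y) : LoopState p s n m k)
    (steadyPoint τ σ '' A) := ⟨_, rfl⟩
  rw [← hρ] at hdist hxd ⊢
  rw [dist_steadyPoint] at hdist
  have hρ0 : 0 ≤ ρ := by rw [hρ]; exact Metric.infDist_nonneg
  have h1 : dist z₀ z' ≤ ρ := hdist ▸ le_max_left _ _
  have h2 : ‖steadyError τ σ z' (z₀, y)‖ ≤ ρ := hdist ▸ le_max_right _ _
  have hzρ : Metric.infDist z₀ A ≤ ρ := (Metric.infDist_le_dist_of_mem hz').trans h1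
  have hzd' : Metric.infDist z₀ A ≤ d' := hzρ.trans (hxd.trans (min_le_left _ _))
  obtain ⟨zs₀, hzs₀, hzs₀d⟩ := hA.isCompact.exists_infDist_eq_dist hA.nonempty z₀
  obtain ⟨γ, h0, hγ, hγf, hγz, -⟩ := hsolv z₀ hz₀ (hA.attracts z₀ hz₀ (hzd'.trans hdd)).1 y
  have h3 : dist zs₀ z' ≤ 2 * ρ := by
    have := dist_triangle_left zs₀ z' z₀
    linarith
  have h4 : ‖steadyError τ σ zs₀ (z₀, y)‖ ≤ (1 + 2 * L) * ρ := by
    have h5 := hs.norm_steadyError_sub_le hzs₀ hz' (z₀, y)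
    have h6 := norm_le_norm_add_norm_sub' (steadyError τ σ zs₀ (z₀, y))
      (steadyError τ σ z' (z₀, y))
    have h7 : L * dist zs₀ z' ≤ L * (2 * ρ) := by gcongr
    linarith
  have hρ1 : ρ ≤ 1 := hxd.trans (min_le_right _ _)
  refine ⟨γ, h0, hγ, fun t ht => ?_⟩
  obtain ⟨zs, hzs, h5, h6⟩ := h z₀ hz₀ hzd' zs₀ hzs₀ hzs₀d.symm γ hγf hγz
    (by rw [h0]; exact h4.trans (mul_le_of_le_one_right (by positivity) hρ1)) t ht
  rw [h0] at h6
  have h7 : Q * Real.exp (-ω * t) * ((2 + 2 * L) * ρ) ≤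
      max 1 (Q * (2 + 2 * L)) * Real.exp (-ω * t) * ρ := by
    calc _ = Q * (2 + 2 * L) * Real.exp (-ω * t) * ρ := by ring
      _ ≤ _ := by gcongr; exact le_max_right _ _
  refine infDist_image_le hzs _ (h5.trans (le_trans ?_ h7)) (h6.trans (le_trans ?_ h7))
  · gcongr
    have : 0 ≤ (1 + 2 * L) * ρ := by positivity
    linarith
  · gcongr
    linarith

/-- On a finite horizon, solutions of the closed loop over plant states in `B` with bounded initial
values remain bounded. -/
def LoopBounded (S : Plant p s n) (B : Set (ZState p s n)) (ψ : Flow ℝ (ZState p s n))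
    (b : Fin m → ℝ) (lam : ℝ) (θ : (Fin p → ℝ) → Fin k → ℝ)
    (φ : ℝ → Fin (m + 1) → ℝ) (Ω : ℝ → Fin (m + 1) → Fin k → ℝ) (dz : ℝ → ℝ) : Prop :=
  ∀ T, 0 ≤ T → ∀ ρ, 0 ≤ ρ → ∃ R, ∀ z₀ ∈ B, ∀ γ : ℝ → LoopState p s n m k, ‖(γ 0).2‖ ≤ ρ →
    (∀ t, 0 ≤ t → (γ t).1 = ψ t z₀) →
    IsIntegralCurveOn γ (fun _ => S.loopField b lam (fun _ => θ z₀.1.1) φ Ω dz) (Ici 0) →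
    ‖(γ T).2‖ ≤ R

theorem SteadyState.exists_norm_steadyError_le (hs : SteadyState S A ψ b τ σ θ φ Ω L T κ)
    (hA : IsCompact A) : ∃ C, 0 ≤ C ∧ ∀ zs ∈ A, ∀ x : LoopState p s n m k,
      ‖steadyError τ σ zs x‖ ≤ ‖x.2‖ + C := by
  obtain ⟨C, hC⟩ := (hs.isCompact_image hA).isBounded.exists_norm_le
  refine ⟨|C|, abs_nonneg _, fun zs hzs x => ?_⟩
  have h : steadyError τ σ zs x = x.2 - (steadyPoint τ σ zs).2 := by
    refine Prod.ext rfl (Prod.ext ?_ rfl)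
    simp [steadyError, steadyPoint]
  rw [h]
  refine (norm_sub_le _ _).trans (add_le_add le_rfl ?_)
  exact ((norm_snd_le _).trans (hC _ (mem_image_of_mem _ hzs))).trans (le_abs_self C)

theorem exists_exp_le {C ω ε : ℝ} (hω : 0 < ω) (hε : 0 < ε) :
    ∃ T, 0 ≤ T ∧ ∀ t, T ≤ t → C * Real.exp (-ω * t) ≤ ε := by
  have h : Tendsto (fun t => C * Real.exp (-ω * t)) atTop (𝓝 (C * 0)) :=
    (Real.tendsto_exp_atBot.comp
      ((tendsto_const_mul_atBot_of_neg (neg_lt_zero.2 hω)).2 tendsto_id)).const_mul C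
  rw [mul_zero] at h
  obtain ⟨T, hT⟩ := eventually_atTop.1 (h.eventually (ge_mem_nhds hε))
  exact ⟨max T 0, le_max_right _ _, fun t ht => hT t ((le_max_left _ _).trans ht)⟩

/-- The steady states attract the initial conditions in `B ×ˢ Y` uniformly: the plant enters the
neighbourhood of `A` where convergence holds after a time `T₀`, up to which the loop stays bounded.
-/
theorem SteadyState.eventually_infDist_le (hs : SteadyState S A ψ b τ σ θ φ Ω L T κ)
    (hA : AttractingSet S.zeroField D B A ψ K M α d) (hBD : B ⊆ D)
    (hsolv : LoopSolvable S D ψ b lam θ φ Ω dz) (hbdd : LoopBounded S B ψ b lam θ φ Ω dz)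
    (hd' : 0 < d') (hconv : ConvergesToSteadyState S D A ψ b lam τ σ θ φ Ω dz d')
    {Y : Set (ErrorState m k)} (hY : IsCompact Y) {ε : ℝ} (hε : 0 < ε) :
    ∃ T, 0 ≤ T ∧ ∀ t, T ≤ t → ∀ x ∈ B ×ˢ Y,
      Metric.infDist (odeFlow (S.loopField b lam θ φ Ω dz) t x) (steadyPoint τ σ '' A) ≤ ε := by
  obtain ⟨ρ, hρ⟩ := hY.isBounded.exists_norm_le
  obtain ⟨T₀, hT₀, habs⟩ := hA.absorbs d' hd'
  obtain ⟨R, hR⟩ := hbdd T₀ hT₀ |ρ| (abs_nonneg _)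
  obtain ⟨C, hC0, hC⟩ := hs.exists_norm_steadyError_le hA.isCompact
  obtain ⟨c, hcD, -, hc⟩ := hA.bounded
  obtain ⟨Q, ω, hQ, hω, h⟩ := hconv (R + C)
  obtain ⟨T₁, hT₁, hexp⟩ := exists_exp_le (C := Q * (R + C + d')) hω hε
  refine ⟨T₁ + T₀, by positivity, ?_⟩
  rintro t ht ⟨z₀, y⟩ ⟨hz₀, hy⟩
  obtain ⟨γ, h0, -, hγf, hγz, hflow⟩ := hsolv z₀ (hBD hz₀) (hA.isIntegralCurveOn z₀ hz₀) y
  obtain ⟨u, rfl⟩ : ∃ u, t = u + T₀ := ⟨t - T₀, by ring⟩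
  have hu : T₁ ≤ u := by linarith
  have hu0 : 0 ≤ u := hT₁.trans hu
  rw [hflow _ (by positivity)]
  have hparam : (ψ T₀ z₀).1.1 = z₀.1.1 := by
    have := Plant.param_eq (γ := fun t => ψ t z₀) hT₀
      ((hA.isIntegralCurveOn z₀ hz₀).mono Icc_subset_Ici_self)
    simpa using this
  have hγR : ‖(γ T₀).2‖ ≤ R := hR z₀ hz₀ γ (by
    rw [h0]; exact (hρ y hy).trans (le_abs_self ρ)) hγz hγf
  have hshift : IsIntegralCurveOn (fun u => γ (u + T₀))
      (fun _ => S.loopField b lam (fun _ => θ (ψ T₀ z₀).1.1) φ Ω dz) (Ici 0) := by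
    rw [hparam]
    refine (hγf.comp_add T₀).mono fun v hv => ?_
    exact ⟨v + T₀, add_nonneg hv hT₀, neg_add_cancel_comm_assoc _ _⟩
  have hzd : Metric.infDist (ψ T₀ z₀) A ≤ d' := habs z₀ hz₀ T₀ le_rfl
  obtain ⟨zs₀, hzs₀, hzs₀d⟩ := hA.isCompact.exists_infDist_eq_dist hA.nonempty (ψ T₀ z₀)
  have herr : ‖steadyError τ σ zs₀ (γ (0 + T₀))‖ ≤ R + C := by
    rw [zero_add]
    exact (hC zs₀ hzs₀ _).trans (by gcongr)
  obtain ⟨zs, hzs, h5, h6⟩ := h _ (hcD (hc z₀ hz₀ T₀ hT₀)) hzd zs₀ hzs₀ hzs₀d.symm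
    (fun u => γ (u + T₀)) hshift
    (fun v hv => by rw [hγz _ (by positivity), Flow.map_add]) herr u hu0
  have hRC : 0 ≤ R + C := (norm_nonneg _).trans herr
  have h7 : Q * Real.exp (-ω * u) * (R + C + d') ≤ ε :=
    le_trans (le_of_eq (by ring)) (hexp u hu)
  refine infDist_image_le hzs _ (h5.trans (le_trans ?_ h7)) (h6.trans (le_trans ?_ h7))
  · gcongr
    linarith
  · gcongr

/-- The limit set of the closed loop is the graph of the steady state over `A`. -/
theorem SteadyState.odeOmega_eq (hs : SteadyState S A ψ b τ σ θ φ Ω L T κ)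
    (hA : AttractingSet S.zeroField D B A ψ K M α d) (hBD : B ⊆ D)
    (hsolv : LoopSolvable S D ψ b lam θ φ Ω dz) (hbdd : LoopBounded S B ψ b lam θ φ Ω dz)
    (hd' : 0 < d') (hconv : ConvergesToSteadyState S D A ψ b lam τ σ θ φ Ω dz d')
    {Y : Set (ErrorState m k)} (hY : IsCompact Y) (hYne : Y.Nonempty) :
    odeOmega (S.loopField b lam θ φ Ω dz) (B ×ˢ Y) = steadyPoint τ σ '' A := by
  refine Subset.antisymm (fun x hx => ?_) ?_
  · refine ((hs.isCompact_image hA.isCompact).isClosed.mem_iff_infDist_zero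
      (hA.nonempty.image _)).2 (le_antisymm (le_of_forall_pos_le_add fun ε hε => ?_)
        Metric.infDist_nonneg)
    obtain ⟨T, -, hT⟩ := hs.eventually_infDist_le hA hBD hsolv hbdd hd' hconv hY hε
    have hcl : IsClosed {x : LoopState p s n m k |
        Metric.infDist x (steadyPoint τ σ '' A) ≤ ε} :=
      isClosed_le (Metric.continuous_infDist_pt _) continuous_const
    have h1 := omegaLimit_subset_closure_image2 (f := atTop)
      (odeFlow (S.loopField b lam θ φ Ω dz)) (B ×ˢ Y) (Ici_mem_atTop T) hx
    rw [zero_add]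
    refine closure_minimal ?_ hcl h1
    rintro _ ⟨t, ht, x, hx, rfl⟩
    exact hT t ht x hx
  · -- the steady state over `z` is the limit of the states at time `t` of the solutions that start
    -- over `ψ (-t) z`, a point of `A`, with a fixed value `y` of the other coordinates
    rintro _ ⟨z, hz, rfl⟩
    obtain ⟨y, hy⟩ := hYne
    obtain ⟨C, hC0, hC⟩ := hs.exists_norm_steadyError_le hA.isCompact
    obtain ⟨Q, ω, hQ, hω, h⟩ := hconv (‖y‖ + C)
    refine (mem_omegaLimit_iff_frequently _ _ _ _).2 fun N hN => Eventually.frequently ?_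
    obtain ⟨ε, hε, hball⟩ := Metric.mem_nhds_iff.1 hN
    obtain ⟨T, hT0, hexp⟩ := exists_exp_le (C := Q * (‖y‖ + C)) hω (half_pos hε)
    filter_upwards [eventually_ge_atTop T] with t ht
    have ht0 : 0 ≤ t := hT0.trans ht
    have hz' := hA.flow_mem z hz (-t)
    refine ⟨(ψ (-t) z, y), ⟨hA.subset_initial hz', hy⟩, hball ?_⟩
    obtain ⟨γ, h0, -, hγf, hγz, hflow⟩ := hsolv _ (hA.subset hz')
      (hA.isIntegralCurveOn _ (hA.subset_initial hz')) y
    rw [hflow t ht0]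
    have hinf : Metric.infDist (ψ (-t) z) A = 0 := Metric.infDist_zero_of_mem hz'
    have herr : ‖steadyError τ σ (ψ (-t) z) (γ 0)‖ ≤ ‖y‖ + C := by
      rw [h0]; exact hC _ hz' _
    obtain ⟨zs, hzs, h5, h6⟩ := h _ (hA.subset hz') (by rw [hinf]; exact hd'.le) _ hz'
      (by rw [dist_self, hinf]) γ hγf hγz herr t ht0
    have hγt : (γ t).1 = z := by
      rw [hγz t ht0, ← Flow.map_add]; simp
    rw [hinf, mul_zero] at h5
    have hzsz : zs = z := by rw [← hγt]; exact (dist_le_zero.1 h5).symm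
    rw [hzsz, hinf, add_zero] at h6
    rw [Metric.mem_ball, dist_steadyPoint, hγt, dist_self]
    refine max_lt hε ?_
    have h7 : Q * Real.exp (-ω * t) * (‖y‖ + C) ≤ ε / 2 :=
      le_trans (le_of_eq (by ring)) (hexp t ht)
    calc _ ≤ Q * Real.exp (-ω * t) * ‖steadyError τ σ (ψ (-t) z) (γ 0)‖ := h6
      _ ≤ Q * Real.exp (-ω * t) * (‖y‖ + C) := by gcongr
      _ < ε := by linarith

end LimitSet

/-! ### Exponential attractivity of the limit set -/

section Assembly

variable {p s n m k : ℕ} {S : Plant p s n} {D B A : Set (ZState p s n)}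
  {ψ : Flow ℝ (ZState p s n)} {θ : (Fin p → ℝ) → Fin k → ℝ} {φ : ℝ → Fin (m + 1) → ℝ}
  {Ω : ℝ → Fin (m + 1) → Fin k → ℝ} {dz : ℝ → ℝ} {K M α d : ℝ}

/-- By compactness the strict bound `ℓ` on the parameters leaves a margin. -/
theorem exists_parameter_bound {P : Set (Fin p → ℝ)} (hP : IsCompact P) (hne : P.Nonempty)
    (hθ : ContinuousOn θ P) {ℓ : ℝ} (hℓ : ∀ ϱ ∈ P, ‖WithLp.toLp 2 (θ ϱ)‖ < ℓ) :
    ∃ ℓ', 0 ≤ ℓ' ∧ ℓ' < ℓ ∧ ∀ ϱ ∈ P, ∀ i, |θ ϱ i| ≤ ℓ' := by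
  obtain ⟨ϱ₀, hϱ₀, hmax⟩ := hP.exists_isMaxOn hne
    (((PiLp.continuous_toLp 2 _).comp_continuousOn hθ).norm)
  exact ⟨‖WithLp.toLp 2 (θ ϱ₀)‖, norm_nonneg _, hℓ ϱ₀ hϱ₀, fun ϱ hϱ i =>
    (PiLp.norm_apply_le (WithLp.toLp 2 (θ ϱ)) i).trans (hmax hϱ)⟩

theorem AttractingSet.loopBounded (hA : AttractingSet S.zeroField D B A ψ K M α d)
    (hφ : ContDiff ℝ 1 φ) (hφs : HasCompactSupport φ) (hΩ : ContDiff ℝ 1 Ω)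
    (hΩs : HasCompactSupport Ω) {ℓ ℓ' : ℝ} (hdz : IsDeadZone ℓ dz) (hℓ' : 0 ≤ ℓ')
    (hθ : ∀ z ∈ B, ∀ i, |θ z.1.1 i| ≤ ℓ') (b : Fin m → ℝ) (lam : ℝ) :
    LoopBounded S B ψ b lam θ φ Ω dz := by
  obtain ⟨Cφ, hCφ⟩ := hφs.exists_bound_of_continuous hφ.continuous
  obtain ⟨C, hC⟩ := hΩs.exists_bound_of_continuous hΩ.continuous
  obtain ⟨c, -, hc, hψc⟩ := hA.bounded
  have hq : Continuous fun z : ZState p s n => S.q (z, 0) :=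
    S.contDiff_q.continuous.comp (by fun_prop)
  obtain ⟨Cq, hCq⟩ := hc.exists_bound_of_continuousOn hq.continuousOn
  intro T hT ρ hρ
  obtain ⟨R, hR⟩ := exists_loop_bound S b lam hCφ hC hdz hℓ' hρ hT (le_max_right Cq 0)
  refine ⟨R, fun z₀ hz₀ γ h0 hγz hγ => hR _ (hθ z₀ hz₀) T ⟨hT, le_rfl⟩ γ h0 (fun u hu => ?_)
    (hγ.mono Icc_subset_Ici_self)⟩
  rw [hγz u hu.1]
  exact (hCq _ (hψc z₀ hz₀ u hu.1)).trans (le_max_left _ _)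

theorem mainTheorem2 {p s n m k : ℕ} (S : Plant p s n)
    (P : Set (Fin p → ℝ)) (W : Set (ExoState p s)) (Z : Set (Fin n → ℝ))
    (hP : IsCompact P) (hW : IsCompact W) (hW_ne : W.Nonempty)
    (hZ : IsCompact Z) (hZ_ne : Z.Nonempty) (hWP : ∀ w ∈ W, w.1 ∈ P)
    (h_i : S.AssumptionI W)
    (𝒵 : Set (ZState p s n)) (h_ii : S.AssumptionII W Z 𝒵)
    (h_iii : S.AssumptionIII W Z)
    (τ : ZState p s n → Fin (m + 1) → ℝ) (θ : (Fin p → ℝ) → Fin k → ℝ)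
    (φ : ℝ → Fin (m + 1) → ℝ) (Ω : ℝ → Fin (m + 1) → Fin k → ℝ)
    (h_iv : S.AssumptionIV P W Z 𝒵 τ θ φ Ω)
    (ℓ : ℝ) (dz : ℝ → ℝ) (hdz : IsDeadZone ℓ dz)
    (hℓ : ∀ ϱ ∈ P, ‖WithLp.toLp 2 (θ ϱ)‖ < ℓ) :
    ∃ μ : ℝ, 0 < μ ∧ ∀ b : Fin m → ℝ, RootsLeftOf b 0 → S.AssumptionV W Z b τ Ω →
      (RootsLeftOf b μ ∨ ∃ L, LipschitzOnWith L (S.sigma b τ Ω) (S.A₀ W Z)) →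
      ∃ lamStar : ℝ, 0 < lamStar ∧ ∀ lam : ℝ, lamStar ≤ lam →
        ∀ (H : Set (Fin (m + 1) → ℝ)) (Θ : Set (Fin k → ℝ)) (Ξ : Set (Fin m → Fin k → ℝ)),
          IsCompact H → H.Nonempty → IsCompact Θ → Θ.Nonempty → IsCompact Ξ → Ξ.Nonempty →
          LocallyExponentiallyAttractive (S.loopField b lam θ φ Ω dz)
            ((W ×ˢ univ) ×ˢ univ)
            (odeOmega (S.loopField b lam θ φ Ω dz) ((W ×ˢ Z) ×ˢ H ×ˢ Θ ×ˢ Ξ)) := by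
  obtain ⟨h𝒵, h𝒵W, horb, -, hd₁⟩ := h_ii
  obtain ⟨⟨U, hU, h𝒵U, hτ⟩, hθc, hφ, hφs, hΩ, hΩs, himm⟩ := h_iv
  obtain ⟨hA𝒵, ψ, K, M, α, d, hA⟩ :=
    exists_attractingSet S.contDiff_zeroField h𝒵 h𝒵W horb hd₁ h_iii
  obtain ⟨ℓ', hℓ'0, hℓ'ℓ, hθ⟩ :=
    exists_parameter_bound hP (hW_ne.image Prod.fst |>.mono (image_subset_iff.2 hWP)) hθc hℓ
  have hDP : ∀ z ∈ W ×ˢ (univ : Set (Fin n → ℝ)), z.1.1 ∈ P := fun z hz => hWP _ hz.1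
  have hBD : W ×ˢ Z ⊆ W ×ˢ (univ : Set (Fin n → ℝ)) := prod_mono_right (subset_univ Z)
  obtain ⟨Lφ, hLφ⟩ := hφ.lipschitzWith_of_hasCompactSupport hφs one_ne_zero
  obtain ⟨LΩ, hLΩ⟩ := hΩ.lipschitzWith_of_hasCompactSupport hΩs one_ne_zero
  obtain ⟨C, hC⟩ := hΩs.exists_bound_of_continuous hΩ.continuous
  have hK := hA.nonneg_K
  -- orbits in `𝒜₀` separate at most at the rate `K`, so that a decay rate `K + 1` of `F` makes `σ`
  -- Lipschitz
  refine ⟨K + 1, by positivity, fun b hb hpe hσ => ?_⟩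
  obtain ⟨r, a, hinj, hr, ha0, ha, hσ'⟩ : ∃ (r : Fin m → ℂ) (a : ℝ), Function.Injective r ∧
      (∀ i, (polyB b).eval (r i) = 0) ∧ 0 < a ∧ (∀ i, (r i).re ≤ -a) ∧
      (K < a ∨ ∃ L, LipschitzOnWith L (S.sigma b τ Ω) (S.A₀ W Z)) := by
    rcases hσ with hμ | hLip
    · obtain ⟨r, hinj, hr, hre⟩ := hμ.exists_roots
      exact ⟨r, K + 1, hinj, hr, by positivity, fun i => (hre i).le, Or.inl (lt_add_one K)⟩
    · obtain ⟨r, hinj, hr, hre⟩ := hb.exists_roots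
      obtain ⟨a, ha0, ha⟩ := exists_re_le_neg hre
      exact ⟨r, a, hinj, hr, ha0, ha, Or.inr hLip⟩
  obtain ⟨Cf, hCf, hF⟩ := exists_norm_exp_le hinj hr ha
  obtain ⟨L, T, κ, hs⟩ := exists_steadyState hA hU (hA𝒵.trans h𝒵U) hτ hφ hφs hΩ hΩs
    (fun z hz => (pi_norm_le_iff_of_nonneg hℓ'0).2 (hθ _ (hDP z (hA.subset hz)))) himm hF hCf.le
    ha0 hσ' hpe
  obtain ⟨lamStar, hpos, hlam⟩ := hs.exists_loop_convergence hA hDP hθc hLφ hLΩ hC hdz hℓ'0 hℓ'ℓ hθ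
    hinj hr ha0 ha
  refine ⟨lamStar, hpos, fun lam hle H Θ Ξ hH hHne hΘ hΘne hΞ hΞne => ?_⟩
  obtain ⟨d', hd'0, hd', hconv⟩ := hlam lam hle
  have hsolv : LoopSolvable S (W ×ˢ univ) ψ b lam θ φ Ω dz := fun z₀ hz₀ hz y =>
    exists_loop_solution hφ hφs hΩ hΩs hdz hz hℓ'0 (hθ _ (hDP z₀ hz₀)) b lam y
  have hbdd : LoopBounded S (W ×ˢ Z) ψ b lam θ φ Ω dz :=
    hA.loopBounded hφ hφs hΩ hΩs hdz hℓ'0 (fun z hz => hθ _ (hDP z (hBD hz))) b lam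
  rw [hs.odeOmega_eq hA hBD hsolv hbdd hd'0 hconv (hH.prod (hΘ.prod hΞ))
    (hHne.prod (hΘne.prod hΞne))]
  exact hs.locallyExponentiallyAttractive hA hsolv hd'0 hd' hconv

end Assembly

end
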